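/- For $n\ge 1$ let $c(n)=0$ if $n\equiv 0$, $c(n)=1$ if $n\equiv 1$, and $c(n)=2$ if $n\equiv 2$ or $3 \pmod 4$. Let $V_n$ be the set of vectors $v\in\mathbb{R}^n$ with all coordinates in $\{-1,0,1\}$ and Euclidean length $|v|=\sqrt 3$, and let $G_n$ be the graph with vertex set $V_n$ in which two vectors are adjacent if and only if their scalar product equals $1$. Let $\chi(G)$ denote the chromatic number of a graph $G$ and $\alpha(G)$ its independence number (the maximum size of a set of pairwise non-adjacent vertices). Let $\chi(\mathbb{R}^n)$ (respectively $\chi(\mathbb{Q}^n)$) be the minimum number of colors needed to color all points of $\mathbb{R}^n$ (respectively all points of $\mathbb{R}^n$ with rational coordinates) so that any two points at Euclidean distance $1$ receive different colors. Then for all $n\ge 3$ $$\chi(\mathbb{R}^n)\ \ge\ \chi(\mathbb{Q}^n)\ \ge\ \chi(G_n)\ \ge\ \frac{|V_n|}{\alpha(G_n)}\ =\ \frac{8\binom{n}{3}}{\max\{6n-28,\;4n-4c(n)\}}.$$ In particular, $\chi(\mathbb{R}^9)\ge\chi(\mathbb{Q}^9)\ge 21$, $\chi(\mathbb{R}^{10})\ge\chi(\mathbb{Q}^{10})\ge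 30$, $\chi(\mathbb{R}^{11})\ge\chi(\mathbb{Q}^{11})\ge 35$ and $\chi(\mathbb{R}^{12})\ge\chi(\mathbb{Q}^{12})\ge 37$. -/

import Mathlib

/-- The constant `c(n)`: it is `0` if `n ≡ 0`, `1` if `n ≡ 1`, and `2` if `n ≡ 2` or `n ≡ 3`
modulo `4`. -/
def cConst (n : ℕ) : ℕ :=
  if n % 4 = 0 then 0 else if n % 4 = 1 then 1 else 2

/-- The unit distance graph on the whole Euclidean space `ℝⁿ`. -/
def unitDistanceGraph (n : ℕ) : SimpleGraph (EuclideanSpace ℝ (Fin n)) where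
  Adj x y := dist x y = 1
  symm := ⟨fun x y h => by rw [dist_comm]; exact h⟩
  loopless := ⟨fun x h => by simp at h⟩

/-- The set `ℚⁿ` of points of `ℝⁿ` all of whose coordinates are rational. -/
def rationalPoints (n : ℕ) : Set (EuclideanSpace ℝ (Fin n)) :=
  {x | ∀ i, ∃ q : ℚ, x i = (q : ℝ)}

/-- The chromatic number `χ(ℝⁿ)`: the least number of colours in a colouring of `ℝⁿ` in which
points at Euclidean distance `1` receive different colours. -/
noncomputable def chiR (n : ℕ) : ℕ∞ := (unitDistanceGraph n).chromaticNumber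

/-- The chromatic number `χ(ℚⁿ)`: the same for the points with rational coordinates. -/
noncomputable def chiQ (n : ℕ) : ℕ∞ :=
  ((unitDistanceGraph n).induce (rationalPoints n)).chromaticNumber

/-- The vertex set `V_n`: the vectors of `ℝⁿ` with coordinates in `{-1, 0, 1}` and of
Euclidean length `√3`. -/
def vertexSet (n : ℕ) : Set (EuclideanSpace ℝ (Fin n)) :=
  {v | (∀ i, v i = -1 ∨ v i = 0 ∨ v i = 1) ∧ ‖v‖ = Real.sqrt 3}

/-- The graph `G_n` on `V_n`: two vectors are adjacent iff their scalar product is `1`. -/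
def graphG (n : ℕ) : SimpleGraph (vertexSet n) where
  Adj u v := inner ℝ (u : EuclideanSpace ℝ (Fin n)) (v : EuclideanSpace ℝ (Fin n)) = 1
  symm := ⟨fun u v h => by rw [real_inner_comm]; exact h⟩
  loopless := ⟨fun u h => by
    rw [real_inner_self_eq_norm_sq, u.2.2, Real.sq_sqrt (by norm_num)] at h
    norm_num at h⟩

/-!
The inequalities between the chromatic numbers are formal: the unit distance graph on `ℚⁿ` is an
induced subgraph of the one on `ℝⁿ`; adjacent vectors of `G_n` have distance `2`, so `v ↦ v / 2`
maps `G_n` to the unit distance graph on `ℚⁿ`; and colour classes are independent sets. As `G_n`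
has `8 * n.choose 3` vertices, everything rests on the value `alphaBound n` of its independence
number.

**Lower bound.** On four coordinates, the vectors with an even number of negative entries are
pairwise non-adjacent. Disjoint blocks of four, with one block of three if it fits, give
`4 (n - c(n))` vectors. For `n ≥ 6`, two disjoint triangles of coordinates carry four vectors
each, and six further vectors join them to each coordinate outside; this gives `6 n - 28` vectors.

**Upper bound.** An independent set is replaced by a `SignedTriples`: the system of the supports
of its vectors, with the signs that occur at each element of a support. Two vectors whose supports
have just one common element must have opposite signs there. Hence two triples with one common
element use one sign each at it, and opposite ones (`SignedTriples.conflict`). If `0`, `1` or more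
elements of a triple use only one sign, then the triple carries at most `4`, `2` or `1` vectors,
which is its weight `w` (`card_fiber_le_w`). It remains to bound the total weight of the triples
on a set of `n` elements by `alphaBound n` (`SignedTriples.sum_w_le`). The names below belong to
the namespace `SignedTriples`.

The obstruction to a local bound are the pairs in four or more triples, called core pairs. They
form a graph of maximal degree two (`core.eq_or_eq`), because a triple through `u` contains one of
any two core neighbours of `u` (`core.mem_or_mem`). Outside the core, the triples at an element
that use a given sign pairwise meet in a second element, and there are at most three of them
(`card_cls_le`). At a core vertex `u` with the only core neighbour `v`, at most three triples
avoid `v` (`card_ex_le`).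

The weight of each triple is now distributed over its elements (`share`, `sum_share`), in such a
way that the total `ch x` given to `x` is small for all `x`. In a triple with one core pair, the
third element receives everything, or half of the weight if the triple uses both signs on the
whole pair and another triple separates the pair (`irr`). The middle of two core pairs receives
everything, a core triangle shares equally, and a triple without core pairs favours its core
vertices. In general an element outside the core gets at most `6`, and a core vertex at most `4`;
the gain comes from the vertices that stay well below.

* Two core triangles: their six vertices get `4 / 3` each, whence `6 n - 28`.
* One core triangle: the others get at most `4`, or at most `5` with a further saving on core
  vertices outside the triangle. This gives `4 n - 8`, or `5 n - 18`, the mean of `4 n - 8` and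
  `6 n - 28`.
* No core triangle, but a core pair that no triple separates or a core vertex with two core
  neighbours: everything gets at most `4`, and around this pair or vertex `8` is saved in all, or
  `15 / 2`, which is as good because the total is an integer.
* The core pairs form a matching, and each is separated by some triple: here a triple of weight
  `4` off the core that meets another triple off the core is dangerous. But then some four
  elements meet triples of total weight at most `16` (`exists_removal`), and they can be removed
  by induction, as `alphaBound (n - 4) + 16` is at most `alphaBound n`. Otherwise every element
  gets at most `3`, which suffices for `n ≥ 8` and is improved for smaller `n`.
* No core pairs: after the same removals, every element gets at most `5 / 2`.
-/

/-! ### Signed triple systems -/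

open Classical in
/-- A family of triples in which each triple `T` uses, at each of its elements `x`, one or both
signs; `side x s T` says that the sign `s` is used. It abstracts an independent set of `G_n`: the
triples are the supports of the vectors, and two triples using a common sign at a common element
have a second common element. -/
structure SignedTriples (V : Type*) where
  H : Finset (Finset V)
  side : V → Bool → Finset V → Prop
  card_eq : ∀ T ∈ H, T.card = 3
  exists_side : ∀ T ∈ H, ∀ x ∈ T, ∃ s, side x s T
  meet : ∀ T ∈ H, ∀ T' ∈ H, ∀ x s, x ∈ T → x ∈ T' → side x s T → side x s T' →
    ∃ y, y ≠ x ∧ y ∈ T ∧ y ∈ T'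

namespace SignedTriples

noncomputable section

open Classical

variable {V : Type*} (C : SignedTriples V) {T T' : Finset V} {a b c u v x y z : V}

/-- The triple `T` uses only one sign at `x`. -/
def mono (x : V) (T : Finset V) : Prop := ∃ s, ¬ C.side x s T

/-- The largest number of vectors that a support `T` can carry: `4`, `2` or `1`, according to
whether the number of elements at which only one sign is used is `0`, `1` or at least `2`. -/
def w (T : Finset V) : ℕ :=
  if (T.filter (C.mono · T)).card = 0 then 4 else if (T.filter (C.mono · T)).card = 1 then 2 else 1

/-- The number of triples through the pair `u`, `v`. -/
def codeg (u v : V) : ℕ := (C.H.filter fun T => u ∈ T ∧ v ∈ T).card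

/-- A core pair: a pair lying in at least four triples. -/
def core (u v : V) : Prop := u ≠ v ∧ 4 ≤ C.codeg u v

/-- A core vertex: an element of a core pair. -/
def isCore (u : V) : Prop := ∃ v, C.core u v

/-- No triple separates `u` from `v`. -/
def clean (u v : V) : Prop := ∀ T ∈ C.H, u ∈ T ↔ v ∈ T

/-- The triples through `u` that avoid `v`. -/
def ex (u v : V) : Finset (Finset V) := C.H.filter fun T => u ∈ T ∧ v ∉ T

variable {C}

lemma exists_eq (hT : T ∈ C.H) (hx : x ∈ T) :
    ∃ y z, x ≠ y ∧ x ≠ z ∧ y ≠ z ∧ T = {x, y, z} := by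
  obtain ⟨a, b, c, hab, hac, hbc, rfl⟩ := Finset.card_eq_three.1 (C.card_eq T hT)
  simp only [Finset.mem_insert, Finset.mem_singleton] at hx
  rcases hx with rfl | rfl | rfl
  · exact ⟨b, c, hab, hac, hbc, rfl⟩
  · exact ⟨a, c, hab.symm, hbc, hac, by ext; simp; tauto⟩
  · exact ⟨a, b, hac.symm, hbc.symm, hab, by ext; simp; tauto⟩

lemma eq_triple (hT : T ∈ C.H) (ha : a ∈ T) (hb : b ∈ T) (hc : c ∈ T) (hab : a ≠ b) (hac : a ≠ c)
    (hbc : b ≠ c) : T = {a, b, c} := by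
  symm
  apply Finset.eq_of_subset_of_card_le
  · intro i; simp; rintro (rfl | rfl | rfl) <;> assumption
  · rw [C.card_eq T hT, Finset.card_eq_three.2 ⟨a, b, c, hab, hac, hbc, rfl⟩]

lemma eq_of_mem (hT : T ∈ C.H) (hT' : T' ∈ C.H) (ha : a ∈ T) (hb : b ∈ T) (hc : c ∈ T)
    (ha' : a ∈ T') (hb' : b ∈ T') (hc' : c ∈ T') (hab : a ≠ b) (hac : a ≠ c) (hbc : b ≠ c) :
    T = T' := by
  rw [eq_triple hT ha hb hc hab hac hbc, eq_triple hT' ha' hb' hc' hab hac hbc]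

lemma exists_eq_pair (hT : T ∈ C.H) (hu : u ∈ T) (hv : v ∈ T) (h : u ≠ v) :
    ∃ x, x ≠ u ∧ x ≠ v ∧ T = {u, v, x} := by
  obtain ⟨y, z, hy, hz, hyz, rfl⟩ := exists_eq hT hu
  simp only [Finset.mem_insert, Finset.mem_singleton] at hv
  rcases hv with rfl | rfl | rfl
  · exact absurd rfl h
  · exact ⟨z, hz.symm, hyz.symm, rfl⟩
  · exact ⟨y, hy.symm, hyz, by ext; simp; tauto⟩

/-- Two triples with exactly one common element use opposite signs there, hence one sign each. -/
lemma conflict (hT : T ∈ C.H) (hT' : T' ∈ C.H) (hx : x ∈ T) (hx' : x ∈ T')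
    (h : ∀ y, y ∈ T → y ∈ T' → y = x) :
    ∀ s, C.side x s T → ¬ C.side x s T' := by
  intro s h1 h2
  obtain ⟨y, hy, hyT, hyT'⟩ := C.meet T hT T' hT' x s hx hx' h1 h2
  exact hy (h y hyT hyT')

lemma mono_of_conflict (hT : T ∈ C.H) (hT' : T' ∈ C.H) (hx : x ∈ T) (hx' : x ∈ T')
    (h : ∀ y, y ∈ T → y ∈ T' → y = x) : C.mono x T := by
  obtain ⟨s, hs⟩ := C.exists_side T' hT' x hx'
  exact ⟨s, fun h1 => conflict hT hT' hx hx' h s h1 hs⟩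

lemma side_of_not_mono (h : ¬ C.mono x T) (s : Bool) : C.side x s T := by
  by_contra h1; exact h ⟨s, h1⟩

lemma not_side_of_mono (hm : C.mono x T) {s : Bool} (hs : C.side x s T) : ¬ C.side x (!s) T := by
  obtain ⟨t, ht⟩ := hm
  have : t = !s := by
    cases s <;> cases t <;> simp_all
  exact this ▸ ht

lemma side_not (hT : T ∈ C.H) (hx : x ∈ T) {s : Bool} (hs : ¬ C.side x s T) : C.side x (!s) T := by
  obtain ⟨t, ht⟩ := C.exists_side T hT x hx
  have : t = !s := by
    cases s <;> cases t <;> first | rfl | exact absurd ht hs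
  exact this ▸ ht

lemma w_pos : 1 ≤ C.w T := by unfold w; split_ifs <;> norm_num

lemma w_le_four : C.w T ≤ 4 := by unfold w; split_ifs <;> norm_num

lemma w_le_two (hx : x ∈ T) (hm : C.mono x T) : C.w T ≤ 2 := by
  have : 0 < (T.filter (C.mono · T)).card := Finset.card_pos.2 ⟨x, by simp [hx, hm]⟩
  unfold w; split_ifs <;> omega

lemma w_eq_one (hx : x ∈ T) (hy : y ∈ T) (hxy : x ≠ y) (hm : C.mono x T) (hm' : C.mono y T) :
    C.w T = 1 := by
  have : 1 < (T.filter (C.mono · T)).card :=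
    Finset.one_lt_card.2 ⟨x, by simp [hx, hm], y, by simp [hy, hm'], hxy⟩
  unfold w; split_ifs <;> omega

lemma w_eq_four (h : ∀ x ∈ T, ¬ C.mono x T) : C.w T = 4 := by
  unfold w; rw [if_pos]; simpa [Finset.filter_eq_empty_iff] using h

lemma not_mono_of_w_eq_four (h : C.w T = 4) (hx : x ∈ T) : ¬ C.mono x T := by
  intro hm; have := w_le_two hx hm; omega

/-- The weight determines how many elements are `mono`. -/
lemma not_mono_of_w_eq_two (h : C.w T = 2) (hx : x ∈ T) (hm : C.mono x T) (hy : y ∈ T)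
    (hxy : x ≠ y) : ¬ C.mono y T := by
  intro hm'; have := w_eq_one hx hy hxy hm hm'; omega

lemma codeg_comm : C.codeg u v = C.codeg v u := by
  unfold codeg; congr 1; ext T; simp [and_comm]

lemma core.symm (h : C.core u v) : C.core v u := ⟨h.1.symm, by rw [codeg_comm]; exact h.2⟩

lemma core_comm : C.core u v ↔ C.core v u := ⟨core.symm, core.symm⟩

lemma core.isCore (h : C.core u v) : C.isCore u := ⟨v, h⟩

lemma clean.symm (h : C.clean u v) : C.clean v u := fun T hT => (h T hT).symm

lemma clean_comm : C.clean u v ↔ C.clean v u := ⟨clean.symm, clean.symm⟩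

/-- If a family of triples through `u`, `v` is hit by a set `S` outside `u`, `v`, then it has at
most `|S|` members. -/
lemma card_le_of_hit (huv : u ≠ v) {A : Finset (Finset V)} (hA : ∀ T ∈ A, T ∈ C.H ∧ u ∈ T ∧ v ∈ T)
    (S : Finset V) (h : ∀ T ∈ A, ∃ y ∈ S, y ≠ u ∧ y ≠ v ∧ y ∈ T) : A.card ≤ S.card := by
  have : Nonempty V := ⟨u⟩
  choose! g hg using h
  refine Finset.card_le_card_of_injOn g (fun T hT => (hg T hT).1) fun T hT T' hT' heq => ?_
  have h1 := hg T hT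
  have h2 := hg T' hT'
  have a1 := hA T hT
  have a2 := hA T' hT'
  exact eq_of_mem a1.1 a2.1 a1.2.1 a1.2.2 h1.2.2.2 a2.2.1 a2.2.2 (heq ▸ h2.2.2.2) huv
    h1.2.1.symm h1.2.2.1.symm

lemma codeg_le_card (huv : u ≠ v) (S : Finset V)
    (h : ∀ T ∈ C.H, u ∈ T → v ∈ T → ∃ y ∈ S, y ≠ u ∧ y ≠ v ∧ y ∈ T) : C.codeg u v ≤ S.card :=
  card_le_of_hit huv (fun T hT => by simpa using hT) S fun T hT => by
    simp only [Finset.mem_filter] at hT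
    exact h T hT.1 hT.2.1 hT.2.2

/-- A core pair has a triple whose third element avoids three given ones. -/
lemma core.exists_avoid (h : C.core u v) (p q r : V) :
    ∃ x, x ≠ u ∧ x ≠ v ∧ x ≠ p ∧ x ≠ q ∧ x ≠ r ∧ ({u, v, x} : Finset V) ∈ C.H := by
  by_contra hcon
  push Not at hcon
  have : C.codeg u v ≤ ({p, q, r} : Finset V).card := by
    refine codeg_le_card h.1 _ fun T hT hu hv => ?_
    obtain ⟨x, hxu, hxv, rfl⟩ := exists_eq_pair hT hu hv h.1
    by_contra hx
    refine hcon x hxu hxv ?_ ?_ ?_ hT <;>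
    · rintro rfl
      exact hx ⟨x, by simp, hxu, hxv, by simp⟩
  have := Finset.card_le_three (a := p) (b := q) (c := r)
  have := h.2
  omega

/-- If `u` lies in two core pairs, then every triple through `u` contains one of them. -/
lemma core.mem_or_mem {v' : V} (h : C.core u v) (h' : C.core u v') (hv : v ≠ v') (hT : T ∈ C.H)
    (hu : u ∈ T) : v ∈ T ∨ v' ∈ T := by
  by_contra hcon
  push Not at hcon
  obtain ⟨p, q, hp, hq, hpq, rfl⟩ := exists_eq hT hu
  obtain ⟨y, hyu, hyv, hyp, hyq, hyv', hy⟩ := h.exists_avoid p q v'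
  obtain ⟨y', hyu', hyv1, hyp', hyq', hyv1', hy'⟩ := h'.exists_avoid p q v
  obtain ⟨x, hxu, hxv, hxv', hxy, -, hx⟩ := h.exists_avoid v' y y
  obtain ⟨x', hxu', hxv1, hxv1', hxy', hxx, hx'⟩ := h'.exists_avoid v y x
  simp only [Finset.mem_insert, Finset.mem_singleton] at hcon
  obtain ⟨s, hs⟩ := C.exists_side _ hT u (by simp)
  obtain ⟨s1, hs1⟩ := C.exists_side _ hy u (by simp)
  obtain ⟨s2, hs2⟩ := C.exists_side _ hy' u (by simp)
  obtain ⟨s3, hs3⟩ := C.exists_side _ hx u (by simp)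
  obtain ⟨s4, hs4⟩ := C.exists_side _ hx' u (by simp)
  have c1 := conflict (x := u) hT hy (by simp) (by simp) (by grind)
  have c2 := conflict (x := u) hT hy' (by simp) (by simp) (by grind)
  by_cases hyy : y = y'
  · have c3 := conflict (x := u) hx hy' (by simp) (by simp) (by grind)
    have c4 := conflict (x := u) hx' hy (by simp) (by simp) (by grind)
    have c5 := conflict (x := u) hx hx' (by simp) (by simp) (by grind)
    cases s <;> cases s1 <;> cases s2 <;> cases s3 <;> cases s4 <;> simp_all
  · have c3 := conflict (x := u) hy hy' (by simp) (by simp) (by grind)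
    cases s <;> cases s1 <;> cases s2 <;> simp_all

/-- A vertex is in at most two core pairs. -/
lemma core.eq_or_eq {v' t : V} (h : C.core u v) (h' : C.core u v') (hv : v ≠ v') (ht : C.core u t) :
    t = v ∨ t = v' := by
  by_contra hcon
  push Not at hcon
  obtain ⟨x, hxu, hxt, hxv, hxv', -, hx⟩ := ht.exists_avoid v v' v
  have := h.mem_or_mem h' hv hx (by simp)
  have := h.1; have := h'.1
  grind

/-- A triple containing just one of two core pairs at `u` uses one sign at `u`. -/
lemma core.mono {v' : V} (h' : C.core u v') (hT : T ∈ C.H) (hu : u ∈ T) (hv : v' ∉ T) :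
    C.mono u T := by
  obtain ⟨p, q, hp, hq, hpq, rfl⟩ := exists_eq hT hu
  obtain ⟨x, hxu, hxv, hxp, hxq, -, hx⟩ := h'.exists_avoid p q p
  exact mono_of_conflict hT hx (by simp) (by simp) (by grind)

/-- Triples through `x` that pairwise meet outside `x` either all contain a second point, or there
are at most three of them. -/
lemma card_le_three_or_star {A : Finset (Finset V)} (hA : A ⊆ C.H) (hx : ∀ T ∈ A, x ∈ T)
    (hmeet : ∀ T ∈ A, ∀ T' ∈ A, ∃ y, y ≠ x ∧ y ∈ T ∧ y ∈ T') :
    A.card ≤ 3 ∨ ∃ q, q ≠ x ∧ ∀ T ∈ A, q ∈ T := by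
  by_cases hcard : A.card ≤ 1
  · exact Or.inl (by omega)
  obtain ⟨T₁, h₁, T₂, h₂, hne⟩ := Finset.one_lt_card.1 (not_le.1 hcard)
  obtain ⟨a, hax, ha₁, ha₂⟩ := hmeet T₁ h₁ T₂ h₂
  obtain ⟨b, hbx, hba, rfl⟩ := exists_eq_pair (hA h₁) (hx _ h₁) ha₁ hax.symm
  obtain ⟨c, hcx, hca, rfl⟩ := exists_eq_pair (hA h₂) (hx _ h₂) ha₂ hax.symm
  have hbc : b ≠ c := by rintro rfl; exact hne rfl
  by_cases hstar : ∀ T ∈ A, a ∈ T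
  · exact Or.inr ⟨a, hax, hstar⟩
  push Not at hstar
  obtain ⟨T₃, h₃, ha₃⟩ := hstar
  obtain ⟨y, hy, hy1, hy2⟩ := hmeet _ h₃ _ h₁
  obtain ⟨z, hz, hz1, hz2⟩ := hmeet _ h₃ _ h₂
  have hb3 : b ∈ T₃ := by grind
  have hc3 : c ∈ T₃ := by grind
  have e3 := eq_triple (hA h₃) (hx _ h₃) hb3 hc3 hbx.symm hcx.symm hbc
  subst e3
  left
  refine (Finset.card_le_card (t := {{x, a, b}, {x, a, c}, {x, b, c}}) ?_).trans
    Finset.card_le_three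
  intro T hT
  obtain ⟨y1, hy1, hy1T, h1'⟩ := hmeet _ hT _ h₁
  obtain ⟨y2, hy2, hy2T, h2'⟩ := hmeet _ hT _ h₂
  obtain ⟨y3, hy3, hy3T, h3'⟩ := hmeet _ hT _ h₃
  have hxT := hx _ hT
  have hTH := hA hT
  have key : (a ∈ T ∧ b ∈ T) ∨ (a ∈ T ∧ c ∈ T) ∨ (b ∈ T ∧ c ∈ T) := by grind
  simp only [Finset.mem_insert, Finset.mem_singleton]
  rcases key with ⟨h1, h2⟩ | ⟨h1, h2⟩ | ⟨h1, h2⟩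
  · left; exact eq_triple hTH hxT h1 h2 hax.symm hbx.symm hba.symm
  · right; left; exact eq_triple hTH hxT h1 h2 hax.symm hcx.symm hca.symm
  · right; right; exact eq_triple hTH hxT h1 h2 hbx.symm hcx.symm hbc

lemma mem_ex : T ∈ C.ex u v ↔ T ∈ C.H ∧ u ∈ T ∧ v ∉ T := by simp [ex]

lemma card_le_codeg {A : Finset (Finset V)} (h : ∀ T ∈ A, T ∈ C.H ∧ u ∈ T ∧ v ∈ T) :
    A.card ≤ C.codeg u v :=
  Finset.card_le_card fun T hT => by simpa using h T hT

lemma codeg_le_three (huv : u ≠ v) (h : ¬ C.core u v) : C.codeg u v ≤ 3 := by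
  by_contra h'; exact h ⟨huv, by omega⟩

/-- The triples at a vertex `u` that use the sign `s` there. -/
def cls (C : SignedTriples V) (u : V) (s : Bool) : Finset (Finset V) :=
  C.H.filter fun T => u ∈ T ∧ C.side u s T

lemma mem_cls {s : Bool} : T ∈ C.cls u s ↔ T ∈ C.H ∧ u ∈ T ∧ C.side u s T := by simp [cls]

lemma cls_meet {s : Bool} (hT : T ∈ C.cls u s) (hT' : T' ∈ C.cls u s) :
    ∃ y, y ≠ u ∧ y ∈ T ∧ y ∈ T' := by
  rw [mem_cls] at hT hT'
  exact C.meet _ hT.1 _ hT'.1 u s hT.2.1 hT'.2.1 hT.2.2 hT'.2.2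

/-- Away from the core, each sign class has at most three triples. -/
lemma card_cls_le (hx : ¬ C.isCore x) (s : Bool) : (C.cls x s).card ≤ 3 := by
  rcases card_le_three_or_star (C := C) (A := C.cls x s) (x := x)
    (fun T hT => (mem_cls.1 hT).1) (fun T hT => (mem_cls.1 hT).2.1)
    (fun T hT T' hT' => cls_meet hT hT') with h | ⟨q, hq, h⟩
  · exact h
  · refine (card_le_codeg (u := x) (v := q) fun T hT => ?_).trans
      (codeg_le_three hq.symm fun h' => hx ⟨q, h'⟩)
    have := mem_cls.1 hT
    exact ⟨this.1, this.2.1, h T hT⟩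

/-- If two triples avoid the core neighbour `v` of `u` and use opposite signs at `u`, then they
split the third elements of the triples on `u`, `v` between them, and no other triple through `u`
avoids `v`. -/
lemma ex_subset_pair {T₁ T₂ : Finset V} (h : C.core u v) (h₁ : T₁ ∈ C.ex u v) (h₂ : T₂ ∈ C.ex u v)
    (f₁ : ¬ C.side u true T₁) (f₂ : ¬ C.side u false T₂) : C.ex u v ⊆ {T₁, T₂} := by
  have m₁ := mem_ex.1 h₁
  have m₂ := mem_ex.1 h₂
  have g₁ : C.side u false T₁ := by
    obtain ⟨s, hs⟩ := C.exists_side _ m₁.1 u m₁.2.1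
    cases s
    · exact hs
    · exact absurd hs f₁
  have g₂ : C.side u true T₂ := by
    obtain ⟨s, hs⟩ := C.exists_side _ m₂.1 u m₂.2.1
    cases s
    · exact absurd hs f₂
    · exact hs
  have cover : ∀ A B : Finset V, A ∈ C.ex u v → B ∈ C.ex u v → C.side u false A →
      C.side u true B → ∀ T ∈ C.H, u ∈ T → v ∈ T → ∃ y, y ≠ u ∧ y ≠ v ∧ y ∈ T ∧ (y ∈ A ∨ y ∈ B) := by
    intro A B hA hB sA sB T hT huT hvT
    have hA := mem_ex.1 hA
    have hB := mem_ex.1 hB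
    obtain ⟨y, hyu, hyv, rfl⟩ := exists_eq_pair hT huT hvT h.1
    by_contra hcon
    push Not at hcon
    have hy := hcon y hyu hyv (by simp)
    obtain ⟨s, hs⟩ := C.exists_side _ hT u (by simp)
    cases s
    · exact conflict hT hA.1 (by simp) hA.2.1 (by grind) _ hs sA
    · exact conflict hT hB.1 (by simp) hB.2.1 (by grind) _ hs sB
  obtain ⟨p, q, hp, hq, hpq, e₁⟩ := exists_eq m₁.1 m₁.2.1
  obtain ⟨p', q', hp', hq', hpq', e₂⟩ := exists_eq m₂.1 m₂.2.1
  have uniq₁ : ∀ A ∈ C.ex u v, C.side u false A → A = T₁ := by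
    intro A hA sA
    have mA := mem_ex.1 hA
    have hpA : p ∈ A := by
      obtain ⟨x, hxu, hxv, hx1, hx2, hx3, hx⟩ := h.exists_avoid p' q' q
      obtain ⟨y, hy⟩ := cover T₁ T₂ h₁ h₂ g₁ g₂ _ hx (by simp) (by simp)
      obtain ⟨z, hz⟩ := cover A T₂ hA h₂ sA g₂ _ hx (by simp) (by simp)
      grind
    have hqA : q ∈ A := by
      obtain ⟨x, hxu, hxv, hx1, hx2, hx3, hx⟩ := h.exists_avoid p' q' p
      obtain ⟨y, hy⟩ := cover T₁ T₂ h₁ h₂ g₁ g₂ _ hx (by simp) (by simp)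
      obtain ⟨z, hz⟩ := cover A T₂ hA h₂ sA g₂ _ hx (by simp) (by simp)
      grind
    rw [e₁]; exact eq_triple mA.1 mA.2.1 hpA hqA hp hq hpq
  have uniq₂ : ∀ B ∈ C.ex u v, C.side u true B → B = T₂ := by
    intro A hA sA
    have mA := mem_ex.1 hA
    have hpA : p' ∈ A := by
      obtain ⟨x, hxu, hxv, hx1, hx2, hx3, hx⟩ := h.exists_avoid p q q'
      obtain ⟨y, hy⟩ := cover T₁ T₂ h₁ h₂ g₁ g₂ _ hx (by simp) (by simp)
      obtain ⟨z, hz⟩ := cover T₁ A h₁ hA g₁ sA _ hx (by simp) (by simp)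
      grind
    have hqA : q' ∈ A := by
      obtain ⟨x, hxu, hxv, hx1, hx2, hx3, hx⟩ := h.exists_avoid p q p'
      obtain ⟨y, hy⟩ := cover T₁ T₂ h₁ h₂ g₁ g₂ _ hx (by simp) (by simp)
      obtain ⟨z, hz⟩ := cover T₁ A h₁ hA g₁ sA _ hx (by simp) (by simp)
      grind
    rw [e₂]; exact eq_triple mA.1 mA.2.1 hpA hqA hp' hq' hpq'
  intro A hA
  obtain ⟨s, hs⟩ := C.exists_side _ (mem_ex.1 hA).1 u (mem_ex.1 hA).2.1
  cases s
  · simp [uniq₁ A hA hs]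
  · simp [uniq₂ A hA hs]

/-- At an end `u` of the core, with core neighbour `v`, at most three triples avoid `v`. -/
lemma card_ex_le (h : C.core u v) (hu : ∀ t, C.core u t → t = v) : (C.ex u v).card ≤ 3 := by
  by_cases hs : ∃ s, C.ex u v ⊆ C.cls u s
  · obtain ⟨s, hs⟩ := hs
    rcases card_le_three_or_star (C := C) (A := C.ex u v) (x := u)
      (fun T hT => (mem_ex.1 hT).1) (fun T hT => (mem_ex.1 hT).2.1)
      (fun T hT T' hT' => cls_meet (hs hT) (hs hT')) with h3 | ⟨q, hq, h3⟩
    · exact h3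
    · by_cases hqv : q = v
      · subst hqv
        rw [Finset.card_eq_zero.2]
        · norm_num
        · refine Finset.eq_empty_of_forall_notMem fun T hT => (mem_ex.1 hT).2.2 (h3 T hT)
      refine (card_le_codeg (u := u) (v := q) fun T hT => ?_).trans
        (codeg_le_three hq.symm fun h' => hqv (hu _ h'))
      have := mem_ex.1 hT
      exact ⟨this.1, this.2.1, h3 T hT⟩
  · push Not at hs
    obtain ⟨T₁, h₁, h₁'⟩ := Finset.not_subset.1 (hs true)
    obtain ⟨T₂, h₂, h₂'⟩ := Finset.not_subset.1 (hs false)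
    have m₁ := mem_ex.1 h₁
    have m₂ := mem_ex.1 h₂
    have f₁ : ¬ C.side u true T₁ := fun h => h₁' (mem_cls.2 ⟨m₁.1, m₁.2.1, h⟩)
    have f₂ : ¬ C.side u false T₂ := fun h => h₂' (mem_cls.2 ⟨m₂.1, m₂.2.1, h⟩)
    exact (Finset.card_le_card (ex_subset_pair h h₁ h₂ f₁ f₂)).trans
      (Finset.card_le_two.trans (by norm_num))

end

end SignedTriples

/-! ### Distributing the weight of a triple over its elements -/

namespace SignedTriples

noncomputable section

open Classical

variable {V : Type*} {C : SignedTriples V} {T T' : Finset V} {a b c u v x y z : V} {l : Prop}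

variable (C) in
/-- The triple `T` uses both signs at both elements of the pair `u`, `v`, and some other triple
separates the pair. -/
def irr (T : Finset V) (u v : V) : Prop := ¬ C.mono u T ∧ ¬ C.mono v T ∧ ¬ C.clean u v

variable (C) in
/-- The part of the weight of `T = {x, y, z}` that is given to `x`. In a triple without core
vertices, elements at which both signs are used receive more. If there is exactly one core vertex
and no core pair, then `l` decides whether that vertex receives the whole weight or only `1`. -/
def triShare (l : Prop) (T : Finset V) (x y z : V) : ℚ :=
  if C.core y z then
    if C.core x y ∧ C.core x z then (C.w T : ℚ) / 3
    else if C.core x y ∨ C.core x z then 0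
    else if C.irr T y z then (C.w T : ℚ) / 2 else C.w T
  else if C.core x y ∧ C.core x z then C.w T
  else if C.core x y then if C.irr T x y then (C.w T : ℚ) / 4 else 0
  else if C.core x z then if C.irr T x z then (C.w T : ℚ) / 4 else 0
  else if C.isCore x then
    if C.isCore y ∧ C.isCore z then (C.w T : ℚ) / 3
    else if C.isCore y ∨ C.isCore z then (C.w T : ℚ) / 2
    else if l then C.w T else 1
  else if C.isCore y ∧ C.isCore z then 0
  else if C.isCore y ∨ C.isCore z then if l then 0 else ((C.w T : ℚ) - 1) / 2
  else if C.w T = 4 then 4 / 3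
  else if C.w T = 2 ∧ ¬ C.mono x T then 5 / 6
  else 1 / 3

lemma irr_comm : C.irr T u v ↔ C.irr T v u := by
  unfold irr; rw [clean_comm]; tauto

lemma triShare_comm : C.triShare l T x y z = C.triShare l T x z y := by
  unfold triShare
  rw [core_comm (u := y) (v := z), irr_comm (u := y) (v := z)]
  by_cases h1 : C.core x y <;> by_cases h2 : C.core x z <;> by_cases h3 : C.isCore y <;>
    by_cases h4 : C.isCore z <;> simp [h1, h2, h3, h4]

variable (C) in
/-- The part of the weight of the triple `T` that is given to its element `x`. -/
def share (l : Prop) (x : V) (T : Finset V) : ℚ :=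
  if h : ∃ y z, x ≠ y ∧ x ≠ z ∧ y ≠ z ∧ T = {x, y, z} then
    C.triShare l T x h.choose h.choose_spec.choose else 0

lemma share_eq (hxy : x ≠ y) (hxz : x ≠ z) (hyz : y ≠ z) (hT : T = {x, y, z}) :
    C.share l x T = C.triShare l T x y z := by
  have h : ∃ y z, x ≠ y ∧ x ≠ z ∧ y ≠ z ∧ T = {x, y, z} := ⟨y, z, hxy, hxz, hyz, hT⟩
  rw [share, dif_pos h]
  obtain ⟨h1, h2, h3, h4⟩ := h.choose_spec.choose_spec
  generalize h.choose_spec.choose = z' at *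
  generalize h.choose = y' at *
  rw [hT] at h4
  have hy : y' = y ∨ y' = z := by
    have : y' ∈ ({x, y, z} : Finset V) := by rw [h4]; simp
    simp at this; grind
  have hz : z' = y ∨ z' = z := by
    have : z' ∈ ({x, y, z} : Finset V) := by rw [h4]; simp
    simp at this; grind
  rcases hy with rfl | rfl
  · have : z' = z := by grind
    rw [this]
  · have : z' = y := by grind
    rw [this, triShare_comm]

lemma w_eq_one_or : C.w T = 1 ∨ C.w T = 2 ∨ C.w T = 4 := by unfold w; split_ifs <;> simp

lemma exists_mono_of_w_eq_two (h : C.w T = 2) : ∃ x ∈ T, C.mono x T := by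
  by_contra hcon
  push Not at hcon
  rw [w_eq_four hcon] at h
  norm_num at h

/-- The weight is completely distributed. -/
lemma sum_share (hT : T ∈ C.H) : ∑ x ∈ T, C.share l x T = C.w T := by
  obtain ⟨x, y, z, hxy, hxz, hyz, hTe⟩ := Finset.card_eq_three.1 (C.card_eq T hT)
  have e : ∑ x ∈ T, C.share l x T = C.share l x T + C.share l y T + C.share l z T := by
    conv_lhs => rw [hTe]
    rw [Finset.sum_insert (by simp [hxy, hxz]), Finset.sum_insert (by simp [hyz]),
      Finset.sum_singleton, add_assoc]
    rw [← hTe]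
  have e2 : T = {y, x, z} := by rw [hTe]; ext; simp; tauto
  have e3 : T = {z, x, y} := by rw [hTe]; ext; simp; tauto
  rw [e, share_eq hxy hxz hyz hTe, share_eq hxy.symm hyz hxz e2,
    share_eq hxz.symm hyz.symm hxy e3]
  have far : C.w T = 2 → (C.mono x T ∧ ¬ C.mono y T ∧ ¬ C.mono z T) ∨
      (¬ C.mono x T ∧ C.mono y T ∧ ¬ C.mono z T) ∨ (¬ C.mono x T ∧ ¬ C.mono y T ∧ C.mono z T) := by
    intro h
    have hx : x ∈ T := by simp [hTe]
    have hy : y ∈ T := by simp [hTe]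
    have hz : z ∈ T := by simp [hTe]
    obtain ⟨t, ht, hm⟩ := exists_mono_of_w_eq_two h
    have key : ∀ s ∈ T, t ≠ s → ¬ C.mono s T := fun s hs hts => not_mono_of_w_eq_two h ht hm hs hts
    rw [hTe] at ht
    simp only [Finset.mem_insert, Finset.mem_singleton] at ht
    rcases ht with rfl | rfl | rfl
    · exact Or.inl ⟨hm, key _ hy hxy, key _ hz hxz⟩
    · exact Or.inr (Or.inl ⟨key _ hx hxy.symm, hm, key _ hz hyz⟩)
    · exact Or.inr (Or.inr ⟨key _ hx hxz.symm, key _ hy hyz.symm, hm⟩)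
  unfold triShare
  rw [core_comm (u := y) (v := x), core_comm (u := z) (v := x), core_comm (u := z) (v := y),
    irr_comm (u := y) (v := x), irr_comm (u := z) (v := x), irr_comm (u := z) (v := y)]
  by_cases h1 : C.core x y
  · by_cases h2 : C.core x z <;> by_cases h3 : C.core y z <;> simp only [h1, h2, h3] <;>
      simp <;> (try split_ifs) <;> ring
  by_cases h2 : C.core x z
  · by_cases h3 : C.core y z <;> simp only [h1, h2, h3] <;>
      simp <;> (try split_ifs) <;> ring
  by_cases h3 : C.core y z
  · simp only [h1, h2, h3]
    simp
    split_ifs <;> ring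
  simp only [h1, h2, h3]
  by_cases h4 : C.isCore x <;> by_cases h5 : C.isCore y <;> by_cases h6 : C.isCore z <;>
    simp only [h4, h5, h6] <;> simp
  · ring
  · split_ifs <;> ring
  · split_ifs <;> ring
  · split_ifs <;> ring
  · rcases w_eq_one_or (C := C) (T := T) with h | h | h
    · norm_num [h]
    · rcases far h with ⟨f1, f2, f3⟩ | ⟨f1, f2, f3⟩ | ⟨f1, f2, f3⟩ <;> norm_num [h, f1, f2, f3]
    · norm_num [h]

variable (C) in
/-- The total weight given to `x`. -/
def ch (l : Prop) (x : V) : ℚ := ∑ T ∈ C.H.filter (x ∈ ·), C.share l x T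

lemma sum_ch {U : Finset V} (hU : ∀ T ∈ C.H, T ⊆ U) :
    ∑ x ∈ U, C.ch l x = ((∑ T ∈ C.H, C.w T : ℕ) : ℚ) := by
  unfold ch
  push_cast
  rw [Finset.sum_comm' (t' := C.H) (s' := fun T => T)]
  · exact Finset.sum_congr rfl fun T hT => sum_share hT
  · intro x T
    simp only [Finset.mem_filter]
    exact ⟨fun h => ⟨h.2.2, h.2.1⟩, fun h => ⟨hU T h.2 h.1, h.2, h.1⟩⟩

variable (C) in
/-- The part of the share of `x` in `T` that is attributed to each sign used by `T` at `x`. -/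
def part (l : Prop) (x : V) (T : Finset V) : ℚ :=
  if C.mono x T then C.share l x T else C.share l x T / 2

lemma ch_eq_sum_cls : C.ch l x =
    ∑ T ∈ C.cls x true, C.part l x T + ∑ T ∈ C.cls x false, C.part l x T := by
  have e : ∀ s, ∑ T ∈ C.cls x s, C.part l x T =
      ∑ T ∈ C.H.filter (x ∈ ·), if C.side x s T then C.part l x T else 0 := by
    intro s
    rw [← Finset.sum_filter, Finset.filter_filter]
    rfl
  rw [e, e, ← Finset.sum_add_distrib, ch]
  refine Finset.sum_congr rfl fun T hT => ?_
  rw [Finset.mem_filter] at hT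
  by_cases hm : C.mono x T
  · obtain ⟨s, hs⟩ := C.exists_side T hT.1 x hT.2
    have := not_side_of_mono hm hs
    cases s <;> simp_all [part]
  · rw [if_pos (side_of_not_mono hm _), if_pos (side_of_not_mono hm _), part, if_neg hm]
    ring

end

end SignedTriples

/-! ### Vertices outside the core -/

namespace SignedTriples

noncomputable section

open Classical

variable {V : Type*} {C : SignedTriples V} {T T' T₁ T₂ : Finset V} {a b c u v x y z : V} {l : Prop}
  {s : Bool}

variable (C) in
/-- The triple `T` contains a core pair. -/
def paired (T : Finset V) : Prop := ∃ y ∈ T, ∃ z ∈ T, C.core y z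

variable (C) in
/-- The triple `T` contains no core vertex. -/
def far (T : Finset V) : Prop := ∀ y ∈ T, ¬ C.isCore y

lemma paired.exists_eq (hp : C.paired T) (hT : T ∈ C.H) (hx : x ∈ T) (hn : ¬ C.isCore x) :
    ∃ y z, x ≠ y ∧ x ≠ z ∧ y ≠ z ∧ T = {x, y, z} ∧ C.core y z := by
  obtain ⟨y, hy, z, hz, h⟩ := hp
  have hxy : x ≠ y := by rintro rfl; exact hn h.isCore
  have hxz : x ≠ z := by rintro rfl; exact hn h.symm.isCore
  exact ⟨y, z, hxy, hxz, h.1, eq_triple hT hx hy hz hxy hxz h.1, h⟩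

/-- A core vertex of a triple without core pairs uses only one sign there. -/
lemma mono_of_not_paired (hT : T ∈ C.H) (hp : ¬ C.paired T) (hy : y ∈ T) (h : C.isCore y) :
    C.mono y T := by
  obtain ⟨t, ht⟩ := h
  exact ht.mono hT hy fun h' => hp ⟨y, hy, t, h', ht⟩

lemma one_le_w : (1 : ℚ) ≤ C.w T := by exact_mod_cast w_pos

lemma w_le_four' : (C.w T : ℚ) ≤ 4 := by exact_mod_cast w_le_four

lemma w_le_two' (hx : x ∈ T) (hm : C.mono x T) : (C.w T : ℚ) ≤ 2 := by
  exact_mod_cast w_le_two hx hm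

lemma w_eq_one' (hx : x ∈ T) (hy : y ∈ T) (hxy : x ≠ y) (hm : C.mono x T) (hm' : C.mono y T) :
    (C.w T : ℚ) = 1 := by
  exact_mod_cast w_eq_one hx hy hxy hm hm'

lemma share_leaf (hxy : x ≠ y) (hxz : x ≠ z) (hn : ¬ C.isCore x)
    (h : C.core y z) : C.share l x {x, y, z} =
      if C.irr {x, y, z} y z then (C.w {x, y, z} : ℚ) / 2 else C.w {x, y, z} := by
  have h1 : ¬ C.core x y := fun h' => hn h'.isCore
  have h2 : ¬ C.core x z := fun h' => hn h'.isCore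
  rw [share_eq hxy hxz h.1 rfl, triShare, if_pos h, if_neg (by tauto), if_neg (by tauto)]

lemma share_leaf_le (hxy : x ≠ y) (hxz : x ≠ z) (hn : ¬ C.isCore x)
    (h : C.core y z) : C.share l x {x, y, z} ≤ C.w {x, y, z} := by
  rw [share_leaf hxy hxz hn h]
  have := one_le_w (C := C) (T := {x, y, z})
  split_ifs <;> linarith

lemma part_le_two_of_core (hxy : x ≠ y) (hxz : x ≠ z) (hn : ¬ C.isCore x)
    (h : C.core y z) : C.part l x {x, y, z} ≤ 2 := by
  have := share_leaf_le (l := l) hxy hxz hn h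
  have := w_le_four' (C := C) (T := {x, y, z})
  unfold part
  split_ifs with hm
  · have := w_le_two' (by simp) hm; linarith
  · linarith

lemma part_le_one_of_core (hxy : x ≠ y) (hxz : x ≠ z) (hn : ¬ C.isCore x)
    (h : C.core y z) (hc : ¬ C.clean y z) : C.part l x {x, y, z} ≤ 1 := by
  have h4 := w_le_four' (C := C) (T := {x, y, z})
  unfold part
  rw [share_leaf hxy hxz hn h]
  split_ifs with hm hi hi
  · have := w_le_two' (by simp) hm; linarith
  · have : C.mono y {x, y, z} ∨ C.mono z {x, y, z} := by unfold irr at hi; tauto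
    rcases this with h' | h'
    · exact (w_eq_one' (by simp) (by simp) hxy hm h').le
    · exact (w_eq_one' (by simp) (by simp) hxz hm h').le
  · linarith
  · have : C.mono y {x, y, z} ∨ C.mono z {x, y, z} := by unfold irr at hi; tauto
    have : (C.w {x, y, z} : ℚ) ≤ 2 := by
      rcases this with h' | h'
      · exact w_le_two' (by simp) h'
      · exact w_le_two' (by simp) h'
    linarith

/-- The share of a non-core vertex in a triple with core vertices but no core pair. -/
lemma share_mixed_le (hT : T ∈ C.H) (hx : x ∈ T) (hn : ¬ C.isCore x) (hp : ¬ C.paired T)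
    (hf : ¬ C.far T) : C.share l x T ≤ if l then 0 else ((C.w T : ℚ) - 1) / 2 := by
  obtain ⟨y, z, hxy, hxz, hyz, rfl⟩ := exists_eq hT hx
  have h1 : ¬ C.core x y := fun h' => hp ⟨x, by simp, y, by simp, h'⟩
  have h2 : ¬ C.core x z := fun h' => hp ⟨x, by simp, z, by simp, h'⟩
  have h3 : ¬ C.core y z := fun h' => hp ⟨y, by simp, z, by simp, h'⟩
  have h4 : C.isCore y ∨ C.isCore z := by
    unfold far at hf; push Not at hf; obtain ⟨t, ht, htc⟩ := hf
    simp only [Finset.mem_insert, Finset.mem_singleton] at ht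
    rcases ht with rfl | rfl | rfl
    · exact absurd htc hn
    · exact Or.inl htc
    · exact Or.inr htc
  rw [share_eq hxy hxz hyz rfl, triShare, if_neg h3, if_neg (by tauto), if_neg h1, if_neg h2,
    if_neg hn, if_pos h4]
  have := one_le_w (C := C) (T := {x, y, z})
  split_ifs <;> linarith

lemma part_mixed_le (hT : T ∈ C.H) (hx : x ∈ T) (hn : ¬ C.isCore x) (hp : ¬ C.paired T)
    (hf : ¬ C.far T) : C.part l x T ≤ if l ∨ C.mono x T then 0 else 1 / 4 := by
  have h := share_mixed_le (l := l) hT hx hn hp hf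
  unfold far at hf; push Not at hf; obtain ⟨t, ht, htc⟩ := hf
  have htm := mono_of_not_paired hT hp ht htc
  have h2 := w_le_two' ht htm
  have hxt : x ≠ t := by rintro rfl; exact hn htc
  have h1 : C.mono x T → (C.w T : ℚ) = 1 := fun hm => w_eq_one' hx ht hxt hm htm
  unfold part
  by_cases hl : l <;> by_cases hm : C.mono x T <;> simp only [hl, hm] at h ⊢ <;> simp at h ⊢
  · exact h
  · linarith
  · linarith [h1 hm]
  · linarith

lemma part_far_eq (hT : T ∈ C.H) (hx : x ∈ T) (hf : C.far T) : C.part l x T =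
    if C.w T = 4 then 2 / 3 else if C.mono x T then 1 / 3 else if C.w T = 2 then 5 / 12 else 1 / 6
    := by
  obtain ⟨y, z, hxy, hxz, hyz, rfl⟩ := exists_eq hT hx
  have hy : ¬ C.isCore y := hf y (by simp)
  have hz : ¬ C.isCore z := hf z (by simp)
  have hn : ¬ C.isCore x := hf x (by simp)
  have h1 : ¬ C.core x y := fun h' => hn h'.isCore
  have h2 : ¬ C.core x z := fun h' => hn h'.isCore
  have h3 : ¬ C.core y z := fun h' => hy h'.isCore
  have h5 : ¬ (C.core x y ∧ C.core x z) := fun h => h1 h.1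
  have h6 : ¬ (C.isCore y ∧ C.isCore z) := fun h => hy h.1
  have h7 : ¬ (C.isCore y ∨ C.isCore z) := not_or.2 ⟨hy, hz⟩
  rw [part, share_eq hxy hxz hyz rfl, triShare, if_neg h3, if_neg h5, if_neg h1, if_neg h2,
    if_neg hn, if_neg h6, if_neg h7]
  by_cases h4 : C.w {x, y, z} = 4
  · have := not_mono_of_w_eq_four (C := C) (x := x) h4 (by simp)
    simp [this, h4]; norm_num
  · by_cases hm : C.mono x {x, y, z} <;> by_cases h2 : C.w {x, y, z} = 2 <;> simp [h4, hm, h2] <;>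
      norm_num

lemma part_far_le (hT : T ∈ C.H) (hx : x ∈ T) (hf : C.far T) : C.part l x T ≤ 2 / 3 := by
  rw [part_far_eq hT hx hf]; split_ifs <;> norm_num

lemma part_far_le_of_ne (hT : T ∈ C.H) (hx : x ∈ T) (hf : C.far T) (h4 : C.w T ≠ 4) :
    C.part l x T ≤ 5 / 12 := by
  rw [part_far_eq hT hx hf, if_neg h4]; split_ifs <;> norm_num

lemma part_far_le_of_mono (hT : T ∈ C.H) (hx : x ∈ T) (hf : C.far T) (hm : C.mono x T) :
    C.part l x T ≤ 1 / 3 := by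
  have h4 : C.w T ≠ 4 := fun h4 => not_mono_of_w_eq_four h4 hx hm
  rw [part_far_eq hT hx hf, if_neg h4, if_pos hm]

lemma part_mixed_le_quarter (hT : T ∈ C.H) (hx : x ∈ T) (hn : ¬ C.isCore x) (hp : ¬ C.paired T)
    (hf : ¬ C.far T) : C.part l x T ≤ 1 / 4 :=
  (part_mixed_le hT hx hn hp hf).trans (by split_ifs <;> norm_num)

lemma part_le_of_not_paired (hT : T ∈ C.H) (hx : x ∈ T) (hn : ¬ C.isCore x)
    (hp : ¬ C.paired T) : C.part l x T ≤ 2 / 3 := by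
  by_cases hf : C.far T
  · exact part_far_le hT hx hf
  · exact (part_mixed_le_quarter hT hx hn hp hf).trans (by norm_num)

/-- A triple with two core vertices and no core pair gives nothing to a third, non-core vertex. -/
lemma part_eq_zero (hxy : x ≠ y) (hxz : x ≠ z) (hyz : y ≠ z) (hn : ¬ C.isCore x)
    (hy : C.isCore y) (hz : C.isCore z) (h : ¬ C.core y z) : C.part l x {x, y, z} = 0 := by
  have h1 : ¬ C.core x y := fun h' => hn h'.isCore
  have h2 : ¬ C.core x z := fun h' => hn h'.isCore
  have : C.share l x {x, y, z} = 0 := by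
    rw [share_eq hxy hxz hyz rfl, triShare, if_neg h, if_neg (by tauto), if_neg h1, if_neg h2,
      if_neg hn, if_pos ⟨hy, hz⟩]
  simp [part, this]

lemma sum_le_three_mul {ι : Type*} {A : Finset ι} {g : ι → ℚ} {q : ℚ} (hA : A.card ≤ 3)
    (hq : 0 ≤ q) (h : ∀ i ∈ A, g i ≤ q) : ∑ i ∈ A, g i ≤ 3 * q := by
  refine (Finset.sum_le_card_nsmul A g q h).trans ?_
  rw [nsmul_eq_mul]
  exact mul_le_mul_of_nonneg_right (by exact_mod_cast hA) hq

lemma sum_le_add_two_mul {ι : Type*} {A : Finset ι} {g : ι → ℚ} {p q : ℚ} (hA : A.card ≤ 3)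
    (hq : 0 ≤ q) {i₀ : ι} (h₀ : i₀ ∈ A) (hp : g i₀ ≤ p) (h : ∀ i ∈ A, i ≠ i₀ → g i ≤ q) :
    ∑ i ∈ A, g i ≤ p + 2 * q := by
  rw [← Finset.add_sum_erase _ _ h₀]
  refine add_le_add hp ((Finset.sum_le_card_nsmul _ g q fun i hi => ?_).trans ?_)
  · rw [Finset.mem_erase] at hi; exact h i hi.2 hi.1
  · rw [nsmul_eq_mul, Finset.card_erase_of_mem h₀]
    refine mul_le_mul_of_nonneg_right ?_ hq
    exact_mod_cast (by omega : A.card - 1 ≤ 2)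

lemma sum_le_add {ι : Type*} {A : Finset ι} {g : ι → ℚ} {p q : ℚ} {i j : ι} (hi : i ∈ A)
    (hj : j ∈ A) (hij : i ≠ j) (hp : g i ≤ p) (hq : g j ≤ q)
    (h : ∀ k ∈ A, k ≠ i → k ≠ j → g k ≤ 0) : ∑ i ∈ A, g i ≤ p + q := by
  have hj' : j ∈ A.erase i := Finset.mem_erase.2 ⟨hij.symm, hj⟩
  rw [← Finset.add_sum_erase _ _ hi, ← Finset.add_sum_erase _ _ hj']
  have := Finset.sum_nonpos (s := (A.erase i).erase j) (f := g) fun k hk => by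
    simp only [Finset.mem_erase] at hk
    exact h k hk.2.2 hk.2.1 hk.1
  linarith

/-- Triples of one class at `x`: if one contains a core pair, then all meet the core. -/
lemma not_far_of_paired (hn : ¬ C.isCore x) (hT : T ∈ C.cls x s) (hp : C.paired T)
    (hT' : T' ∈ C.cls x s) : ¬ C.far T' := by
  intro hf
  obtain ⟨t, htx, ht, ht'⟩ := cls_meet hT hT'
  obtain ⟨y, z, hxy, hxz, hyz, rfl, h⟩ := hp.exists_eq (mem_cls.1 hT).1 (mem_cls.1 hT).2.1 hn
  simp only [Finset.mem_insert, Finset.mem_singleton] at ht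
  rcases ht with rfl | rfl | rfl
  · exact htx rfl
  · exact hf _ ht' h.isCore
  · exact hf _ ht' h.symm.isCore

/-- Two triples of one class at `x` with core pairs: the pairs share a vertex, and only one more
triple is possible in the class. -/
lemma cls_two_paired (hn : ¬ C.isCore x) (h₁ : T₁ ∈ C.cls x s) (h₂ : T₂ ∈ C.cls x s)
    (hne : T₁ ≠ T₂) (hp₁ : C.paired T₁) (hp₂ : C.paired T₂) :
    ∃ y z t, x ≠ y ∧ x ≠ z ∧ x ≠ t ∧ y ≠ z ∧ y ≠ t ∧ z ≠ t ∧ T₁ = {x, y, z} ∧ T₂ = {x, y, t} ∧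
      C.core y z ∧ C.core y t ∧ ∀ T ∈ C.cls x s, T ≠ T₁ → T ≠ T₂ → T = {x, z, t} := by
  have m₁ := mem_cls.1 h₁
  have m₂ := mem_cls.1 h₂
  obtain ⟨y, hyx, hy₁, hy₂⟩ := cls_meet h₁ h₂
  have key : ∀ T ∈ C.H, x ∈ T → C.paired T → y ∈ T → ∃ z, x ≠ z ∧ y ≠ z ∧ T = {x, y, z} ∧
      C.core y z := by
    intro T hT hx hp hy
    obtain ⟨p, q, h1, h2, h3, rfl, h4⟩ := hp.exists_eq hT hx hn
    simp only [Finset.mem_insert, Finset.mem_singleton] at hy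
    rcases hy with rfl | rfl | rfl
    · exact absurd rfl hyx
    · exact ⟨q, h2, h3, rfl, h4⟩
    · exact ⟨p, h1, h3.symm, by ext; simp; tauto, h4.symm⟩
  obtain ⟨z, hxz, hyz, rfl, hz⟩ := key _ m₁.1 m₁.2.1 hp₁ hy₁
  obtain ⟨t, hxt, hyt, rfl, ht⟩ := key _ m₂.1 m₂.2.1 hp₂ hy₂
  have hzt : z ≠ t := by rintro rfl; exact hne rfl
  refine ⟨y, z, t, hyx.symm, hxz, hxt, hyz, hyt, hzt, rfl, rfl, hz, ht, fun T hT hT₁ hT₂ => ?_⟩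
  have m := mem_cls.1 hT
  have hy : y ∉ T := by
    intro hy
    rcases hz.mem_or_mem ht hzt m.1 hy with h | h
    · exact hT₁ (eq_triple m.1 m.2.1 hy h hyx.symm hxz hyz)
    · exact hT₂ (eq_triple m.1 m.2.1 hy h hyx.symm hxt hyt)
  obtain ⟨p, hp, hp1, hp2⟩ := cls_meet hT h₁
  obtain ⟨q, hq, hq1, hq2⟩ := cls_meet hT h₂
  have hz : z ∈ T := by simp at hp2; grind
  have ht : t ∈ T := by simp at hq2; grind
  exact eq_triple m.1 m.2.1 hz ht hxz hxt hzt

/-- A class with a triple on a clean core pair has no other triple. -/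
lemma cls_eq_of_clean (hT : {x, y, z} ∈ C.cls x s) (h : C.core y z) (hc : C.clean y z)
    (hxy : x ≠ y) (hxz : x ≠ z) : C.cls x s = {{x, y, z}} := by
  refine Finset.eq_singleton_iff_unique_mem.2 ⟨hT, fun T hT' => ?_⟩
  obtain ⟨t, htx, ht, ht'⟩ := cls_meet hT hT'
  have m := mem_cls.1 hT'
  have := hc T m.1
  have h1 : y ∈ T ∧ z ∈ T := by simp at ht; grind
  exact eq_triple m.1 m.2.1 h1.1 h1.2 hxy hxz h.1

lemma sum_cls_of_clean (hn : ¬ C.isCore x) (hT : {x, y, z} ∈ C.cls x s) (h : C.core y z)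
    (hc : C.clean y z) (hxy : x ≠ y) (hxz : x ≠ z) : ∑ T ∈ C.cls x s, C.part l x T ≤ 2 := by
  rw [cls_eq_of_clean hT h hc hxy hxz, Finset.sum_singleton]
  exact part_le_two_of_core hxy hxz hn h

/-- The charge of a class at a non-core vertex. Only a core triangle brings it above `2`. -/
lemma sum_cls_le_two_or (hn : ¬ C.isCore x) (s : Bool) : ∑ T ∈ C.cls x s, C.part l x T ≤ 2 ∨
    (∑ T ∈ C.cls x s, C.part l x T ≤ 3 ∧ ∃ y z t, x ≠ y ∧ x ≠ z ∧ x ≠ t ∧ y ≠ z ∧ y ≠ t ∧ z ≠ t ∧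
      C.core y z ∧ C.core y t ∧ C.core z t ∧ C.cls x s = {{x, y, z}, {x, y, t}, {x, z, t}}) := by
  have h3 := card_cls_le hn s
  by_cases hcl : ∃ y z, x ≠ y ∧ x ≠ z ∧ {x, y, z} ∈ C.cls x s ∧ C.core y z ∧ C.clean y z
  · obtain ⟨y, z, hxy, hxz, hT, h, hc⟩ := hcl
    exact Or.inl (sum_cls_of_clean hn hT h hc hxy hxz)
  push Not at hcl
  have hone : ∀ T ∈ C.cls x s, C.paired T → C.part l x T ≤ 1 := by
    intro T hT hp
    have m := mem_cls.1 hT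
    obtain ⟨p, q, h1, h2, -, rfl, h4⟩ := hp.exists_eq m.1 m.2.1 hn
    exact part_le_one_of_core h1 h2 hn h4 (hcl p q h1 h2 hT h4)
  by_cases hp : ∃ T ∈ C.cls x s, C.paired T
  · obtain ⟨T₁, h₁, hp₁⟩ := hp
    by_cases hp' : ∃ T ∈ C.cls x s, T ≠ T₁ ∧ C.paired T
    · obtain ⟨T₂, h₂, hne, hp₂⟩ := hp'
      have e1 := hone _ h₁ hp₁
      have e2 := hone _ h₂ hp₂
      obtain ⟨y, z, t, hxy, hxz, hxt, hyz, hyt, hzt, rfl, rfl, h5, h6, h7⟩ :=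
        cls_two_paired hn h₁ h₂ hne.symm hp₁ hp₂
      by_cases h8 : {x, z, t} ∈ C.cls x s ∧ C.core z t
      · right
        refine ⟨?_, y, z, t, hxy, hxz, hxt, hyz, hyt, hzt, h5, h6, h8.2, ?_⟩
        · refine (sum_le_three_mul h3 zero_le_one fun T hT => ?_).trans (by norm_num)
          by_cases hT₁ : T = {x, y, z}
          · rw [hT₁]; exact e1
          by_cases hT₂ : T = {x, y, t}
          · rw [hT₂]; exact e2
          · rw [h7 T hT hT₁ hT₂]
            exact hone _ h8.1 ⟨z, by simp, t, by simp, h8.2⟩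
        · ext T
          simp only [Finset.mem_insert, Finset.mem_singleton]
          constructor
          · intro hT
            by_cases hT₁ : T = {x, y, z}
            · exact Or.inl hT₁
            by_cases hT₂ : T = {x, y, t}
            · exact Or.inr (Or.inl hT₂)
            · exact Or.inr (Or.inr (h7 T hT hT₁ hT₂))
          · rintro (rfl | rfl | rfl)
            exacts [h₁, h₂, h8.1]
      · left
        refine (sum_le_add h₁ h₂ hne.symm e1 e2 fun T hT hT₁ hT₂ => ?_).trans (by norm_num)
        have := h7 T hT hT₁ hT₂
        subst this
        rw [part_eq_zero hxz hxt hzt hn h5.symm.isCore h6.symm.isCore fun h => h8 ⟨hT, h⟩]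
    · push Not at hp'
      left
      refine (sum_le_add_two_mul h3 (q := 1 / 4) (by norm_num) h₁ (hone _ h₁ hp₁)
        fun T hT hne => ?_).trans (by norm_num)
      have m := mem_cls.1 hT
      exact part_mixed_le_quarter m.1 m.2.1 hn (hp' T hT hne) (not_far_of_paired hn h₁ hp₁ hT)
  · push Not at hp
    left
    refine (sum_le_three_mul h3 (q := 2 / 3) (by norm_num) fun T hT => ?_).trans (by norm_num)
    have m := mem_cls.1 hT
    exact part_le_of_not_paired m.1 m.2.1 hn (hp T hT)

lemma sum_cls_le_three (hn : ¬ C.isCore x) (s : Bool) : ∑ T ∈ C.cls x s, C.part l x T ≤ 3 := by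
  rcases sum_cls_le_two_or (l := l) hn s with h | h
  · linarith
  · exact h.1

/-- A class with exactly one triple on a core pair, which is not clean. -/
lemma sum_cls_le_of_unique (hn : ¬ C.isCore x) (hT : {x, y, z} ∈ C.cls x s) (hxy : x ≠ y)
    (hxz : x ≠ z) (h : C.core y z) (hc : ¬ C.clean y z)
    (hu : ∀ T ∈ C.cls x s, C.paired T → T = {x, y, z}) :
    ∑ T ∈ C.cls x s, C.part l x T ≤ 3 / 2 := by
  refine (sum_le_add_two_mul (card_cls_le hn s) (q := 1 / 4) (by norm_num) hT
    (part_le_one_of_core hxy hxz hn h hc) fun T hT' hne => ?_).trans (by norm_num)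
  have m := mem_cls.1 hT'
  exact part_mixed_le_quarter m.1 m.2.1 hn (fun hp => hne (hu T hT' hp))
    (not_far_of_paired hn hT ⟨y, by simp, z, by simp, h⟩ hT')

/-- If `y`, `z` is an isolated edge of the core graph, then a class with a triple on it has no
other triple on a core pair. -/
lemma eq_of_paired (hn : ¬ C.isCore x) (hT : {x, y, z} ∈ C.cls x s) (h : C.core y z)
    (hxy : x ≠ y) (hxz : x ≠ z)
    (hy : ∀ t, C.core y t → t = z) (hz : ∀ t, C.core z t → t = y) (hT' : T' ∈ C.cls x s)
    (hp : C.paired T') : T' = {x, y, z} := by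
  by_contra hne
  obtain ⟨y', z', t', h1, h2, h3, h4, h5, h6, h7, h8, h9, h10, -⟩ :=
    cls_two_paired hn hT hT' (Ne.symm hne) ⟨y, by simp, z, by simp, h⟩ hp
  have h11 : y' ∈ ({x, y, z} : Finset V) := by rw [h7]; simp
  simp only [Finset.mem_insert, Finset.mem_singleton] at h11
  rcases h11 with rfl | rfl | rfl
  · exact h1 rfl
  · exact h6 ((hy _ h9).trans (hy _ h10).symm)
  · exact h6 ((hz _ h9).trans (hz _ h10).symm)

lemma sum_cls_le_of_isolated (hn : ¬ C.isCore x) (hT : {x, y, z} ∈ C.cls x s) (hxy : x ≠ y)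
    (hxz : x ≠ z) (h : C.core y z) (hc : ¬ C.clean y z)
    (hy : ∀ t, C.core y t → t = z) (hz : ∀ t, C.core z t → t = y) :
    ∑ T ∈ C.cls x s, C.part l x T ≤ 3 / 2 :=
  sum_cls_le_of_unique hn hT hxy hxz h hc fun _ hT' hp => eq_of_paired hn hT h hxy hxz hy hz hT' hp

/-- If the core graph is a matching without clean edges, and no triple of weight `4` off the core
can be removed, then each class has charge at most `3 / 2`. -/
lemma sum_cls_le_three_halves (hn : ¬ C.isCore x) (hc : ∀ u v, C.core u v → ¬ C.clean u v)
    (hd : ∀ u v t, C.core u v → C.core u t → v = t)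
    (h4 : ∀ T ∈ C.H, x ∈ T → C.far T → C.w T = 4 → ∀ T' ∈ C.H, x ∈ T' → T' ≠ T → ¬ C.far T')
    (s : Bool) : ∑ T ∈ C.cls x s, C.part l x T ≤ 3 / 2 := by
  by_cases hp : ∃ T ∈ C.cls x s, C.paired T
  · obtain ⟨T, hT, hp⟩ := hp
    have m := mem_cls.1 hT
    obtain ⟨y, z, hxy, hxz, hyz, rfl, h⟩ := hp.exists_eq m.1 m.2.1 hn
    exact sum_cls_le_of_isolated hn hT hxy hxz h (hc _ _ h) (fun t ht => hd _ _ _ ht h)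
      (fun t ht => hd _ _ _ ht h.symm)
  push Not at hp
  have h3 := card_cls_le hn s
  by_cases hw : ∃ T ∈ C.cls x s, C.far T ∧ C.w T = 4
  · obtain ⟨T, hT, hf, hw⟩ := hw
    have m := mem_cls.1 hT
    refine (sum_le_add_two_mul h3 (q := 1 / 4) (by norm_num) hT (part_far_le m.1 m.2.1 hf)
      fun T' hT' hne => ?_).trans (by norm_num)
    have m' := mem_cls.1 hT'
    exact part_mixed_le_quarter m'.1 m'.2.1 hn (hp _ hT') (h4 T m.1 m.2.1 hf hw T' m'.1 m'.2.1 hne)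
  · push Not at hw
    refine (sum_le_three_mul h3 (q := 5 / 12) (by norm_num) fun T hT => ?_).trans (by norm_num)
    have m := mem_cls.1 hT
    by_cases hf : C.far T
    · exact part_far_le_of_ne m.1 m.2.1 hf (hw T hT hf)
    · exact (part_mixed_le_quarter m.1 m.2.1 hn (hp _ hT) hf).trans (by norm_num)

/-- The same without any core vertex. -/
lemma sum_cls_le_five_quarters (hn : ∀ y, ¬ C.isCore y)
    (h4 : ∀ T ∈ C.H, x ∈ T → C.w T = 4 → ∀ T' ∈ C.H, x ∈ T' → T' = T)
    (s : Bool) : ∑ T ∈ C.cls x s, C.part l x T ≤ 5 / 4 := by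
  have hf : ∀ T, C.far T := fun T y _ => hn y
  by_cases hw : ∃ T ∈ C.cls x s, C.w T = 4
  · obtain ⟨T, hT, hw⟩ := hw
    have m := mem_cls.1 hT
    have : C.cls x s = {T} := Finset.eq_singleton_iff_unique_mem.2 ⟨hT, fun T' hT' =>
      h4 T m.1 m.2.1 hw T' (mem_cls.1 hT').1 (mem_cls.1 hT').2.1⟩
    rw [this, Finset.sum_singleton]
    exact (part_far_le m.1 m.2.1 (hf T)).trans (by norm_num)
  · push Not at hw
    refine (sum_le_three_mul (card_cls_le (hn x) s) (q := 5 / 12) (by norm_num)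
      fun T hT => ?_).trans (by norm_num)
    have m := mem_cls.1 hT
    exact part_far_le_of_ne m.1 m.2.1 (hf T) (hw T hT)

end

end SignedTriples

/-! ### Core vertices -/

namespace SignedTriples

noncomputable section

open Classical

variable {V : Type*} {C : SignedTriples V} {T T' T₁ T₂ : Finset V} {a b c u v x y z : V} {l : Prop}
  {s : Bool}

variable (C) in
/-- The triples on the pair `u`, `v` that use both signs at `u` and `v`, if the pair is not clean.
-/
def irrs (u v : V) : Finset (Finset V) := C.H.filter fun T => (u ∈ T ∧ v ∈ T) ∧ C.irr T u v

lemma ch_eq_ex_add (u v : V) : C.ch l u = ∑ T ∈ C.ex u v, C.share l u T +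
    ∑ T ∈ C.H.filter (fun T => u ∈ T ∧ v ∈ T), C.share l u T := by
  rw [ch, ← Finset.sum_filter_add_sum_filter_not _ (fun T => v ∈ T), add_comm]
  simp only [Finset.filter_filter, ex]

/-- At an end of the core, a triple on the core pair gives something to the end only if it uses
both signs at both elements of the pair. -/
lemma share_end_le (h : C.core u v) (hu : ∀ t, C.core u t → t = v) (hT : T ∈ C.H) (huT : u ∈ T)
    (hvT : v ∈ T) : C.share l u T ≤ if C.irr T u v then 1 else 0 := by
  obtain ⟨x, hxu, hxv, rfl⟩ := exists_eq_pair hT huT hvT h.1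
  have h1 : ¬ C.core u x := fun h' => hxv (hu _ h')
  have h2 : ¬ (C.core u v ∧ C.core u x) := fun h => h1 h.2
  rw [share_eq h.1 hxu.symm hxv.symm rfl, triShare, if_neg h2, if_pos (Or.inl h), if_neg h2,
    if_pos h]
  have := w_le_four' (C := C) (T := {u, v, x})
  split_ifs <;> linarith

/-- If the core neighbour of an end has a second core neighbour, then triples on the core pair
give nothing to the end. -/
lemma share_end_eq_zero (h : C.core u v) (hu : ∀ t, C.core u t → t = v) (h' : C.core v c)
    (hc : c ≠ u) (hT : T ∈ C.H) (huT : u ∈ T) (hvT : v ∈ T) : C.share l u T = 0 := by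
  obtain ⟨x, hxu, hxv, rfl⟩ := exists_eq_pair hT huT hvT h.1
  have h1 : ¬ C.core u x := fun h' => hxv (hu _ h')
  have h2 : ¬ (C.core u v ∧ C.core u x) := fun h => h1 h.2
  rw [share_eq h.1 hxu.symm hxv.symm rfl, triShare, if_neg h2, if_pos (Or.inl h), if_neg h2,
    if_pos h]
  by_cases hcx : c = x
  · subst hcx; rw [if_pos h']
  · have h3 : ¬ C.core v x := fun h3 =>
      hxu (Or.resolve_right (h.symm.eq_or_eq h' hc.symm h3) fun h => hcx h.symm)
    rw [if_neg h3, if_neg]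
    have := h'.mono hT (by simp : v ∈ _) (by
      simp only [Finset.mem_insert, Finset.mem_singleton]; rintro (h | h | h)
      · exact hc h
      · exact h'.1 h.symm
      · exact hcx h)
    exact fun hi => hi.2.1 this

lemma sum_share_end_le (h : C.core u v) (hu : ∀ t, C.core u t → t = v) :
    ∑ T ∈ C.H.filter (fun T => u ∈ T ∧ v ∈ T), C.share l u T ≤ (C.irrs u v).card := by
  calc _ ≤ ∑ T ∈ C.H.filter (fun T => u ∈ T ∧ v ∈ T), if C.irr T u v then (1 : ℚ) else 0 :=
        Finset.sum_le_sum fun T hT => by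
          rw [Finset.mem_filter] at hT
          exact share_end_le h hu hT.1 hT.2.1 hT.2.2
    _ = (C.irrs u v).card := by
        rw [Finset.sum_ite, Finset.sum_const_zero, add_zero, Finset.sum_const, nsmul_eq_mul,
          mul_one, Finset.filter_filter]
        rfl

lemma mem_irrs : T ∈ C.irrs u v ↔ T ∈ C.H ∧ (u ∈ T ∧ v ∈ T) ∧ C.irr T u v := by simp [irrs]

lemma irrs_comm : C.irrs u v = C.irrs v u := by
  ext T; rw [mem_irrs, mem_irrs, irr_comm, and_comm (a := u ∈ T)]

/-- The third element of an irregular triple lies in every triple through `u` avoiding `v`. -/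
lemma mem_of_irrs (hT : {u, v, x} ∈ C.irrs u v) (hT' : T' ∈ C.ex u v) : x ∈ T' := by
  by_contra hx
  have m := mem_irrs.1 hT
  have m' := mem_ex.1 hT'
  exact m.2.2.1 (mono_of_conflict m.1 m'.1 (by simp) m'.2.1 (by grind))

lemma card_le_of_third_mem (huv : u ≠ v) {A : Finset (Finset V)}
    (hA : ∀ T ∈ A, T ∈ C.H ∧ u ∈ T ∧ v ∈ T) (S : Finset V)
    (h : ∀ x, x ≠ u → x ≠ v → {u, v, x} ∈ A → x ∈ S) : A.card ≤ S.card := by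
  refine card_le_of_hit huv hA S fun T hT => ?_
  have m := hA T hT
  obtain ⟨x, hxu, hxv, rfl⟩ := exists_eq_pair m.1 m.2.1 m.2.2 huv
  exact ⟨x, h x hxu hxv hT, hxu, hxv, by simp⟩

lemma card_inter_erase_le (h₁ : T₁ ∈ C.ex u v) (h₂ : T₂ ∈ C.ex u v) (hne : T₁ ≠ T₂) :
    ((T₁ ∩ T₂).erase u).card ≤ 1 := by
  have m₁ := mem_ex.1 h₁
  have m₂ := mem_ex.1 h₂
  rw [Finset.card_erase_of_mem (Finset.mem_inter.2 ⟨m₁.2.1, m₂.2.1⟩)]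
  have : (T₁ ∩ T₂).card < T₁.card := Finset.card_lt_card ⟨Finset.inter_subset_left, fun h =>
    hne (Finset.eq_of_subset_of_card_le (h.trans Finset.inter_subset_right)
      (by rw [C.card_eq _ m₁.1, C.card_eq _ m₂.1]))⟩
  rw [C.card_eq _ m₁.1] at this
  omega

lemma card_le_two_of_ex {A : Finset (Finset V)} (hA : ∀ T ∈ A, T ∈ C.H ∧ u ∈ T ∧ v ∈ T)
    (hmem : ∀ x, {u, v, x} ∈ A → ∀ T' ∈ C.ex u v, x ∈ T') 
    (huv : u ≠ v) (hT : T ∈ C.ex u v) : A.card ≤ 2 := by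
  have m := mem_ex.1 hT
  refine (card_le_of_third_mem huv hA (T.erase u) fun x hxu hxv hx => ?_).trans ?_
  · exact Finset.mem_erase.2 ⟨hxu, hmem x hx T hT⟩
  · rw [Finset.card_erase_of_mem m.2.1, C.card_eq T m.1]

lemma card_le_one_of_ex {A : Finset (Finset V)} (hA : ∀ T ∈ A, T ∈ C.H ∧ u ∈ T ∧ v ∈ T)
    (hmem : ∀ x, {u, v, x} ∈ A → ∀ T' ∈ C.ex u v, x ∈ T') 
    (huv : u ≠ v) (h₁ : T₁ ∈ C.ex u v) (h₂ : T₂ ∈ C.ex u v) (hne : T₁ ≠ T₂) :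
    A.card ≤ 1 :=
  (card_le_of_third_mem huv hA ((T₁ ∩ T₂).erase u) fun x hxu _ hx => Finset.mem_erase.2 ⟨hxu,
    Finset.mem_inter.2 ⟨hmem x hx _ h₁, hmem x hx _ h₂⟩⟩).trans (card_inter_erase_le h₁ h₂ hne)

/-- At an end `u`, consider triples on the core pair whose third elements lie in all triples
through `u` avoiding `v`. -/
lemma card_ex_add_le {A : Finset (Finset V)} (hA : ∀ T ∈ A, T ∈ C.H ∧ u ∈ T ∧ v ∈ T)
    (hmem : ∀ x, {u, v, x} ∈ A → ∀ T' ∈ C.ex u v, x ∈ T') 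
    (h : C.core u v) (hu : ∀ t, C.core u t → t = v) (hex : (C.ex u v).Nonempty) :
    (C.ex u v).card + A.card ≤ 3 := by
  have h3 := card_ex_le h hu
  have h2 := card_le_two_of_ex hA hmem h.1 hex.choose_spec
  by_cases hc : (C.ex u v).card ≤ 1
  · omega
  obtain ⟨T₁, h₁, T₂, h₂, hne⟩ := Finset.one_lt_card.1 (not_le.1 hc)
  have h1 := card_le_one_of_ex hA hmem h.1 h₁ h₂ hne
  by_cases hc' : (C.ex u v).card = 3
  · -- such a triple and the three triples avoiding `v` would make up a further core pair
    suffices A = ∅ by rw [this, hc']; rfl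
    refine Finset.eq_empty_of_forall_notMem fun T hT => ?_
    have m := hA T hT
    obtain ⟨x, hxu, hxv, rfl⟩ := exists_eq_pair m.1 m.2.1 m.2.2 h.1
    refine hxv (hu x ⟨hxu.symm, ?_⟩)
    refine le_trans ?_ (card_le_codeg (A := insert {u, v, x} (C.ex u v)) fun T hT' => ?_)
    · rw [Finset.card_insert_of_notMem fun h => (mem_ex.1 h).2.2 (by simp), hc']
    · rcases Finset.mem_insert.1 hT' with rfl | hT'
      · exact ⟨m.1, by simp, by simp⟩
      · exact ⟨(mem_ex.1 hT').1, (mem_ex.1 hT').2.1, hmem x hT T hT'⟩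
  · omega

lemma irrs_sub (u v : V) : ∀ T ∈ C.irrs u v, T ∈ C.H ∧ u ∈ T ∧ v ∈ T := fun _ hT =>
  ⟨(mem_irrs.1 hT).1, (mem_irrs.1 hT).2.1⟩

lemma card_irrs_le_two (huv : u ≠ v) : (C.irrs u v).card ≤ 2 := by
  by_cases h1 : (C.ex u v).Nonempty
  · exact card_le_two_of_ex (irrs_sub u v) (fun x hx T hT => mem_of_irrs hx hT) huv h1.choose_spec
  by_cases h2 : (C.ex v u).Nonempty
  · rw [irrs_comm]
    exact card_le_two_of_ex (irrs_sub v u) (fun x hx T hT => mem_of_irrs hx hT) huv.symm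
      h2.choose_spec
  rw [Finset.not_nonempty_iff_eq_empty] at h1 h2
  have : C.irrs u v = ∅ := by
    refine Finset.eq_empty_of_forall_notMem fun T hT => (mem_irrs.1 hT).2.2.2.2 fun T' hT' => ?_
    have h1 : T' ∉ C.ex u v := by rw [h1]; exact Finset.notMem_empty _
    have h2 : T' ∉ C.ex v u := by rw [h2]; exact Finset.notMem_empty _
    rw [mem_ex] at h1 h2
    tauto
  simp [this]

lemma card_ex_add_card_irrs_le (h : C.core u v) (hu : ∀ t, C.core u t → t = v) :
    (C.ex u v).card + (C.irrs u v).card ≤ 3 := by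
  by_cases hex : (C.ex u v).Nonempty
  · exact card_ex_add_le (irrs_sub u v) (fun x hx T hT => mem_of_irrs hx hT) h hu hex
  · rw [Finset.not_nonempty_iff_eq_empty.1 hex, Finset.card_empty, zero_add]
    exact (card_irrs_le_two h.1).trans (by norm_num)

/-- Two triples through `u` avoiding its core neighbour and with no other common element are the
only triples avoiding it, and all triples on the core pair use one sign at `u`. -/
lemma ex_eq_pair (h : C.core u v) (h₁ : T₁ ∈ C.ex u v) (h₂ : T₂ ∈ C.ex u v)
    (hd : ∀ y, y ∈ T₁ → y ∈ T₂ → y = u) : C.ex u v ⊆ {T₁, T₂} ∧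
    (∀ x, x ≠ u → x ≠ v → {u, v, x} ∈ C.H → x ∈ T₁ ∨ x ∈ T₂) ∧ C.irrs u v = ∅ := by
  have m₁ := mem_ex.1 h₁
  have m₂ := mem_ex.1 h₂
  have c₁ := conflict m₁.1 m₂.1 m₁.2.1 m₂.2.1 hd
  have c₂ := conflict m₂.1 m₁.1 m₂.2.1 m₁.2.1 fun y h1 h2 => hd y h2 h1
  have hcov : ∀ x, x ≠ u → x ≠ v → {u, v, x} ∈ C.H → x ∈ T₁ ∨ x ∈ T₂ := by
    intro x hxu hxv hx
    by_contra hcon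
    push Not at hcon
    have d₁ := conflict hx m₁.1 (by simp) m₁.2.1 (by grind)
    have d₂ := conflict hx m₂.1 (by simp) m₂.2.1 (by grind)
    obtain ⟨s, hs⟩ := C.exists_side _ hx u (by simp)
    obtain ⟨s₁, hs₁⟩ := C.exists_side _ m₁.1 u m₁.2.1
    obtain ⟨s₂, hs₂⟩ := C.exists_side _ m₂.1 u m₂.2.1
    cases s <;> cases s₁ <;> cases s₂ <;> simp_all
  refine ⟨?_, hcov, ?_⟩
  · obtain ⟨s, hs⟩ := C.exists_side _ m₁.1 u m₁.2.1
    obtain ⟨t, ht⟩ := C.exists_side _ m₂.1 u m₂.2.1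
    have f := c₁ s hs
    have g := c₂ t ht
    cases s <;> cases t
    · exact absurd ht f
    · exact ex_subset_pair h h₁ h₂ g f
    · rw [Finset.pair_comm]; exact ex_subset_pair h h₂ h₁ f g
    · exact absurd ht f
  · refine Finset.eq_empty_of_forall_notMem fun T hT => ?_
    have m := mem_irrs.1 hT
    obtain ⟨x, hxu, hxv, rfl⟩ := exists_eq_pair m.1 m.2.1.1 m.2.1.2 h.1
    exact hxu (hd x (mem_of_irrs hT h₁) (mem_of_irrs hT h₂))

/-- The share of a core vertex in a triple without its core neighbours. -/
lemma share_ex_eq (huy : u ≠ y) (huz : u ≠ z) (hyz : y ≠ z) (hu : C.isCore u) (h1 : ¬ C.core u y)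
    (h2 : ¬ C.core u z) : C.share l u {u, y, z} =
    if C.core y z then if C.irr {u, y, z} y z then (C.w {u, y, z} : ℚ) / 2 else C.w {u, y, z}
    else if C.isCore y ∧ C.isCore z then (C.w {u, y, z} : ℚ) / 3
    else if C.isCore y ∨ C.isCore z then (C.w {u, y, z} : ℚ) / 2
    else if l then C.w {u, y, z} else 1 := by
  have h3 : ¬ (C.core u y ∧ C.core u z) := fun h => h1 h.1
  have h4 : ¬ (C.core u y ∨ C.core u z) := not_or.2 ⟨h1, h2⟩
  rw [share_eq huy huz hyz rfl, triShare, if_neg h3, if_neg h4, if_neg h3, if_neg h1, if_neg h2,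
    if_pos hu]

lemma mono_ex (h : C.core u v) (hT : T ∈ C.ex u v) : C.mono u T :=
  h.mono (mem_ex.1 hT).1 (mem_ex.1 hT).2.1 (mem_ex.1 hT).2.2

/-- At an end, a triple avoiding the core neighbour. -/
lemma share_ex_le_w (h : C.core u v) (hu : ∀ t, C.core u t → t = v) (hT : T ∈ C.ex u v) :
    C.share l u T ≤ C.w T := by
  have m := mem_ex.1 hT
  obtain ⟨y, z, huy, huz, hyz, rfl⟩ := exists_eq m.1 m.2.1
  have h1 : ¬ C.core u y := fun h' => m.2.2 (by simp [hu _ h'])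
  have h2 : ¬ C.core u z := fun h' => m.2.2 (by simp [hu _ h'])
  rw [share_ex_eq huy huz hyz h.isCore h1 h2]
  have := one_le_w (C := C) (T := {u, y, z})
  split_ifs <;> linarith

lemma share_ex_le_one (h : C.core u v) (hu : ∀ t, C.core u t → t = v) (hT : {u, y, z} ∈ C.ex u v)
    (huy : u ≠ y) (huz : u ≠ z) (hyz : y ≠ z) (hc : C.core y z → ¬ C.clean y z) :
    C.share False u {u, y, z} ≤ 1 := by
  have m := mem_ex.1 hT
  have h1 : ¬ C.core u y := fun h' => m.2.2 (by simp [hu _ h'])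
  have h2 : ¬ C.core u z := fun h' => m.2.2 (by simp [hu _ h'])
  rw [share_ex_eq huy huz hyz h.isCore h1 h2]
  have hm := mono_ex h hT
  have := w_le_two' (C := C) (T := {u, y, z}) (by simp) hm
  by_cases hyz' : C.core y z
  · rw [if_pos hyz']
    split_ifs with hi
    · linarith
    · unfold irr at hi
      have : C.mono y {u, y, z} ∨ C.mono z {u, y, z} := by have := hc hyz'; tauto
      rcases this with h' | h'
      · exact (w_eq_one' (by simp) (by simp) huy hm h').le
      · exact (w_eq_one' (by simp) (by simp) huz hm h').le
  · rw [if_neg hyz', if_neg not_false]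
    split_ifs <;> linarith

/-- A second core vertex halves the share. -/
lemma share_le_half (huy : u ≠ y) (huz : u ≠ z) (hyz : y ≠ z) (hu : C.isCore u) (h1 : ¬ C.core u y)
    (h2 : ¬ C.core u z) (h3 : ¬ C.core y z) (hy : C.isCore y) (hw : (C.w {u, y, z} : ℚ) = 1) :
    C.share l u {u, y, z} ≤ 1 / 2 := by
  rw [share_ex_eq huy huz hyz hu h1 h2, if_neg h3, hw, if_pos (Or.inl hy : C.isCore y ∨ C.isCore z)]
  split_ifs <;> norm_num

lemma ex_eq_singleton_of_clean (h : C.core u v) (hT : {u, y, z} ∈ C.ex u v)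
    (huy : u ≠ y) (huz : u ≠ z) (hc : C.core y z) (hcl : C.clean y z) :
    C.ex u v = {{u, y, z}} ∧ C.irrs u v = ∅ := by
  have m := mem_ex.1 hT
  have hyv : y ≠ v := by rintro rfl; exact m.2.2 (by simp)
  have hzv : z ≠ v := by rintro rfl; exact m.2.2 (by simp)
  have leaf : ∀ x, x ≠ u → x ≠ v → {u, v, x} ∈ C.H → x ≠ y ∧ x ≠ z := by
    intro x hxu hxv hx
    have := hcl _ hx
    have := hc.1
    grind
  constructor
  · refine Finset.eq_singleton_iff_unique_mem.2 ⟨hT, fun T' hT' => ?_⟩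
    by_contra hne
    have m' := mem_ex.1 hT'
    have hyT : y ∉ T' := by
      intro hy
      exact hne (eq_triple m'.1 m'.2.1 hy ((hcl _ m'.1).1 hy) huy huz hc.1)
    have hzT : z ∉ T' := fun hz => hyT ((hcl _ m'.1).2 hz)
    obtain ⟨p, q, hp, hq, hpq, rfl⟩ := exists_eq m'.1 m'.2.1
    obtain ⟨-, hcov, -⟩ := ex_eq_pair h hT hT' (by grind)
    obtain ⟨x, hxu, hxv, hxp, hxq, -, hx⟩ := h.exists_avoid p q q
    have := leaf x hxu hxv hx
    have := hcov x hxu hxv hx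
    grind
  · refine Finset.eq_empty_of_forall_notMem fun T hT' => ?_
    have m' := mem_irrs.1 hT'
    obtain ⟨x, hxu, hxv, rfl⟩ := exists_eq_pair m'.1 m'.2.1.1 m'.2.1.2 h.1
    have := mem_of_irrs hT' hT
    have := leaf x hxu hxv m'.1
    grind

/-- The charge of an end of the core. -/
lemma ch_end_le (h : C.core u v) (hu : ∀ t, C.core u t → t = v) : C.ch False u ≤ 3 := by
  rw [ch_eq_ex_add u v]
  have h1 := sum_share_end_le (l := False) h hu
  by_cases hcl : ∃ y z, u ≠ y ∧ u ≠ z ∧ {u, y, z} ∈ C.ex u v ∧ C.core y z ∧ C.clean y z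
  · obtain ⟨y, z, huy, huz, hT, hc, hcl⟩ := hcl
    obtain ⟨e1, e2⟩ := ex_eq_singleton_of_clean h hT huy huz hc hcl
    rw [e2] at h1
    rw [e1, Finset.sum_singleton]
    have := share_ex_le_w (l := False) h hu hT
    have := w_le_two' (C := C) (T := {u, y, z}) (by simp) (mono_ex h hT)
    simp only [Finset.card_empty, Nat.cast_zero] at h1
    linarith
  · push Not at hcl
    have h2 : ∑ T ∈ C.ex u v, C.share False u T ≤ (C.ex u v).card := by
      refine (Finset.sum_le_card_nsmul _ _ 1 fun T hT => ?_).trans (by simp)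
      obtain ⟨y, z, huy, huz, hyz, rfl⟩ := exists_eq (mem_ex.1 hT).1 (mem_ex.1 hT).2.1
      exact share_ex_le_one h hu hT huy huz hyz (hcl y z huy huz hT)
    have h3 : ((C.ex u v).card : ℚ) + (C.irrs u v).card ≤ 3 := by
      exact_mod_cast card_ex_add_card_irrs_le h hu
    linarith

/-- Both vertices of a clean core pair receive nothing. -/
lemma ch_clean_le (h : C.core u v) (hc : C.clean u v) : C.ch l u ≤ 0 := by
  have hu : ∀ t, C.core u t → t = v := by
    intro t ht
    by_contra hne
    obtain ⟨x, hxu, hxt, hxv, -, -, hx⟩ := ht.exists_avoid v v v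
    have := (hc _ hx).1 (by simp)
    have := h.1
    grind
  rw [ch_eq_ex_add u v]
  have h1 : C.ex u v = ∅ := Finset.eq_empty_of_forall_notMem fun T hT =>
    (mem_ex.1 hT).2.2 ((hc T (mem_ex.1 hT).1).1 (mem_ex.1 hT).2.1)
  have h2 : C.irrs u v = ∅ := Finset.eq_empty_of_forall_notMem fun T hT =>
    (mem_irrs.1 hT).2.2.2.2 hc
  have := sum_share_end_le (l := l) h hu
  rw [h2] at this
  rw [h1, Finset.sum_empty, zero_add]
  simpa using this

/-- If `b` has the core neighbours `a` and `c`, then only the triple `{a, b, c}` gives something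
to it. -/
lemma ch_deg_two_eq (hba : C.core b a) (hbc : C.core b c) (hac : a ≠ c) :
    C.ch l b = if {a, b, c} ∈ C.H then C.share l b {a, b, c} else 0 := by
  have key : ∀ T ∈ C.H, b ∈ T → T ≠ {a, b, c} → C.share l b T = 0 := by
    intro T hT hb hne
    have aux : ∀ a c, C.core b a → C.core b c → a ≠ c → a ∈ T → c ∉ T → C.share l b T = 0 := by
      intro a c hba hbc hac ha hc
      obtain ⟨x, hxb, hxa, rfl⟩ := exists_eq_pair hT hb ha hba.1
      have h1 : ¬ C.core b x := by
        intro h1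
        rcases hba.eq_or_eq hbc hac h1 with rfl | rfl
        · exact hxa rfl
        · simp at hc
      have h2 : ¬ (C.core b a ∧ C.core b x) := fun h => h1 h.2
      have h3 : ¬ C.irr {b, a, x} b a := fun hi => hi.1 (hbc.mono hT (by simp) hc)
      rw [share_eq hba.1 hxb.symm hxa.symm rfl, triShare, if_neg h2, if_pos (Or.inl hba), if_neg h2,
        if_pos hba, if_neg h3, ite_self]
    by_cases ha : a ∈ T
    · by_cases hc : c ∈ T
      · exact absurd (eq_triple hT ha hb hc hba.1.symm hac hbc.1) hne
      · exact aux a c hba hbc hac ha hc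
    · rcases hba.mem_or_mem hbc hac hT hb with h | h
      · exact absurd h ha
      · exact aux c a hbc hba hac.symm h ha
  unfold ch
  split_ifs with h
  · refine Finset.sum_eq_single_of_mem _ (by simp [h]) fun T hT hne => ?_
    rw [Finset.mem_filter] at hT
    exact key T hT.1 hT.2 hne
  · refine Finset.sum_eq_zero fun T hT => ?_
    rw [Finset.mem_filter] at hT
    exact key T hT.1 hT.2 (by rintro rfl; exact h hT.1)

lemma share_mid_le (hba : C.core b a) (hbc : C.core b c) (hac : a ≠ c) :
    C.share l b {a, b, c} ≤ C.w {a, b, c} := by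
  have e : ({a, b, c} : Finset V) = {b, a, c} := by ext; simp; tauto
  rw [share_eq hba.1 hbc.1 hac e, triShare]
  have := one_le_w (C := C) (T := {a, b, c})
  by_cases h : C.core a c
  · rw [if_pos h, if_pos ⟨hba, hbc⟩]; linarith
  · rw [if_neg h, if_pos ⟨hba, hbc⟩]

lemma ch_deg_two_le (hba : C.core b a) (hbc : C.core b c) (hac : a ≠ c) :
    C.ch l b ≤ if {a, b, c} ∈ C.H then (C.w {a, b, c} : ℚ) else 0 := by
  rw [ch_deg_two_eq hba hbc hac]
  split_ifs
  · exact share_mid_le hba hbc hac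
  · exact le_rfl

lemma ch_deg_two_le_four (hba : C.core b a) (hbc : C.core b c) (hac : a ≠ c) : C.ch l b ≤ 4 := by
  refine (ch_deg_two_le hba hbc hac).trans ?_
  split_ifs
  · exact w_le_four'
  · norm_num

lemma ch_triangle_le (hab : C.core a b) (hac : C.core a c) (hbc : C.core b c) :
    C.ch l a ≤ 4 / 3 := by
  rw [ch_deg_two_eq hab hac hbc.1]
  split_ifs
  · have e : ({b, a, c} : Finset V) = {a, b, c} := by ext; simp; tauto
    rw [share_eq hab.1 hac.1 hbc.1 e, triShare, if_pos hbc, if_pos ⟨hab, hac⟩]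
    have := w_le_four' (C := C) (T := {b, a, c})
    linarith
  · norm_num

/-- The core graph around `u`: no neighbour, one neighbour, or two. -/
lemma core_cases (u : V) : ¬ C.isCore u ∨ (∃ v, C.core u v ∧ ∀ t, C.core u t → t = v) ∨
    ∃ v v', C.core u v ∧ C.core u v' ∧ v ≠ v' := by
  by_cases h : C.isCore u
  · right
    obtain ⟨v, hv⟩ := h
    by_cases h' : ∀ t, C.core u t → t = v
    · exact Or.inl ⟨v, hv, h'⟩
    · push Not at h'
      obtain ⟨t, ht, hne⟩ := h'
      exact Or.inr ⟨v, t, hv, ht, hne.symm⟩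
  · exact Or.inl h

lemma ch_core_le_four (hu : C.isCore u) : C.ch False u ≤ 4 := by
  rcases core_cases (C := C) u with h | ⟨v, h, h'⟩ | ⟨v, v', h, h', hne⟩
  · exact absurd hu h
  · exact (ch_end_le h h').trans (by norm_num)
  · exact ch_deg_two_le_four h h' hne

end

end SignedTriples

/-! ### Paths and triangles in the core graph -/

namespace SignedTriples

noncomputable section

open Classical

variable {V : Type*} {C : SignedTriples V} {T T' T₁ T₂ : Finset V} {a b c d t u v x y z : V}
  {l : Prop} {s : Bool}

lemma ch_end_eq (h : C.core a b) (ha : ∀ t, C.core a t → t = b) (h' : C.core b c) (hc : c ≠ a) :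
    C.ch l a = ∑ T ∈ C.ex a b, C.share l a T := by
  rw [ch_eq_ex_add a b, add_eq_left]
  refine Finset.sum_eq_zero fun T hT => ?_
  rw [Finset.mem_filter] at hT
  exact share_end_eq_zero h ha h' hc hT.1 hT.2.1 hT.2.2

/-- In a path `a`, `b`, `c` of the core graph with ends `a` and `c`, the vertex `a` gets at most
half of each triple, if all triples through `a` avoiding `b` contain `c`. -/
lemma ch_path_end_le (h : C.core a b) (ha : ∀ t, C.core a t → t = b) (h' : C.core b c)
    (hc : ∀ t, C.core c t → t = b) (hac : a ≠ c) (he : ∀ T ∈ C.ex a b, c ∈ T) :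
    C.ch l a ≤ ((C.ex a b).card : ℚ) / 2 := by
  rw [ch_end_eq h ha h' hac.symm]
  refine (Finset.sum_le_card_nsmul _ _ (1 / 2) fun T hT => ?_).trans (by
    rw [nsmul_eq_mul]; linarith)
  have m := mem_ex.1 hT
  obtain ⟨y, hya, hyc, rfl⟩ := exists_eq_pair m.1 m.2.1 (he T hT) hac
  have hyb : y ≠ b := by rintro rfl; exact m.2.2 (by simp)
  have hbc := h'.1
  have h1 : ¬ C.core a c := fun h1 => hbc (ha _ h1).symm
  have h2 : ¬ C.core a y := fun h1 => hyb (ha _ h1)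
  have h3 : ¬ C.core c y := fun h1 => hyb (hc _ h1)
  have hm : C.mono c {a, c, y} := h'.symm.mono m.1 (by simp) m.2.2
  exact share_le_half hac hya.symm hyc.symm h.isCore h1 h2 h3 h'.symm.isCore
    (w_eq_one' (by simp) (by simp) hac (mono_ex h hT) hm)

lemma mono_mid (hH : {a, b, c} ∈ C.H) (hT : T ∈ C.ex a b)
    (hc : c ∉ T) : C.mono a {a, b, c} := by
  have m := mem_ex.1 hT
  exact mono_of_conflict hH m.1 (by simp) m.2.1 (by grind)

/-- The charge of an isolated path `a`, `b`, `c` of the core graph. -/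
lemma ch_path_le (h : C.core a b) (ha : ∀ t, C.core a t → t = b) (h' : C.core b c)
    (hc : ∀ t, C.core c t → t = b) (hac : a ≠ c) :
    C.ch False a + C.ch False b + C.ch False c ≤ 7 := by
  have h1 := ch_end_le h ha
  have h2 := ch_end_le h'.symm hc
  have h3 := ch_deg_two_le (l := False) h.symm h' hac
  split_ifs at h3 with hH
  swap
  · linarith
  have e : ({a, b, c} : Finset V) = {c, b, a} := by ext; simp; tauto
  have key : ∀ a c, C.core a b → (∀ t, C.core a t → t = b) → C.core b c →
      (∀ t, C.core c t → t = b) → a ≠ c → {a, b, c} ∈ C.H →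
      C.mono a {a, b, c} ∨ C.ch False a ≤ 3 / 2 := by
    intro a c h ha h' hc hac hH
    by_cases he : ∀ T ∈ C.ex a b, c ∈ T
    · right
      have h4 := ch_path_end_le (l := False) h ha h' hc hac he
      have : ((C.ex a b).card : ℚ) ≤ 3 := by exact_mod_cast card_ex_le h ha
      linarith
    · left
      push Not at he
      obtain ⟨T, hT, hcT⟩ := he
      exact mono_mid hH hT hcT
  have k1 := key a c h ha h' hc hac hH
  have k2 := key c a h'.symm hc h.symm ha hac.symm (e ▸ hH)
  rw [← e] at k2
  have h4 := w_le_four' (C := C) (T := {a, b, c})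
  rcases k1 with k1 | k1 <;> rcases k2 with k2 | k2
  · have := w_eq_one' (by simp) (by simp) hac k1 k2; linarith
  · have := w_le_two' (by simp) k1; linarith
  · have := w_le_two' (by simp) k2; linarith
  · linarith

/-- The charge of two neighbouring vertices `a`, `b` on a path `a`, `b`, `c`, `d` of the core
graph. -/
lemma ch_add_ch_le (hba : C.core b a) (hbc : C.core b c) (hcd : C.core c d) (hac : a ≠ c)
    (hbd : b ≠ d) (hnac : ¬ C.core a c) : C.ch False a + C.ch False b ≤ 4 := by
  have hb := ch_deg_two_le (l := False) hba hbc hac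
  have hda : d ≠ a := by rintro rfl; exact hnac hcd.symm
  have hcm : {a, b, c} ∈ C.H → C.mono c {a, b, c} := fun hH => hcd.mono hH (by simp) (by
    have := hcd.1; simp; grind)
  rcases core_cases (C := C) a with h | ⟨v, h, ha⟩ | ⟨v, v', h, h', hne⟩
  · exact absurd hba.symm.isCore h
  · obtain rfl := ha _ hba.symm
    have h3 := ch_end_le h ha
    split_ifs at hb with hH
    swap
    · linarith
    by_cases he : ∀ T ∈ C.ex a b, c ∈ T
    · have h2 := w_le_two' (by simp) (hcm hH)
      have : C.ch False a ≤ 1 := by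
        rw [ch_end_eq h ha hbc hac.symm]
        have hsub : C.ex a b ⊆ {{a, c, d}} := by
          intro T hT
          have m := mem_ex.1 hT
          have hcT := he T hT
          have hdT : d ∈ T := by
            rcases hbc.symm.mem_or_mem hcd hbd m.1 hcT with h | h
            · exact absurd h m.2.2
            · exact h
          rw [Finset.mem_singleton]
          exact eq_triple m.1 m.2.1 hcT hdT hac hda.symm hcd.1
        rcases Finset.subset_singleton_iff.1 hsub with h0 | h0
        · rw [h0, Finset.sum_empty]; norm_num
        · have hT : {a, c, d} ∈ C.ex a b := by rw [h0]; simp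
          have m := mem_ex.1 hT
          rw [h0, Finset.sum_singleton]
          refine (share_ex_le_w h ha hT).trans (le_of_eq ?_)
          exact w_eq_one' (by simp) (by simp) hac (mono_ex h hT)
            (hbc.symm.mono m.1 (by simp) m.2.2)
      linarith
    · push Not at he
      obtain ⟨T, hT, hcT⟩ := he
      have := w_eq_one' (by simp) (by simp) hac (mono_mid hH hT hcT) (hcm hH)
      linarith
  · obtain ⟨a', ha', hne'⟩ : ∃ a', C.core a a' ∧ a' ≠ b := by
      by_cases hvb : v = b
      · exact ⟨v', h', fun h => hne (hvb.trans h.symm)⟩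
      · exact ⟨v, h, hvb⟩
    have ha'c : a' ≠ c := by rintro rfl; exact hnac ha'
    have h5 := ch_deg_two_le (l := False) ha' hba.symm hne'
    have h6 : C.ch False a ≤ 2 := by
      refine h5.trans ?_
      split_ifs with hH
      · exact w_le_two' (by simp : b ∈ _) (hbc.mono hH (by simp) (by
          have := hbc.1; simp; grind))
      · norm_num
    split_ifs at hb with hH
    · have : C.mono a {a, b, c} := ha'.mono hH (by simp) (by have := ha'.1; simp; grind)
      have := w_eq_one' (by simp) (by simp) hac this (hcm hH)
      linarith
    · linarith

/-- A non-core vertex on the leaves of two isolated edges of the core graph. -/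
lemma ch_common_leaf_le {u' v' : V} (hn : ¬ C.isCore x) (h : C.core u v)
    (hu : ∀ t, C.core u t → t = v) (hv : ∀ t, C.core v t → t = u) (h' : C.core u' v')
    (hu' : ∀ t, C.core u' t → t = v') (hv' : ∀ t, C.core v' t → t = u')
    (hc : ¬ C.clean u v) (hc' : ¬ C.clean u' v') (hne : u' ≠ u ∧ u' ≠ v ∧ v' ≠ u ∧ v' ≠ v)
    (hT : {x, u, v} ∈ C.H) (hT' : {x, u', v'} ∈ C.H) : C.ch False x ≤ 2 := by
  have hx : ∀ t, C.isCore t → x ≠ t := by rintro t ht rfl; exact hn ht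
  have hxu := hx _ h.isCore
  have hxv := hx _ h.symm.isCore
  have hxu' := hx _ h'.isCore
  have hxv' := hx _ h'.symm.isCore
  have c₁ := conflict (x := x) hT hT' (by simp) (by simp) (by grind)
  have c₂ := conflict (x := x) hT' hT (by simp) (by simp) (by grind)
  have key : ∀ u v u' v', C.core u v → (∀ t, C.core u t → t = v) → (∀ t, C.core v t → t = u) →
      ¬ C.clean u v → C.core u' v' → (u' ≠ u ∧ u' ≠ v ∧ v' ≠ u ∧ v' ≠ v) → ∀ s,
      {x, u, v} ∈ C.cls x s → {x, u', v'} ∈ C.cls x (!s) → ∑ T ∈ C.cls x s, C.part False x T ≤ 1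
      := by
    intro u v u' v' h hu hv hc h' hne s hs hs'
    have hxu := hx _ h.isCore
    have hxv := hx _ h.symm.isCore
    have hxu' := hx _ h'.isCore
    have hxv' := hx _ h'.symm.isCore
    refine (sum_le_add_two_mul (card_cls_le hn s) le_rfl hs
      (part_le_one_of_core hxu hxv hn h hc) fun T hT hne' => ?_).trans (by norm_num)
    have m := mem_cls.1 hT
    have hp : ¬ C.paired T := fun hp => hne' (eq_of_paired hn hs h hxu hxv hu hv hT hp)
    by_cases hm : C.mono x T
    · refine (part_mixed_le m.1 m.2.1 hn hp (not_far_of_paired hn hs ⟨u, by simp, v, by simp, h⟩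
        hT)).trans ?_
      rw [if_pos (Or.inr hm)]
    · have hT2 : T ∈ C.cls x (!s) := mem_cls.2 ⟨m.1, m.2.1, side_of_not_mono hm _⟩
      obtain ⟨p, hpx, hp1, hp2⟩ := cls_meet hT hs
      obtain ⟨q, hqx, hq1, hq2⟩ := cls_meet hT2 hs'
      have hpq : p ≠ q := by grind
      have hpc : C.isCore p := by
        simp only [Finset.mem_insert, Finset.mem_singleton] at hp2
        rcases hp2 with rfl | rfl | rfl
        exacts [absurd rfl hpx, h.isCore, h.symm.isCore]
      have hqc : C.isCore q := by
        simp only [Finset.mem_insert, Finset.mem_singleton] at hq2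
        rcases hq2 with rfl | rfl | rfl
        exacts [absurd rfl hqx, h'.isCore, h'.symm.isCore]
      rw [eq_triple m.1 m.2.1 hp1 hq1 hpx.symm hqx.symm hpq, part_eq_zero hpx.symm hqx.symm hpq hn
        hpc hqc fun h => hp ⟨p, hp1, q, hq1, h⟩]
  obtain ⟨s, hs⟩ := C.exists_side _ hT x (by simp)
  have hs' : C.side x (!s) {x, u', v'} := side_not hT' (by simp) (c₁ s hs)
  have k₁ := key u v u' v' h hu hv hc h' hne s (mem_cls.2 ⟨hT, by simp, hs⟩)
    (mem_cls.2 ⟨hT', by simp, hs'⟩)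
  have k₂ := key u' v' u v h' hu' hv' hc' h (by grind) (!s) (mem_cls.2 ⟨hT', by simp, hs'⟩)
    (mem_cls.2 ⟨hT, by simp, by simpa using hs⟩)
  rw [ch_eq_sum_cls]
  cases s
  · simp only [Bool.not_false] at k₂; linarith
  · simp only [Bool.not_true] at k₂; linarith

lemma ch_eq_sum_cls' (s : Bool) : C.ch l x =
    ∑ T ∈ C.cls x s, C.part l x T + ∑ T ∈ C.cls x (!s), C.part l x T := by
  rw [ch_eq_sum_cls]; cases s
  · rw [add_comm]; rfl
  · rfl

/-- If the core graph is a path `a`, `b`, `c`, then a triple of weight `1` on `a`, `b` limits the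
charge of its third element. -/
lemma ch_path_leaf_le (h : C.core a b) (h' : C.core b c) (hac : ¬ C.core a c)
    (hac' : a ≠ c) (hall : ∀ t, C.isCore t → t = a ∨ t = b ∨ t = c) (hn : ¬ C.isCore x)
    (hT : {x, a, b} ∈ C.H) (hw : C.w {x, a, b} = 1) : C.ch False x ≤ 3 := by
  have hx : ∀ t, C.isCore t → x ≠ t := by rintro t ht rfl; exact hn ht
  have hxa := hx _ h.isCore
  have hxb := hx _ h.symm.isCore
  have hxc := hx _ h'.symm.isCore
  have hab := h.1
  have hbc := h'.1
  have hcl : ¬ C.clean a b := fun hcl => by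
    obtain ⟨y, hyb, hyc, hya, -, -, hy⟩ := h'.exists_avoid a a a
    have := (hcl _ hy).2 (by simp)
    grind
  have hcl' : ¬ C.clean b c := fun hcl => by
    obtain ⟨y, hyb, hyc, hya, -, -, hy⟩ := h.exists_avoid c c c
    have := (hcl _ hy).1 (by simp)
    grind
  -- the only triples on core pairs at `x`
  have hpair : ∀ T ∈ C.H, x ∈ T → C.paired T → T = {x, a, b} ∨ T = {x, b, c} := by
    intro T hT hxT hp
    obtain ⟨y, z, hxy, hxz, hyz, rfl, hyz'⟩ := hp.exists_eq hT hxT hn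
    have hca : ¬ C.core c a := fun h => hac h.symm
    rcases hall y hyz'.isCore with rfl | rfl | rfl <;>
      rcases hall z hyz'.symm.isCore with rfl | rfl | rfl <;> first
      | exact absurd rfl hyz
      | exact absurd hyz' hac
      | exact absurd hyz' hca
      | (left; ext; simp; done)
      | (right; ext; simp; done)
      | (left; ext; simp; tauto)
      | (right; ext; simp; tauto)
  have p0 : C.paired {x, a, b} := ⟨a, by simp, b, by simp, h⟩
  have p1 : C.paired {x, b, c} := ⟨b, by simp, c, by simp, h'⟩
  have hne : ({x, a, b} : Finset V) ≠ {x, b, c} := by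
    intro e; have : a ∈ ({x, b, c} : Finset V) := by rw [← e]; simp
    simp at this; grind
  have hzero : ∀ s, {x, a, b} ∈ C.cls x s → {x, b, c} ∈ C.cls x s → ∀ T ∈ C.cls x s,
      T ≠ {x, a, b} → T ≠ {x, b, c} → C.part False x T ≤ 0 := by
    intro s h0 h1 T hT n0 n1
    obtain ⟨y, z, t, hxy, hxz, hxt, hyz, hyt, hzt, e0, e1, hyz', hyt', h7⟩ :=
      cls_two_paired hn h0 h1 hne p0 p1
    obtain rfl := h7 T hT n0 n1
    by_cases hzt' : C.core z t
    · exact absurd (hpair _ (mem_cls.1 hT).1 (by simp) ⟨z, by simp, t, by simp, hzt'⟩) (by tauto)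
    · rw [part_eq_zero hxz hxt hzt hn hyz'.symm.isCore hyt'.symm.isCore hzt']
  have hle2 : ∀ s, ∑ T ∈ C.cls x s, C.part False x T ≤ 2 := by
    intro s
    rcases sum_cls_le_two_or (l := False) hn s with h2 | ⟨-, y, z, t, hxy, hxz, hxt, hyz, hyt, hzt,
      h1, h2, h3, e⟩
    · exact h2
    · exfalso
      have a1 := hpair {x, y, z} (mem_cls.1 (by rw [e]; simp)).1 (by simp)
        ⟨y, by simp, z, by simp, h1⟩
      have a2 := hpair {x, y, t} (mem_cls.1 (by rw [e]; simp)).1 (by simp)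
        ⟨y, by simp, t, by simp, h2⟩
      have a3 := hpair {x, z, t} (mem_cls.1 (by rw [e]; simp)).1 (by simp)
        ⟨z, by simp, t, by simp, h3⟩
      have n1 : ({x, y, z} : Finset V) ≠ {x, y, t} := fun e => by
        have : z ∈ ({x, y, t} : Finset V) := by rw [← e]; simp
        simp at this; grind
      have n2 : ({x, y, z} : Finset V) ≠ {x, z, t} := fun e => by
        have : y ∈ ({x, z, t} : Finset V) := by rw [← e]; simp
        simp at this; grind
      have n3 : ({x, y, t} : Finset V) ≠ {x, z, t} := fun e => by
        have : y ∈ ({x, z, t} : Finset V) := by rw [← e]; simp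
        simp at this; grind
      grind
  have hone : ∀ s, ({x, a, b} ∈ C.cls x s → {x, b, c} ∉ C.cls x s) →
      ({x, a, b} ∈ C.cls x s ∨ {x, b, c} ∈ C.cls x s) →
      ∑ T ∈ C.cls x s, C.part False x T ≤ 3 / 2 := by
    intro s h1 h2
    rcases h2 with h2 | h2
    · refine sum_cls_le_of_unique hn h2 hxa hxb h hcl fun T hT hp => ?_
      rcases hpair T (mem_cls.1 hT).1 (mem_cls.1 hT).2.1 hp with rfl | rfl
      · rfl
      · exact absurd hT (h1 h2)
    · refine sum_cls_le_of_unique hn h2 hxb hxc h' hcl' fun T hT hp => ?_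
      rcases hpair T (mem_cls.1 hT).1 (mem_cls.1 hT).2.1 hp with rfl | rfl
      · exact absurd h2 (h1 hT)
      · rfl
  by_cases hm : C.mono x {x, a, b}
  · obtain ⟨s, hs⟩ := C.exists_side _ hT x (by simp)
    have hns := not_side_of_mono hm hs
    have h0 : {x, a, b} ∈ C.cls x s := mem_cls.2 ⟨hT, by simp, hs⟩
    have h0' : {x, a, b} ∉ C.cls x (!s) := fun h => hns (mem_cls.1 h).2.2
    rw [ch_eq_sum_cls' s]
    by_cases h1 : {x, b, c} ∈ C.cls x (!s)
    · by_cases h2 : {x, b, c} ∈ C.cls x s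
      · have : ∑ T ∈ C.cls x (!s), C.part False x T ≤ 1 := by
          refine (sum_le_add_two_mul (card_cls_le hn (!s)) le_rfl h1
            (part_le_one_of_core hxb hxc hn h' hcl') fun T hT' hne' => ?_).trans (by norm_num)
          have m := mem_cls.1 hT'
          by_cases hm' : C.mono x T
          · have hp : ¬ C.paired T := fun hp => by
              rcases hpair T m.1 m.2.1 hp with rfl | rfl
              · exact h0' hT'
              · exact hne' rfl
            refine (part_mixed_le m.1 m.2.1 hn hp (not_far_of_paired hn h1 p1 hT')).trans ?_
            rw [if_pos (Or.inr hm')]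
          · refine hzero s h0 h2 T (mem_cls.2 ⟨m.1, m.2.1, side_of_not_mono hm' _⟩) ?_ hne'
            rintro rfl
            exact h0' hT'
        have := hle2 s
        linarith
      · have := hone s (fun _ => h2) (Or.inl h0)
        have := hone (!s) (fun h => absurd h h0') (Or.inr h1)
        linarith
    · have : ∑ T ∈ C.cls x (!s), C.part False x T ≤ 1 := by
        refine (sum_le_three_mul (card_cls_le hn (!s)) (q := 1 / 3) (by norm_num)
          fun T hT' => ?_).trans (by norm_num)
        have m := mem_cls.1 hT'
        have hp : ¬ C.paired T := fun hp => by
          rcases hpair T m.1 m.2.1 hp with rfl | rfl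
          · exact h0' hT'
          · exact h1 hT'
        by_cases hf : C.far T
        · refine part_far_le_of_mono m.1 m.2.1 hf ?_
          by_contra hm'
          exact not_far_of_paired hn h0 p0 (mem_cls.2 ⟨m.1, m.2.1, side_of_not_mono hm' _⟩) hf
        · exact (part_mixed_le_quarter m.1 m.2.1 hn hp hf).trans (by norm_num)
      have := hle2 s
      linarith
  · have hhalf : C.part False x {x, a, b} ≤ 1 / 2 := by
      rw [part, if_neg hm]
      have := share_leaf_le (C := C) (l := False) hxa hxb hn h
      rw [hw] at this
      norm_num at this
      linarith
    have h0 : ∀ s, {x, a, b} ∈ C.cls x s := fun s => mem_cls.2 ⟨hT, by simp, side_of_not_mono hm s⟩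
    have hs : ∀ s, ∑ T ∈ C.cls x s, C.part False x T ≤ 3 / 2 := by
      intro s
      by_cases h1 : {x, b, c} ∈ C.cls x s
      · exact (sum_le_add (h0 s) h1 hne hhalf (part_le_one_of_core hxb hxc hn h' hcl')
          (hzero s (h0 s) h1)).trans (by norm_num)
      · exact hone s (fun _ => h1) (Or.inl (h0 s))
    rw [ch_eq_sum_cls]
    linarith [hs true, hs false]

/-- Triples on a pair of a core triangle have weight `1`. -/
lemma w_eq_one_of_triangle (hxy : C.core x y) (hxz : C.core x z) (hyz : C.core y z)
    (hT : {t, x, y} ∈ C.H) (htz : t ≠ z) : C.w {t, x, y} = 1 :=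
  w_eq_one (by simp : x ∈ _) (by simp : y ∈ _) hxy.1
    (hxz.mono hT (by simp) (by have := hxz.1; have := hyz.1; simp; grind))
    (hyz.mono hT (by simp) (by have := hxz.1; have := hyz.1; simp; grind))

lemma mem_pairs {p q : V} (hp : p ∈ ({y, z, t} : Finset V)) (hq : q ∈ ({y, z, t} : Finset V))
    (hpq : p ≠ q) : {x, p, q} ∈ ({{x, y, z}, {x, y, t}, {x, z, t}} : Finset (Finset V)) := by
  simp only [Finset.mem_insert, Finset.mem_singleton] at hp hq ⊢
  rcases hp with rfl | rfl | rfl <;> rcases hq with rfl | rfl | rfl <;> first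
    | exact absurd rfl hpq
    | (left; rfl)
    | (right; left; rfl)
    | (right; right; rfl)
    | (left; exact congrArg (insert x) (Finset.pair_comm _ _))
    | (right; left; exact congrArg (insert x) (Finset.pair_comm _ _))
    | (right; right; exact congrArg (insert x) (Finset.pair_comm _ _))

/-- If all core triangles have the same vertices, then a non-core vertex has charge at most `5`. -/
lemma ch_le_five (hn : ¬ C.isCore x)
    (htri : ∀ y z t, C.core y z → C.core y t → C.core z t → y ∈ ({a, b, c} : Finset V)) :
    C.ch False x ≤ 5 := by
  rw [ch_eq_sum_cls]
  have h1 := sum_cls_le_three (l := False) hn true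
  have h2 := sum_cls_le_three (l := False) hn false
  rcases sum_cls_le_two_or (l := False) hn true with h | ⟨-, y, z, t, hxy, hxz, hxt, hyz, hyt, hzt,
    e1, e2, e3, e⟩
  · linarith
  rcases sum_cls_le_two_or (l := False) hn false with h' | ⟨-, y', z', t', hxy', hxz', hxt', hyz',
    hyt', hzt', e1', e2', e3', e'⟩
  · linarith
  have m1 := htri _ _ _ e1 e2 e3
  have m2 := htri _ _ _ e1.symm e3 e2
  have m3 := htri _ _ _ e2.symm e3.symm e1
  have m1' := htri _ _ _ e1' e2' e3'
  have m2' := htri _ _ _ e1'.symm e3' e2'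
  have m3' := htri _ _ _ e2'.symm e3'.symm e1'
  have hsame : ({y, z, t} : Finset V) = {y', z', t'} := by
    have c1 : ({y, z, t} : Finset V).card = 3 := Finset.card_eq_three.2 ⟨y, z, t, hyz, hyt, hzt, rfl⟩
    have c2 : ({y', z', t'} : Finset V).card = 3 :=
      Finset.card_eq_three.2 ⟨y', z', t', hyz', hyt', hzt', rfl⟩
    have k1 : ({y, z, t} : Finset V) = {a, b, c} := Finset.eq_of_subset_of_card_le
      (by intro i hi; simp only [Finset.mem_insert, Finset.mem_singleton] at hi
          rcases hi with rfl | rfl | rfl <;> assumption)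
      (by rw [c1]; exact Finset.card_le_three)
    have k2 : ({y', z', t'} : Finset V) = {a, b, c} := Finset.eq_of_subset_of_card_le
      (by intro i hi; simp only [Finset.mem_insert, Finset.mem_singleton] at hi
          rcases hi with rfl | rfl | rfl <;> assumption)
      (by rw [c2]; exact Finset.card_le_three)
    rw [k1, k2]
  have hy' : y' ∈ ({y, z, t} : Finset V) := by rw [hsame]; simp
  have hz' : z' ∈ ({y, z, t} : Finset V) := by rw [hsame]; simp
  have ht' : t' ∈ ({y, z, t} : Finset V) := by rw [hsame]; simp
  -- both classes consist of the same three triples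
  have hcls : ∀ p q r, p ∈ ({y, z, t} : Finset V) → q ∈ ({y, z, t} : Finset V) → C.core p q →
      C.core p r → C.core q r → x ≠ p → x ≠ q → x ≠ r → {x, p, q} ∈ C.cls x false →
      C.part False x {x, p, q} ≤ 1 / 2 := by
    intro p q r hp hq hpq hpr hqr hxp hxq hxr hT
    have m := mem_cls.1 hT
    have hT' : {x, p, q} ∈ C.cls x true := by
      rw [e]
      exact mem_pairs hp hq hpq.1
    have hm : ¬ C.mono x {x, p, q} := by
      rintro ⟨s, hs⟩
      cases s
      · exact hs m.2.2
      · exact hs (mem_cls.1 hT').2.2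
    rw [part, if_neg hm]
    have := share_leaf_le (C := C) (l := False) hxp hxq hn hpq
    rw [w_eq_one_of_triangle hpq hpr hqr m.1 hxr] at this
    norm_num at this
    linarith
  have : ∑ T ∈ C.cls x false, C.part False x T ≤ 3 * (1 / 2) := by
    refine sum_le_three_mul (card_cls_le hn false) (by norm_num) fun T hT => ?_
    have hT' := hT
    rw [e'] at hT'
    simp only [Finset.mem_insert, Finset.mem_singleton] at hT'
    rcases hT' with rfl | rfl | rfl
    · exact hcls _ _ t' hy' hz' e1' e2' e3' hxy' hxz' hxt' hT
    · exact hcls _ _ z' hy' ht' e2' e1' e3'.symm hxy' hxt' hxz' hT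
    · exact hcls _ _ y' hz' ht' e3' e1'.symm e2'.symm hxz' hxt' hxy' hT
  linarith

/-- If all core pairs outside the triangles are isolated and not clean, then a non-core vertex has
charge at most `4`. -/
lemma ch_le_four_of_isolated (hn : ¬ C.isCore x)
    (htri : ∀ y z t, C.core y z → C.core y t → C.core z t → y ∈ ({a, b, c} : Finset V))
    (hiso : ∀ y z, C.core y z → y ∉ ({a, b, c} : Finset V) →
      (∀ t, C.core y t → t = z) ∧ (∀ t, C.core z t → t = y) ∧ ¬ C.clean y z) :
    C.ch False x ≤ 4 := by
  suffices H : ∀ s, 2 < ∑ T ∈ C.cls x s, C.part False x T → C.ch False x ≤ 4 by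
    by_cases h1 : 2 < ∑ T ∈ C.cls x true, C.part False x T
    · exact H _ h1
    by_cases h2 : 2 < ∑ T ∈ C.cls x false, C.part False x T
    · exact H _ h2
    rw [ch_eq_sum_cls]; linarith
  intro s hs
  rcases sum_cls_le_two_or (l := False) hn s with h | ⟨-, y, z, t, hxy, hxz, hxt, hyz, hyt, hzt,
    e1, e2, e3, e⟩
  · linarith
  have m1 := htri _ _ _ e1 e2 e3
  have m2 := htri _ _ _ e1.symm e3 e2
  have m3 := htri _ _ _ e2.symm e3.symm e1
  have habc : ({a, b, c} : Finset V) = {y, z, t} := by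
    symm
    refine Finset.eq_of_subset_of_card_le ?_ ?_
    · intro i hi; simp only [Finset.mem_insert, Finset.mem_singleton] at hi
      rcases hi with rfl | rfl | rfl <;> assumption
    · rw [Finset.card_eq_three.2 ⟨y, z, t, hyz, hyt, hzt, rfl⟩]; exact Finset.card_le_three
  rw [habc] at hiso
  have hsplit : C.ch False x = ∑ T ∈ C.cls x s, C.share False x T +
      ∑ T ∈ C.H.filter (fun T => x ∈ T ∧ ¬ C.side x s T), C.share False x T := by
    rw [ch, ← Finset.sum_filter_add_sum_filter_not _ (fun T => C.side x s T)]
    simp only [Finset.filter_filter, cls]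
  have b1 : ∑ T ∈ C.cls x s, C.share False x T ≤ 3 * 1 := by
    refine sum_le_three_mul (card_cls_le hn s) (by norm_num) fun T hT => ?_
    have m := (mem_cls.1 hT).1
    rw [e] at hT
    simp only [Finset.mem_insert, Finset.mem_singleton] at hT
    rcases hT with rfl | rfl | rfl
    · have := share_leaf_le (C := C) (l := False) hxy hxz hn e1
      rwa [w_eq_one_of_triangle e1 e2 e3 m hxt, Nat.cast_one] at this
    · have := share_leaf_le (C := C) (l := False) hxy hxt hn e2
      rwa [w_eq_one_of_triangle e2 e1 e3.symm m hxz, Nat.cast_one] at this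
    · have := share_leaf_le (C := C) (l := False) hxz hxt hn e3
      rwa [w_eq_one_of_triangle e3 e1.symm e2.symm m hxy, Nat.cast_one] at this
  set A := C.H.filter (fun T => x ∈ T ∧ ¬ C.side x s T) with hA
  have hA' : ∀ T ∈ A, T ∈ C.H ∧ x ∈ T ∧ C.mono x T ∧ T ∈ C.cls x (!s) ∧ T ∉ C.cls x s := by
    intro T hT
    rw [hA, Finset.mem_filter] at hT
    have hr := side_not hT.1 hT.2.1 hT.2.2
    exact ⟨hT.1, hT.2.1, ⟨s, hT.2.2⟩, mem_cls.2 ⟨hT.1, hT.2.1, hr⟩,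
      fun h => hT.2.2 (mem_cls.1 h).2.2⟩
  have hcard : A.card ≤ 3 := (Finset.card_le_card fun T hT => (hA' T hT).2.2.2.1).trans
    (card_cls_le hn (!s))
  have hpart : ∀ T ∈ A, C.share False x T = C.part False x T := fun T hT => by
    rw [part, if_pos (hA' T hT).2.2.1]
  have b2 : ∑ T ∈ A, C.share False x T ≤ 1 := by
    by_cases hp : ∃ T ∈ A, C.paired T
    · obtain ⟨T, hT, hp⟩ := hp
      obtain ⟨k1, k2, k3, k4, k5⟩ := hA' T hT
      obtain ⟨p, q, hxp, hxq, hpq, rfl, hpq'⟩ := hp.exists_eq k1 k2 hn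
      have hpout : p ∉ ({y, z, t} : Finset V) := by
        intro hpin
        have hq : q ∈ ({y, z, t} : Finset V) := by
          simp only [Finset.mem_insert, Finset.mem_singleton] at hpin ⊢
          rcases hpin with rfl | rfl | rfl
          · have := e1.eq_or_eq e2 hzt hpq'; tauto
          · have := e1.symm.eq_or_eq e3 hyt hpq'; tauto
          · have := e2.symm.eq_or_eq e3.symm hyz hpq'; tauto
        refine k5 ?_
        rw [e]
        exact mem_pairs hpin hq hpq
      obtain ⟨i1, i2, i3⟩ := hiso _ _ hpq' hpout
      refine (sum_le_add_two_mul hcard le_rfl hT ?_ fun T' hT' hne => ?_).trans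
        (by norm_num : (1 : ℚ) + 2 * 0 ≤ 1)
      · rw [hpart _ hT]
        exact part_le_one_of_core hxp hxq hn hpq' i3
      · obtain ⟨j1, j2, j3, j4, j5⟩ := hA' T' hT'
        rw [hpart _ hT']
        refine (part_mixed_le j1 j2 hn (fun hp' => hne (eq_of_paired hn k4 hpq' hxp hxq i1 i2 j4 hp'))
          (not_far_of_paired hn k4 ⟨p, by simp, q, by simp, hpq'⟩ j4)).trans ?_
        rw [if_pos (Or.inr j3)]
    · push Not at hp
      refine (sum_le_three_mul hcard (q := 1 / 3) (by norm_num) fun T hT => ?_).trans (by norm_num)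
      obtain ⟨j1, j2, j3, j4, j5⟩ := hA' T hT
      rw [hpart _ hT]
      by_cases hf : C.far T
      · exact part_far_le_of_mono j1 j2 hf j3
      · exact (part_mixed_le_quarter j1 j2 hn (hp T hT) hf).trans (by norm_num)
  linarith

end

end SignedTriples

/-! ### Summing the charges when the core graph has a path or a triangle -/

/-- The value of the independence number of `G_n`, see `indepNum_graphG`. It is taken in `ℚ`, so
that the first term may be negative. -/
noncomputable def alphaBound (n : ℕ) : ℚ := max (6 * n - 28) (4 * n - 4 * cConst n)

lemma cConst_le_two (n : ℕ) : cConst n ≤ 2 := by unfold cConst; split_ifs <;> norm_num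

lemma six_mul_sub_le_alphaBound (n : ℕ) : 6 * (n : ℚ) - 28 ≤ alphaBound n := le_max_left _ _

lemma four_mul_sub_le_alphaBound (n : ℕ) : 4 * (n : ℚ) - 8 ≤ alphaBound n := by
  have : (cConst n : ℚ) ≤ 2 := by exact_mod_cast cConst_le_two n
  exact le_trans (by linarith) (le_max_right _ _)

lemma five_mul_sub_le_alphaBound (n : ℕ) : 5 * (n : ℚ) - 18 ≤ alphaBound n := by
  linarith [six_mul_sub_le_alphaBound n, four_mul_sub_le_alphaBound n]

namespace SignedTriples

noncomputable section

open Classical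

variable {V : Type*} {C : SignedTriples V} {T T' T₁ T₂ : Finset V} {a b c d t u v x y z : V}
  {l : Prop} {s : Bool} {U : Finset V}

variable (C) in
/-- The vertex `x` lies in a triangle of the core graph. -/
def inTri (x : V) : Prop := ∃ p q, C.core x p ∧ C.core x q ∧ C.core p q

lemma inTri.of_core (hx : C.inTri x) (h : C.core x y) : C.inTri y := by
  obtain ⟨p, q, hp, hq, hpq⟩ := hx
  rcases hp.eq_or_eq hq hpq.1 h with rfl | rfl
  · exact ⟨x, q, hp.symm, hpq, hq⟩
  · exact ⟨x, p, hq.symm, hpq.symm, hp⟩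

lemma isCore.mem (hU : ∀ T ∈ C.H, T ⊆ U) (h : C.isCore u) : u ∈ U := by
  obtain ⟨v, hv⟩ := h
  obtain ⟨x, -, -, -, -, -, hx⟩ := hv.exists_avoid u u u
  exact hU _ hx (by simp)

lemma sum_le_sub_slack {g : V → ℚ} {S : Finset V} {k m : ℚ} (hS : S ⊆ U) (h : ∀ x ∈ U, g x ≤ k)
    (hm : ∑ x ∈ S, g x ≤ k * S.card - m) : ∑ x ∈ U, g x ≤ k * U.card - m := by
  rw [← Finset.sum_sdiff hS]
  have h1 : ∑ x ∈ U \ S, g x ≤ (U \ S).card * k := by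
    rw [← nsmul_eq_mul]
    exact Finset.sum_le_card_nsmul _ _ _ fun x hx => h x (Finset.mem_sdiff.1 hx).1
  have h2 : ((U \ S).card : ℚ) = U.card - S.card := by
    rw [Finset.card_sdiff_of_subset hS, Nat.cast_sub (Finset.card_le_card hS)]
  rw [h2] at h1
  linarith

lemma ch_le_six (x : V) : C.ch False x ≤ 6 := by
  by_cases hn : C.isCore x
  · exact (ch_core_le_four hn).trans (by norm_num)
  · rw [ch_eq_sum_cls]
    linarith [sum_cls_le_three (l := False) hn true, sum_cls_le_three (l := False) hn false]

lemma sum_three (g : V → ℚ) (hab : a ≠ b) (hac : a ≠ c) (hbc : b ≠ c) :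
    ∑ x ∈ ({a, b, c} : Finset V), g x = g a + g b + g c := by
  rw [Finset.sum_insert (by simp [hab, hac]), Finset.sum_insert (by simp [hbc]),
    Finset.sum_singleton, add_assoc]

/-- If there are two disjoint core triangles, then each of their six vertices gets at most `4 / 3`,
and every other element at most `6`. -/
lemma sum_ch_le_of_two_triangles (hU : ∀ T ∈ C.H, T ⊆ U) (hab : C.core a b) (hac : C.core a c)
    (hbc : C.core b c) (hxy : C.core x y) (hxz : C.core x z) (hyz : C.core y z)
    (hx : x ∉ ({a, b, c} : Finset V)) : ∑ x ∈ U, C.ch False x ≤ 6 * U.card - 28 := by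
  have hA : ∀ p ∈ ({a, b, c} : Finset V), ∀ q, C.core p q → q ∈ ({a, b, c} : Finset V) := by
    intro p hp q hq
    simp only [Finset.mem_insert, Finset.mem_singleton] at hp ⊢
    rcases hp with rfl | rfl | rfl
    · have := hab.eq_or_eq hac hbc.1 hq; tauto
    · have := hab.symm.eq_or_eq hbc hac.1 hq; tauto
    · have := hac.symm.eq_or_eq hbc.symm hab.1 hq; tauto
  have hy : y ∉ ({a, b, c} : Finset V) := fun h => hx (hA _ h _ hxy.symm)
  have hz : z ∉ ({a, b, c} : Finset V) := fun h => hx (hA _ h _ hxz.symm)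
  have hd : Disjoint ({a, b, c} : Finset V) {x, y, z} := by
    rw [Finset.disjoint_right]
    intro i hi
    simp only [Finset.mem_insert, Finset.mem_singleton] at hi
    rcases hi with rfl | rfl | rfl <;> assumption
  have c1 : ({a, b, c} : Finset V).card = 3 :=
    Finset.card_eq_three.2 ⟨a, b, c, hab.1, hac.1, hbc.1, rfl⟩
  have c2 : ({x, y, z} : Finset V).card = 3 :=
    Finset.card_eq_three.2 ⟨x, y, z, hxy.1, hxz.1, hyz.1, rfl⟩
  refine sum_le_sub_slack (S := {a, b, c} ∪ {x, y, z}) ?_ (fun x _ => ch_le_six x) ?_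
  · intro i hi
    simp only [Finset.mem_union, Finset.mem_insert, Finset.mem_singleton] at hi
    rcases hi with (rfl | rfl | rfl) | rfl | rfl | rfl
    exacts [hab.isCore.mem hU, hbc.isCore.mem hU, hbc.symm.isCore.mem hU, hxy.isCore.mem hU,
      hyz.isCore.mem hU, hyz.symm.isCore.mem hU]
  · rw [Finset.sum_union hd, Finset.card_union_of_disjoint hd, c1, c2,
      sum_three _ hab.1 hac.1 hbc.1, sum_three _ hxy.1 hxz.1 hyz.1]
    have h1 := ch_triangle_le (l := False) hab hac hbc
    have h2 := ch_triangle_le (l := False) hab.symm hbc hac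
    have h3 := ch_triangle_le (l := False) hac.symm hbc.symm hab
    have h4 := ch_triangle_le (l := False) hxy hxz hyz
    have h5 := ch_triangle_le (l := False) hxy.symm hyz hxz
    have h6 := ch_triangle_le (l := False) hxz.symm hyz.symm hxy
    norm_num
    linarith

/-- A vertex with two core neighbours off the core triangles is the middle of an isolated path of
length two, or it lies on a longer path or on a cycle of length four. -/
lemma path_or (hba : C.core b a) (hbc : C.core b c) (hac : a ≠ c) (hn : ¬ C.inTri b) :
    ((∀ t, C.core a t → t = b) ∧ (∀ t, C.core c t → t = b)) ∨
    ∃ S : Finset V, S.card = 4 ∧ ∑ x ∈ S, C.ch False x ≤ 8 ∧ ∀ x ∈ S, C.isCore x ∧ ¬ C.inTri x := by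
  have hnac : ¬ C.core a c := fun h => hn ⟨a, c, hba, hbc, h⟩
  have key : ∀ a c d, C.core b a → C.core b c → a ≠ c → ¬ C.core a c → C.core c d → d ≠ b →
      ∃ S : Finset V, S.card = 4 ∧ ∑ x ∈ S, C.ch False x ≤ 8 ∧ ∀ x ∈ S, C.isCore x ∧ ¬ C.inTri x
      := by
    intro a c d hba hbc hac hnac hcd hdb
    have hbd : ¬ C.core b d := by
      intro h
      rcases hba.eq_or_eq hbc hac h with rfl | rfl
      · exact hnac hcd.symm
      · exact hcd.1 rfl
    have hda : d ≠ a := by rintro rfl; exact hbd hba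
    have h1 := ch_add_ch_le hba hbc hcd hac hdb.symm hnac
    have h2 := ch_add_ch_le hcd hbc.symm hba.symm.symm hdb hac.symm fun h => hbd h.symm
    have n0 : ¬ C.inTri c := fun h => hn (h.of_core hbc.symm)
    have n1 : ¬ C.inTri a := fun h => hn (h.of_core hba.symm)
    have n2 : ¬ C.inTri d := fun h => n0 (h.of_core hcd.symm)
    have hb1 := hba.1
    have hb2 := hbc.1
    have hb3 := hcd.1
    refine ⟨{a, b, c, d}, ?_, ?_, ?_⟩
    · rw [Finset.card_insert_of_notMem (by simp; grind), Finset.card_insert_of_notMem (by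
        simp; grind), Finset.card_insert_of_notMem (by simp; grind), Finset.card_singleton]
    · rw [Finset.sum_insert (by simp; grind), Finset.sum_insert (by simp; grind),
        Finset.sum_insert (by simp; grind), Finset.sum_singleton]
      linarith
    · intro x hx
      simp only [Finset.mem_insert, Finset.mem_singleton] at hx
      rcases hx with rfl | rfl | rfl | rfl
      exacts [⟨hba.symm.isCore, n1⟩, ⟨hba.isCore, hn⟩, ⟨hcd.isCore, n0⟩, ⟨hcd.symm.isCore, n2⟩]
  by_cases h1 : ∀ t, C.core a t → t = b
  · by_cases h2 : ∀ t, C.core c t → t = b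
    · exact Or.inl ⟨h1, h2⟩
    · push Not at h2
      obtain ⟨d, hd, hdb⟩ := h2
      exact Or.inr (key a c d hba hbc hac hnac hd hdb)
  · push Not at h1
    obtain ⟨d, hd, hdb⟩ := h1
    exact Or.inr (key c a d hbc hba hac.symm (fun h => hnac h.symm) hd hdb)

/-- Off the core triangles, a core pair that is clean or not isolated leads to a saving. -/
lemma exists_slack (h : C.core y z) (hn : ¬ C.inTri y)
    (hni : ¬ ((∀ t, C.core y t → t = z) ∧ (∀ t, C.core z t → t = y) ∧ ¬ C.clean y z)) :
    ∃ S : Finset V, (∀ x ∈ S, C.isCore x ∧ ¬ C.inTri x) ∧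
      ((S.card = 2 ∧ ∑ x ∈ S, C.ch False x ≤ 0) ∨ (S.card = 3 ∧ ∑ x ∈ S, C.ch False x ≤ 7) ∨
        S.card = 4 ∧ ∑ x ∈ S, C.ch False x ≤ 8) := by
  have hnz : ¬ C.inTri z := fun h' => hn (h'.of_core h.symm)
  by_cases hcl : C.clean y z
  · refine ⟨{y, z}, ?_, Or.inl ⟨Finset.card_pair h.1, ?_⟩⟩
    · simp only [Finset.mem_insert, Finset.mem_singleton]
      rintro x (rfl | rfl)
      exacts [⟨h.isCore, hn⟩, ⟨h.symm.isCore, hnz⟩]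
    · rw [Finset.sum_pair h.1]
      have := ch_clean_le (l := False) h hcl
      have := ch_clean_le (l := False) h.symm hcl.symm
      linarith
  have key : ∀ y z, C.core y z → ¬ C.inTri y → (∃ t, C.core y t ∧ t ≠ z) →
      ∃ S : Finset V, (∀ x ∈ S, C.isCore x ∧ ¬ C.inTri x) ∧
      ((S.card = 2 ∧ ∑ x ∈ S, C.ch False x ≤ 0) ∨ (S.card = 3 ∧ ∑ x ∈ S, C.ch False x ≤ 7) ∨
        S.card = 4 ∧ ∑ x ∈ S, C.ch False x ≤ 8) := by
    rintro y z h hn ⟨t, ht, hne⟩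
    rcases path_or h ht hne.symm hn with ⟨hz, ht'⟩ | ⟨S, h1, h2, h3⟩
    · refine ⟨{z, y, t}, ?_, Or.inr (Or.inl ⟨Finset.card_eq_three.2
        ⟨z, y, t, h.1.symm, hne.symm, ht.1, rfl⟩, ?_⟩)⟩
      · simp only [Finset.mem_insert, Finset.mem_singleton]
        rintro x (rfl | rfl | rfl)
        exacts [⟨h.symm.isCore, fun h' => hn (h'.of_core h.symm)⟩, ⟨h.isCore, hn⟩,
          ⟨ht.symm.isCore, fun h' => hn (h'.of_core ht.symm)⟩]
      · rw [sum_three _ h.1.symm hne.symm ht.1]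
        exact ch_path_le h.symm hz ht ht' hne.symm
    · exact ⟨S, h3, Or.inr (Or.inr ⟨h1, h2⟩)⟩
  by_cases h1 : ∃ t, C.core y t ∧ t ≠ z
  · exact key y z h hn h1
  by_cases h2 : ∃ t, C.core z t ∧ t ≠ y
  · exact key z y h.symm hnz h2
  · push Not at h1 h2
    exact absurd ⟨h1, h2, hcl⟩ hni

/-- If there is a core triangle `a`, `b`, `c`, then its vertices get at most `4` together. If it is
the only one, the other elements get at most `4` when all other core pairs are isolated and not
clean, and at most `5` otherwise, when a second set of core vertices saves the rest. -/
lemma sum_ch_le_of_triangle (hU : ∀ T ∈ C.H, T ⊆ U) (hab : C.core a b) (hac : C.core a c)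
    (hbc : C.core b c) : ∑ x ∈ U, C.ch False x ≤ alphaBound U.card := by
  have h6 := six_mul_sub_le_alphaBound U.card
  have h5 := five_mul_sub_le_alphaBound U.card
  have h4 := four_mul_sub_le_alphaBound U.card
  by_cases htri : ∀ y z t, C.core y z → C.core y t → C.core z t → y ∈ ({a, b, c} : Finset V)
  swap
  · push Not at htri
    obtain ⟨x, y, z, hxy, hxz, hyz, hx⟩ := htri
    exact (sum_ch_le_of_two_triangles hU hab hac hbc hxy hxz hyz hx).trans h6
  have hin : ∀ x ∈ ({a, b, c} : Finset V), C.inTri x := by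
    intro x hx
    simp only [Finset.mem_insert, Finset.mem_singleton] at hx
    rcases hx with rfl | rfl | rfl
    exacts [⟨b, c, hab, hac, hbc⟩, ⟨a, c, hab.symm, hbc, hac⟩, ⟨a, b, hac.symm, hbc.symm, hab⟩]
  have hin' : ∀ x, C.inTri x → x ∈ ({a, b, c} : Finset V) := by
    rintro x ⟨p, q, hp, hq, hpq⟩
    exact htri x p q hp hq hpq
  have hsub : ({a, b, c} : Finset V) ⊆ U := by
    intro x hx
    obtain ⟨p, q, hp, -, -⟩ := hin x hx
    exact hp.isCore.mem hU
  have c1 : ({a, b, c} : Finset V).card = 3 :=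
    Finset.card_eq_three.2 ⟨a, b, c, hab.1, hac.1, hbc.1, rfl⟩
  have s1 : ∑ x ∈ ({a, b, c} : Finset V), C.ch False x ≤ 4 := by
    rw [sum_three _ hab.1 hac.1 hbc.1]
    have h1 := ch_triangle_le (l := False) hab hac hbc
    have h2 := ch_triangle_le (l := False) hab.symm hbc hac
    have h3 := ch_triangle_le (l := False) hac.symm hbc.symm hab
    linarith
  by_cases hiso : ∀ y z, C.core y z → y ∉ ({a, b, c} : Finset V) →
      (∀ t, C.core y t → t = z) ∧ (∀ t, C.core z t → t = y) ∧ ¬ C.clean y z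
  · have : ∀ x ∈ U, C.ch False x ≤ 4 := by
      intro x _
      by_cases hn : C.isCore x
      · exact ch_core_le_four hn
      · exact ch_le_four_of_isolated hn htri hiso
    refine (sum_le_sub_slack (m := 8) hsub this ?_).trans h4
    rw [c1]; norm_num; linarith
  · push Not at hiso
    obtain ⟨y, z, hyz, hy, hni⟩ := hiso
    obtain ⟨S, hS, hS'⟩ := exists_slack hyz (fun h => hy (hin' _ h)) (fun h => h.2.2 (hni h.1 h.2.1))
    have : ∀ x ∈ U, C.ch False x ≤ 5 := by
      intro x _
      by_cases hn : C.isCore x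
      · exact (ch_core_le_four hn).trans (by norm_num)
      · exact ch_le_five hn htri
    have hd : Disjoint ({a, b, c} : Finset V) S := by
      rw [Finset.disjoint_right]
      exact fun x hx h => (hS x hx).2 (hin x h)
    refine (sum_le_sub_slack (m := 18) (S := {a, b, c} ∪ S) ?_ this ?_).trans h5
    · exact Finset.union_subset hsub fun x hx => (hS x hx).1.mem hU
    · rw [Finset.sum_union hd, Finset.card_union_of_disjoint hd, c1]
      rcases hS' with ⟨e, h⟩ | ⟨e, h⟩ | ⟨e, h⟩ <;> rw [e] <;> norm_num <;> linarith

lemma sum_cls_le_two (hn : ¬ C.isCore x) (htri : ∀ x, ¬ C.inTri x) (s : Bool) :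
    ∑ T ∈ C.cls x s, C.part l x T ≤ 2 := by
  rcases sum_cls_le_two_or (l := l) hn s with h | ⟨-, y, z, t, -, -, -, -, -, -, h1, h2, h3, -⟩
  · exact h
  · exact absurd ⟨z, t, h1, h2, h3⟩ (htri y)

lemma ch_le_four (htri : ∀ x, ¬ C.inTri x) (x : V) : C.ch False x ≤ 4 := by
  by_cases hn : C.isCore x
  · exact ch_core_le_four hn
  · rw [ch_eq_sum_cls]
    linarith [sum_cls_le_two (l := False) hn htri true, sum_cls_le_two (l := False) hn htri false]

/-- Besides an isolated path `a`, `b`, `c` of the core graph, which saves `5` compared with charges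
of `4`, a further core vertex leads to a saving of `5 / 2`. -/
lemma exists_slack_of_path (htri : ∀ x, ¬ C.inTri x)
    (hcl : ∀ u v, C.core u v → ¬ C.clean u v) (h : C.core a b) (ha : ∀ t, C.core a t → t = b)
    (h' : C.core b c) (hc : ∀ t, C.core c t → t = b) (hac : a ≠ c) (hy : C.isCore y)
    (hyn : y ∉ ({a, b, c} : Finset V)) (hU : ∀ T ∈ C.H, T ⊆ U) :
    ∃ S ⊆ U, ∑ x ∈ S, C.ch False x ≤ 4 * S.card - 15 / 2 := by
  obtain ⟨z, hyz⟩ := hy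
  have hA : ∀ p ∈ ({a, b, c} : Finset V), ∀ q, C.core p q → q ∈ ({a, b, c} : Finset V) := by
    intro p hp q hq
    simp only [Finset.mem_insert, Finset.mem_singleton] at hp ⊢
    rcases hp with rfl | rfl | rfl
    · have := ha _ hq; tauto
    · have := h.symm.eq_or_eq h' hac hq; tauto
    · have := hc _ hq; tauto
  have hzn : z ∉ ({a, b, c} : Finset V) := fun h => hyn (hA _ h _ hyz.symm)
  have c1 : ({a, b, c} : Finset V).card = 3 :=
    Finset.card_eq_three.2 ⟨a, b, c, h.1, hac, h'.1, rfl⟩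
  have s1 : ∑ x ∈ ({a, b, c} : Finset V), C.ch False x ≤ 7 := by
    rw [sum_three _ h.1 hac h'.1]
    exact ch_path_le h ha h' hc hac
  have hsub : ({a, b, c} : Finset V) ⊆ U := by
    intro i hi
    simp only [Finset.mem_insert, Finset.mem_singleton] at hi
    rcases hi with rfl | rfl | rfl
    exacts [h.isCore.mem hU, h'.isCore.mem hU, h'.symm.isCore.mem hU]
  have key : ∀ S : Finset V, (∀ x ∈ S, x ∉ ({a, b, c} : Finset V) ∧ x ∈ U) →
      ∑ x ∈ S, C.ch False x ≤ 4 * S.card - 5 / 2 →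
      ∃ S ⊆ U, ∑ x ∈ S, C.ch False x ≤ 4 * S.card - 15 / 2 := by
    intro S hS hS'
    have hd : Disjoint ({a, b, c} : Finset V) S := by
      rw [Finset.disjoint_right]; exact fun x hx => (hS x hx).1
    refine ⟨{a, b, c} ∪ S, Finset.union_subset hsub fun x hx => (hS x hx).2, ?_⟩
    rw [Finset.sum_union hd, Finset.card_union_of_disjoint hd, c1]
    push_cast
    linarith
  have path : ∀ y z t, C.core y z → C.core y t → z ≠ t → y ∉ ({a, b, c} : Finset V) →
      ∃ S ⊆ U, ∑ x ∈ S, C.ch False x ≤ 4 * S.card - 15 / 2 := by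
    intro y z t hyz hyt hzt hyn
    rcases path_or hyz hyt hzt (htri y) with ⟨hz, ht⟩ | ⟨S, h1, h2, h3⟩
    · refine key {z, y, t} ?_ ?_
      · intro x hx
        simp only [Finset.mem_insert, Finset.mem_singleton] at hx
        rcases hx with rfl | rfl | rfl
        exacts [⟨fun h => hyn (hA _ h _ hyz.symm), hyz.symm.isCore.mem hU⟩,
          ⟨hyn, hyz.isCore.mem hU⟩, ⟨fun h => hyn (hA _ h _ hyt.symm), hyt.symm.isCore.mem hU⟩]
      · rw [sum_three _ hyz.1.symm hzt hyt.1,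
          Finset.card_eq_three.2 ⟨z, y, t, hyz.1.symm, hzt, hyt.1, rfl⟩]
        have := ch_path_le hyz.symm hz hyt ht hzt
        norm_num
        linarith
    · refine ⟨S, fun x hx => (h3 x hx).1.mem hU, ?_⟩
      rw [h1]; norm_num; linarith
  by_cases hy' : ∀ t, C.core y t → t = z
  swap
  · push Not at hy'
    obtain ⟨t, ht, hne⟩ := hy'
    exact path y z t hyz ht hne.symm hyn
  by_cases hz' : ∀ t, C.core z t → t = y
  swap
  · push Not at hz'
    obtain ⟨t, ht, hne⟩ := hz'
    exact path z y t hyz.symm ht hne.symm hzn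
  -- the core pair `y`, `z` is isolated; a third element of a triple on it saves `1 / 2`
  obtain ⟨x, hxy, hxz, hxa, hxb, hxc, hx⟩ := hyz.exists_avoid a b c
  have hchx : C.ch False x ≤ 7 / 2 := by
    rcases core_cases (C := C) x with hn | ⟨v, hv, hv'⟩ | ⟨v, v', hv, hv', hne⟩
    · have e : ({y, z, x} : Finset V) = {x, y, z} := by ext; simp; tauto
      rw [e] at hx
      obtain ⟨s, hs⟩ := C.exists_side _ hx x (by simp)
      have h1 := sum_cls_le_of_isolated (l := False) hn (mem_cls.2 ⟨hx, by simp, hs⟩) hxy hxz hyz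
        (hcl _ _ hyz) hy' hz'
      have h2 := sum_cls_le_two (l := False) hn htri (!s)
      rw [ch_eq_sum_cls' s]
      linarith
    · exact (ch_end_le hv hv').trans (by norm_num)
    · exfalso
      have h1 := hv.mem_or_mem hv' hne hx (by simp)
      simp only [Finset.mem_insert, Finset.mem_singleton] at h1
      rcases h1 with (rfl | rfl | rfl) | (rfl | rfl | rfl)
      · exact hxz (hy' _ hv.symm)
      · exact hxy (hz' _ hv.symm)
      · exact hv.1 rfl
      · exact hxz (hy' _ hv'.symm)
      · exact hxy (hz' _ hv'.symm)
      · exact hv'.1 rfl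
  refine key {x, y, z} ?_ ?_
  · intro i hi
    simp only [Finset.mem_insert, Finset.mem_singleton] at hi
    rcases hi with rfl | rfl | rfl
    · exact ⟨by simp [hxa, hxb, hxc], hU _ hx (by simp)⟩
    · exact ⟨hyn, hU _ hx (by simp)⟩
    · exact ⟨hzn, hU _ hx (by simp)⟩
  · rw [sum_three _ hxy hxz hyz.1, Finset.card_eq_three.2 ⟨x, y, z, hxy, hxz, hyz.1, rfl⟩]
    have := ch_end_le hyz hy'
    have := ch_end_le hyz.symm hz'
    norm_num
    linarith

end

end SignedTriples

/-! ### The core graph is a path or a matching -/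

namespace SignedTriples

noncomputable section

open Classical

variable {V : Type*} {C : SignedTriples V} {T T' T₁ T₂ : Finset V} {a b c d t u v x y z : V}
  {l : Prop} {s : Bool} {U : Finset V}

/-- If the core graph is a path `a`, `b`, `c`, then the path itself need not save `8`. The third
elements of the triples of weight `1` on `a`, `b` supply the rest. -/
lemma exists_slack_of_sole_path (hU : ∀ T ∈ C.H, T ⊆ U) (h : C.core a b)
    (ha : ∀ t, C.core a t → t = b) (h' : C.core b c) (hc : ∀ t, C.core c t → t = b) (hac : a ≠ c)
    (hall : ∀ t, C.isCore t → t = a ∨ t = b ∨ t = c) (hex : (C.ex a b).Nonempty)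
    (hch : (∃ T ∈ C.ex a b, c ∉ T) ∨ ∀ T ∈ C.ex c b, a ∈ T) :
    ∃ S ⊆ U, ∑ x ∈ S, C.ch False x ≤ 4 * S.card - 8 := by
  have hab := h.1
  have hbc := h'.1
  have hnac : ¬ C.core a c := fun h1 => hbc (ha _ h1).symm
  set N := U.filter (fun x => x ∉ ({a, b, c} : Finset V) ∧ {a, b, x} ∈ C.H ∧ C.w {a, b, x} = 1)
    with hN
  set M := C.H.filter (fun T => (a ∈ T ∧ b ∈ T) ∧ c ∉ T ∧ C.w T = 1) with hM
  set A := C.H.filter (fun T => (a ∈ T ∧ b ∈ T) ∧ c ∉ T ∧ C.w T ≠ 1) with hA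
  have hMN : M.card ≤ N.card := by
    refine card_le_of_third_mem (C := C) hab (fun T hT => ?_) N fun x hxa hxb hx => ?_
    · rw [hM, Finset.mem_filter] at hT; exact ⟨hT.1, hT.2.1⟩
    · rw [hM, Finset.mem_filter] at hx
      have hxc : x ≠ c := by rintro rfl; exact hx.2.2.1 (by simp)
      rw [hN, Finset.mem_filter]
      exact ⟨hU _ hx.1 (by simp), by simp [hxa, hxb, hxc], hx.1, hx.2.2.2⟩
  have hAsub : ∀ T ∈ A, T ∈ C.H ∧ a ∈ T ∧ b ∈ T := fun T hT => by
    rw [hA, Finset.mem_filter] at hT; exact ⟨hT.1, hT.2.1⟩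
  have hAmem : ∀ x, {a, b, x} ∈ A → ∀ T ∈ C.ex a b, x ∈ T := by
    intro x hx T hT
    by_contra hxT
    rw [hA, Finset.mem_filter] at hx
    have m := mem_ex.1 hT
    exact hx.2.2.2 (w_eq_one (by simp) (by simp) hab
      (mono_of_conflict hx.1 m.1 (by simp) m.2.1 (by grind))
      (h'.mono hx.1 (by simp) hx.2.2.1))
  have hcount : 4 ≤ M.card + A.card + if {a, b, c} ∈ C.H then 1 else 0 := by
    refine h.2.trans (le_trans (Finset.card_le_card (t := M ∪ A ∪
      if {a, b, c} ∈ C.H then {{a, b, c}} else ∅) ?_) ((Finset.card_union_le _ _).trans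
        (add_le_add (Finset.card_union_le _ _) ?_)))
    · intro T hT
      rw [Finset.mem_filter] at hT
      by_cases hcT : c ∈ T
      · have e := eq_triple hT.1 hT.2.1 hT.2.2 hcT hab hac hbc
        subst e
        simp [hT.1]
      · by_cases hw : C.w T = 1 <;> simp [hM, hA, hT, hcT, hw]
    · split_ifs <;> simp
  have hcard := card_ex_add_le hAsub hAmem h ha hex
  have hcard' : (∀ T ∈ C.ex a b, c ∈ T) → (C.ex a b).card + 2 * A.card ≤ 3 := by
    intro he
    by_cases h1 : (C.ex a b).card ≤ 1
    · obtain ⟨T, hT⟩ := hex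
      have m := mem_ex.1 hT
      have : A.card ≤ ((T.erase a).erase c).card := by
        refine card_le_of_third_mem hab hAsub _ fun x hxa hxb hx => ?_
        refine Finset.mem_erase.2 ⟨?_, Finset.mem_erase.2 ⟨hxa, hAmem x hx T hT⟩⟩
        rintro rfl
        rw [hA, Finset.mem_filter] at hx
        exact hx.2.2.1 (by simp)
      rw [Finset.card_erase_of_mem (Finset.mem_erase.2 ⟨hac.symm, he T hT⟩),
        Finset.card_erase_of_mem m.2.1, C.card_eq _ m.1] at this
      omega
    · obtain ⟨T₁, h₁, T₂, h₂, hne⟩ := Finset.one_lt_card.1 (not_le.1 h1)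
      have h3 := card_ex_le h ha
      have : A = ∅ := by
        refine Finset.eq_empty_of_forall_notMem fun T hT => ?_
        have m := hAsub T hT
        obtain ⟨x, hxa, hxb, rfl⟩ := exists_eq_pair m.1 m.2.1 m.2.2 hab
        have hxc : c ≠ x := by
          rintro rfl
          rw [hA, Finset.mem_filter] at hT
          exact hT.2.2.1 (by simp)
        exact hne (eq_of_mem (mem_ex.1 h₁).1 (mem_ex.1 h₂).1 (mem_ex.1 h₁).2.1 (he _ h₁)
          (hAmem x hT _ h₁) (mem_ex.1 h₂).2.1 (he _ h₂) (hAmem x hT _ h₂) hac hxa.symm hxc)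
      rw [this, Finset.card_empty]
      omega
  have hcha : C.ch False a ≤ (C.ex a b).card := by
    rw [ch_end_eq h ha h' hac.symm]
    refine (Finset.sum_le_card_nsmul _ _ 1 fun T hT => ?_).trans (by simp)
    have m := mem_ex.1 hT
    obtain ⟨y, z, hay, haz, hyz, rfl⟩ := exists_eq m.1 m.2.1
    refine share_ex_le_one h ha hT hay haz hyz fun hyz' => ?_
    exfalso
    have hy := hall _ hyz'.isCore
    have hz := hall _ hyz'.symm.isCore
    grind
  have hchc := ch_end_le h'.symm hc
  have hchb := ch_deg_two_le (l := False) h.symm h' hac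
  have hd : Disjoint ({a, b, c} : Finset V) N := by
    rw [Finset.disjoint_right]
    intro x hx
    rw [hN, Finset.mem_filter] at hx
    exact hx.2.1
  have hNch : ∑ x ∈ N, C.ch False x ≤ N.card * 3 := by
    rw [← nsmul_eq_mul]
    refine Finset.sum_le_card_nsmul _ _ _ fun x hx => ?_
    rw [hN, Finset.mem_filter] at hx
    have e : ({a, b, x} : Finset V) = {x, a, b} := by ext; simp; tauto
    rw [e] at hx
    refine ch_path_leaf_le h h' hnac hac hall (fun hxc => hx.2.1 ?_) hx.2.2.1 hx.2.2.2
    have := hall _ hxc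
    simpa using this
  have c1 : ({a, b, c} : Finset V).card = 3 := Finset.card_eq_three.2 ⟨a, b, c, hab, hac, hbc, rfl⟩
  have main : C.ch False a + C.ch False b + C.ch False c ≤ 4 + N.card := by
    have e : ({a, b, c} : Finset V) = {c, b, a} := by ext; simp; tauto
    have q1 : (M.card : ℚ) ≤ N.card := by exact_mod_cast hMN
    have q2 : ((C.ex a b).card : ℚ) + A.card ≤ 3 := by exact_mod_cast hcard
    split_ifs at hchb hcount with hH
    · have q3 : (4 : ℚ) ≤ M.card + A.card + 1 := by exact_mod_cast hcount
      by_cases he : ∃ T ∈ C.ex a b, c ∉ T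
      · obtain ⟨T, hT, hcT⟩ := he
        have hm := mono_mid hH hT hcT
        by_cases he' : ∀ T ∈ C.ex c b, a ∈ T
        · have h1 := ch_path_end_le (l := False) h'.symm hc h.symm ha hac.symm he'
          have h2 : ((C.ex c b).card : ℚ) ≤ 3 := by exact_mod_cast card_ex_le h'.symm hc
          have h3 := w_le_two' (by simp) hm
          linarith
        · push Not at he'
          obtain ⟨T', hT', haT'⟩ := he'
          have hm' : C.mono c {a, b, c} := e ▸ mono_mid (e ▸ hH) hT' haT'
          have h3 := w_eq_one' (by simp) (by simp) hac hm hm'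
          linarith
      · have he' := hch.resolve_left he
        push Not at he
        have h0 := ch_path_end_le (l := False) h ha h' hc hac he
        have h1 := ch_path_end_le (l := False) h'.symm hc h.symm ha hac.symm he'
        have h2 : ((C.ex c b).card : ℚ) ≤ 3 := by exact_mod_cast card_ex_le h'.symm hc
        have h3 := w_le_four' (C := C) (T := {a, b, c})
        have h4 : ((C.ex a b).card : ℚ) + 2 * A.card ≤ 3 := by exact_mod_cast hcard' he
        linarith
    · have q3 : (4 : ℚ) ≤ M.card + A.card + 0 := by exact_mod_cast hcount
      linarith
  refine ⟨{a, b, c} ∪ N, Finset.union_subset ?_ (Finset.filter_subset _ _), ?_⟩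
  · intro i hi
    simp only [Finset.mem_insert, Finset.mem_singleton] at hi
    rcases hi with rfl | rfl | rfl
    exacts [h.isCore.mem hU, h'.isCore.mem hU, h'.symm.isCore.mem hU]
  · rw [Finset.sum_union hd, Finset.card_union_of_disjoint hd, c1, sum_three _ hab hac hbc]
    push_cast
    linarith

/-- If there is no core triangle, but a core vertex has two core neighbours, then the total falls
short of `4 |U|` by `15 / 2`. As the total is an integer, this is as good as `8`. -/
lemma sum_ch_le_of_deg_two (hU : ∀ T ∈ C.H, T ⊆ U) (htri : ∀ x, ¬ C.inTri x)
    (hcl : ∀ u v, C.core u v → ¬ C.clean u v) (hba : C.core b a) (hbc : C.core b c) (hac : a ≠ c) :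
    ∑ x ∈ U, C.ch False x ≤ 4 * U.card - 15 / 2 := by
  have h4 : ∀ x ∈ U, C.ch False x ≤ 4 := fun x _ => ch_le_four htri x
  suffices ∃ S ⊆ U, ∑ x ∈ S, C.ch False x ≤ 4 * S.card - 15 / 2 by
    obtain ⟨S, hS, hS'⟩ := this
    exact sum_le_sub_slack hS h4 hS'
  rcases path_or hba hbc hac (htri b) with ⟨ha, hc⟩ | ⟨S, h1, h2, h3⟩
  swap
  · refine ⟨S, fun x hx => (h3 x hx).1.mem hU, ?_⟩
    rw [h1]; norm_num; linarith
  by_cases hall : ∀ t, C.isCore t → t = a ∨ t = b ∨ t = c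
  swap
  · push Not at hall
    obtain ⟨y, hy, hya, hyb, hyc⟩ := hall
    exact exists_slack_of_path htri hcl hba.symm ha hbc hc hac hy (by simp [hya, hyb, hyc]) hU
  have hall' : ∀ t, C.isCore t → t = c ∨ t = b ∨ t = a := fun t ht => by
    have := hall t ht; tauto
  suffices ∃ S ⊆ U, ∑ x ∈ S, C.ch False x ≤ 4 * S.card - 8 by
    obtain ⟨S, hS, hS'⟩ := this
    exact ⟨S, hS, by linarith⟩
  by_cases h1 : ∃ T ∈ C.ex a b, c ∉ T
  · exact exists_slack_of_sole_path hU hba.symm ha hbc hc hac hall ⟨_, h1.choose_spec.1⟩ (Or.inl h1)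
  by_cases h2 : ∃ T ∈ C.ex c b, a ∉ T
  · exact exists_slack_of_sole_path hU hbc.symm hc hba ha hac.symm hall' ⟨_, h2.choose_spec.1⟩
      (Or.inl h2)
  push Not at h1 h2
  by_cases h3 : (C.ex a b).Nonempty
  · exact exists_slack_of_sole_path hU hba.symm ha hbc hc hac hall h3 (Or.inr h2)
  by_cases h5 : (C.ex c b).Nonempty
  · exact exists_slack_of_sole_path hU hbc.symm hc hba ha hac.symm hall' h5 (Or.inr h1)
  rw [Finset.not_nonempty_iff_eq_empty] at h3 h5
  refine ⟨{a, b, c}, ?_, ?_⟩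
  · intro i hi
    simp only [Finset.mem_insert, Finset.mem_singleton] at hi
    rcases hi with rfl | rfl | rfl
    exacts [hba.symm.isCore.mem hU, hbc.isCore.mem hU, hbc.symm.isCore.mem hU]
  · rw [sum_three _ hba.1.symm hac hbc.1, ch_end_eq hba.symm ha hbc hac.symm,
      ch_end_eq hbc.symm hc hba hac, h3, h5,
      Finset.card_eq_three.2 ⟨a, b, c, hba.1.symm, hac, hbc.1, rfl⟩]
    have := ch_deg_two_le_four (l := False) hba hbc hac
    norm_num
    linarith

/-- The only core pair is `u`, `v`: third elements of triples on it. -/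
lemma ch_leaf_le (hn : ¬ C.isCore x) (h : C.core u v) (hc : ¬ C.clean u v)
    (hall : ∀ t, C.isCore t → t = u ∨ t = v) (hT : {x, u, v} ∈ C.H) : C.ch True x ≤ 2 := by
  have hxu : x ≠ u := by rintro rfl; exact hn h.isCore
  have hxv : x ≠ v := by rintro rfl; exact hn h.symm.isCore
  have hp0 : C.paired {x, u, v} := ⟨u, by simp, v, by simp, h⟩
  have hpair : ∀ T ∈ C.H, x ∈ T → C.paired T → T = {x, u, v} := by
    intro T hT hx hp
    obtain ⟨y, z, hxy, hxz, hyz, rfl, hyz'⟩ := hp.exists_eq hT hx hn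
    rcases hall _ hyz'.isCore with rfl | rfl <;> rcases hall _ hyz'.symm.isCore with rfl | rfl
    · exact absurd rfl hyz
    · rfl
    · exact congrArg (insert x) (Finset.pair_comm _ _)
    · exact absurd rfl hyz
  have hmix : ∀ T ∈ C.H, x ∈ T → ¬ C.paired T → ¬ C.far T → C.part True x T ≤ 0 := by
    intro T hT hx hp hf
    refine (part_mixed_le hT hx hn hp hf).trans ?_
    rw [if_pos (Or.inl trivial)]
  have key : ∀ s, {x, u, v} ∈ C.cls x s → ∑ T ∈ C.cls x s, C.part True x T ≤ 1 := by
    intro s hs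
    refine (sum_le_add_two_mul (card_cls_le hn s) le_rfl hs
      (part_le_one_of_core hxu hxv hn h hc) fun T hT hne => ?_).trans (by norm_num)
    have m := mem_cls.1 hT
    exact hmix T m.1 m.2.1 (fun hp => hne (hpair T m.1 m.2.1 hp)) (not_far_of_paired hn hs hp0 hT)
  have key' : ∀ s, {x, u, v} ∈ C.cls x s → {x, u, v} ∉ C.cls x (!s) →
      ∑ T ∈ C.cls x (!s), C.part True x T ≤ 1 := by
    intro s hs hs'
    refine (sum_le_three_mul (card_cls_le hn (!s)) (q := 1 / 3) (by norm_num)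
      fun T hT => ?_).trans (by norm_num)
    have m := mem_cls.1 hT
    have hp : ¬ C.paired T := fun hp => by
      rw [hpair T m.1 m.2.1 hp] at hT
      exact hs' hT
    by_cases hf : C.far T
    · refine part_far_le_of_mono m.1 m.2.1 hf ?_
      by_contra hm
      exact not_far_of_paired hn hs hp0 (mem_cls.2 ⟨m.1, m.2.1, side_of_not_mono hm _⟩) hf
    · exact (hmix T m.1 m.2.1 hp hf).trans (by norm_num)
  obtain ⟨s, hs⟩ := C.exists_side _ hT x (by simp)
  have hs : {x, u, v} ∈ C.cls x s := mem_cls.2 ⟨hT, by simp, hs⟩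
  rw [ch_eq_sum_cls' s]
  have h1 := key s hs
  have h2 : ∑ T ∈ C.cls x (!s), C.part True x T ≤ 1 := by
    by_cases hs' : {x, u, v} ∈ C.cls x (!s)
    · exact key _ hs'
    · exact key' s hs hs'
  linarith

/-- The only core pair is `u`, `v`: vertices off the triples on it. -/
lemma ch_nonleaf_le (hn : ¬ C.isCore x) (hall : ∀ T ∈ C.H, x ∈ T → ¬ C.paired T)
    (h4 : ∀ T ∈ C.H, x ∈ T → C.far T → C.w T = 4 → ∀ T' ∈ C.H, x ∈ T' → T' ≠ T → ¬ C.far T') :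
    C.ch True x ≤ 5 / 2 := by
  have hmix : ∀ T ∈ C.H, x ∈ T → ¬ C.far T → C.part True x T ≤ 0 := by
    intro T hT hx hf
    refine (part_mixed_le hT hx hn (hall T hT hx) hf).trans ?_
    rw [if_pos (Or.inl trivial)]
  have key : ∀ s, ∑ T ∈ C.cls x s, C.part True x T ≤ 5 / 4 := by
    intro s
    have h3 := card_cls_le hn s
    by_cases hw : ∃ T ∈ C.cls x s, C.far T ∧ C.w T = 4
    · obtain ⟨T, hT, hf, hw⟩ := hw
      have m := mem_cls.1 hT
      refine (sum_le_add_two_mul h3 le_rfl hT (part_far_le m.1 m.2.1 hf)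
        fun T' hT' hne => ?_).trans (by norm_num)
      have m' := mem_cls.1 hT'
      exact hmix T' m'.1 m'.2.1 (h4 T m.1 m.2.1 hf hw T' m'.1 m'.2.1 hne)
    · push Not at hw
      refine (sum_le_three_mul h3 (q := 5 / 12) (by norm_num) fun T hT => ?_).trans (by norm_num)
      have m := mem_cls.1 hT
      by_cases hf : C.far T
      · exact part_far_le_of_ne m.1 m.2.1 hf (hw T hT hf)
      · exact (hmix T m.1 m.2.1 hf).trans (by norm_num)
  rw [ch_eq_sum_cls]
  linarith [key true, key false]

/-- The charge of an end that receives the whole weight of the triples avoiding its neighbour. -/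
lemma ch_end_le_sum_w (h : C.core u v) (hu : ∀ t, C.core u t → t = v) :
    C.ch l u ≤ ∑ T ∈ C.ex u v, (C.w T : ℚ) + (C.irrs u v).card := by
  rw [ch_eq_ex_add u v]
  exact add_le_add (Finset.sum_le_sum fun T hT => share_ex_le_w h hu hT) (sum_share_end_le h hu)

lemma ch_end_le_six (h : C.core u v) (hu : ∀ t, C.core u t → t = v) : C.ch l u ≤ 6 := by
  refine (ch_end_le_sum_w h hu).trans ?_
  have h1 : ∑ T ∈ C.ex u v, (C.w T : ℚ) ≤ (C.ex u v).card * 2 := by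
    rw [← nsmul_eq_mul]
    exact Finset.sum_le_card_nsmul _ _ _ fun T hT => w_le_two' (mem_ex.1 hT).2.1 (mono_ex h hT)
  have h2 : ((C.ex u v).card : ℚ) + (C.irrs u v).card ≤ 3 := by
    exact_mod_cast card_ex_add_card_irrs_le h hu
  have h3 : (0 : ℚ) ≤ (C.irrs u v).card := by positivity
  linarith

lemma ch_end_le_four_or (h : C.core u v) (hu : ∀ t, C.core u t → t = v) : C.ch l u ≤ 4 ∨
    ∃ T₁ ∈ C.ex u v, ∃ T₂ ∈ C.ex u v, T₁ ≠ T₂ ∧ C.w T₁ = 2 ∧ C.w T₂ = 2 ∧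
      ∃ y, y ≠ u ∧ y ∈ T₁ ∧ y ∈ T₂ := by
  have h2 : ((C.ex u v).card : ℚ) + (C.irrs u v).card ≤ 3 := by
    exact_mod_cast card_ex_add_card_irrs_le h hu
  have hle := ch_end_le_sum_w (l := l) h hu
  have hw : ∀ T ∈ C.ex u v, C.w T ≠ 2 → (C.w T : ℚ) ≤ 1 := by
    intro T hT hne
    have := w_le_two (mem_ex.1 hT).2.1 (mono_ex h hT)
    exact_mod_cast (by omega : C.w T ≤ 1)
  by_cases h1 : ∃ T₁ ∈ C.ex u v, C.w T₁ = 2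
  swap
  · push Not at h1
    left
    have : ∑ T ∈ C.ex u v, (C.w T : ℚ) ≤ (C.ex u v).card * 1 := by
      rw [← nsmul_eq_mul]
      exact Finset.sum_le_card_nsmul _ _ _ fun T hT => hw T hT (h1 T hT)
    linarith
  obtain ⟨T₁, h₁, w₁⟩ := h1
  by_cases h1 : ∃ T₂ ∈ C.ex u v, T₁ ≠ T₂ ∧ C.w T₂ = 2
  swap
  · push Not at h1
    left
    rw [← Finset.add_sum_erase _ _ h₁, w₁] at hle
    have : ∑ T ∈ (C.ex u v).erase T₁, (C.w T : ℚ) ≤ ((C.ex u v).erase T₁).card * 1 := by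
      rw [← nsmul_eq_mul]
      refine Finset.sum_le_card_nsmul _ _ _ fun T hT => ?_
      rw [Finset.mem_erase] at hT
      exact hw T hT.2 (h1 T hT.2 hT.1.symm)
    rw [Finset.card_erase_of_mem h₁, Nat.cast_sub (Finset.card_pos.2 ⟨_, h₁⟩)] at this
    push_cast at this hle
    linarith
  obtain ⟨T₂, h₂, hne, w₂⟩ := h1
  by_cases hy : ∃ y, y ≠ u ∧ y ∈ T₁ ∧ y ∈ T₂
  · exact Or.inr ⟨T₁, h₁, T₂, h₂, hne, w₁, w₂, hy⟩
  left
  push Not at hy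
  obtain ⟨hsub, -, hirr⟩ := ex_eq_pair h h₁ h₂ fun y hy1 hy2 => by
    by_contra hyu
    exact hy y hyu hy1 hy2
  have e : C.ex u v = {T₁, T₂} := Finset.Subset.antisymm hsub (by
    intro T hT; simp only [Finset.mem_insert, Finset.mem_singleton] at hT
    rcases hT with rfl | rfl <;> assumption)
  rw [hirr, e, Finset.sum_pair hne, w₁, w₂] at hle
  norm_num at hle
  exact hle

/-- Two intersecting triples of weight `2` at one end leave little room for triples at the other
end, if there are at most seven elements. -/
lemma ch_end_le_two (hU : ∀ T ∈ C.H, T ⊆ U) (hcard : U.card ≤ 7) (h : C.core u v)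
    (hv : ∀ t, C.core v t → t = u) (h₁ : T₁ ∈ C.ex u v) (h₂ : T₂ ∈ C.ex u v) (hne : T₁ ≠ T₂)
    (w₁ : C.w T₁ = 2) (w₂ : C.w T₂ = 2) (hyu : y ≠ u) (hy₁ : y ∈ T₁) (hy₂ : y ∈ T₂) :
    C.ch l v ≤ 2 := by
  have m₁ := mem_ex.1 h₁
  have m₂ := mem_ex.1 h₂
  obtain ⟨z, hzu, hzy, rfl⟩ := exists_eq_pair m₁.1 m₁.2.1 hy₁ hyu.symm
  obtain ⟨t, htu, hty, rfl⟩ := exists_eq_pair m₂.1 m₂.2.1 hy₂ hyu.symm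
  have hzt : z ≠ t := by rintro rfl; exact hne rfl
  have huv := h.1
  have nm₁ : ∀ q ∈ ({u, y, z} : Finset V), u ≠ q → ¬ C.mono q {u, y, z} := fun q hq huq =>
    not_mono_of_w_eq_two w₁ (by simp) (mono_ex h h₁) hq huq
  have nm₂ : ∀ q ∈ ({u, y, t} : Finset V), u ≠ q → ¬ C.mono q {u, y, t} := fun q hq huq =>
    not_mono_of_w_eq_two w₂ (by simp) (mono_ex h h₂) hq huq
  have havoid : ∀ T ∈ C.ex v u, y ∉ T ∧ z ∉ T ∧ t ∉ T := by
    intro T hT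
    have m := mem_ex.1 hT
    have hyT : y ∉ T := by
      intro hy
      have hz : z ∈ T := by
        by_contra hz
        exact nm₁ y (by simp) hyu.symm (mono_of_conflict m₁.1 m.1 (by simp) hy (by grind))
      have ht : t ∈ T := by
        by_contra ht
        exact nm₂ y (by simp) hyu.symm (mono_of_conflict m₂.1 m.1 (by simp) hy (by grind))
      have e := eq_triple m.1 hy hz ht hzy.symm hty.symm hzt
      have hvT := m.2.1
      rw [e] at hvT
      have := m₁.2.2
      have := m₂.2.2
      grind
    refine ⟨hyT, fun hz => ?_, fun ht => ?_⟩
    · exact nm₁ z (by simp) hzu.symm (mono_of_conflict m₁.1 m.1 (by simp) hz (by grind))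
    · exact nm₂ t (by simp) htu.symm (mono_of_conflict m₂.1 m.1 (by simp) ht (by grind))
  have hle := ch_end_le_sum_w (l := l) h.symm hv
  by_cases hex : (C.ex v u).Nonempty
  · obtain ⟨T, hT⟩ := hex
    have m := mem_ex.1 hT
    have hTirr : C.irrs v u = ∅ := by
      refine Finset.eq_empty_of_forall_notMem fun T' hT' => ?_
      have m' := mem_irrs.1 hT'
      obtain ⟨x, hxv, hxu, rfl⟩ := exists_eq_pair m'.1 m'.2.1.1 m'.2.1.2 huv.symm
      have hT'' : {u, v, x} ∈ C.irrs u v := by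
        have e : ({u, v, x} : Finset V) = {v, u, x} := by ext; simp; tauto
        rw [irrs_comm, e]; exact hT'
      have a1 := mem_of_irrs hT'' h₁
      have a2 := mem_of_irrs hT'' h₂
      have a3 := mem_of_irrs hT' hT
      have := havoid T hT
      grind
    have hone : C.ex v u = {T} := by
      refine Finset.eq_singleton_iff_unique_mem.2 ⟨hT, fun T' hT' => ?_⟩
      have m' := mem_ex.1 hT'
      -- both triples lie in the set of the remaining three elements
      have hsub : ∀ T ∈ C.ex v u, T ⊆ U \ {u, y, z, t} := by
        intro T hT i hi
        have := havoid T hT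
        have hu := (mem_ex.1 hT).2.2
        refine Finset.mem_sdiff.2 ⟨hU _ (mem_ex.1 hT).1 hi, ?_⟩
        simp only [Finset.mem_insert, Finset.mem_singleton]
        rintro (rfl | rfl | rfl | rfl) <;> tauto
      have hc4 : (U \ {u, y, z, t}).card ≤ 3 := by
        rw [Finset.card_sdiff_of_subset]
        · rw [Finset.card_insert_of_notMem (by simp; grind), Finset.card_insert_of_notMem (by
            simp; grind), Finset.card_insert_of_notMem (by simp; grind), Finset.card_singleton]
          omega
        · intro i hi
          simp only [Finset.mem_insert, Finset.mem_singleton] at hi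
          rcases hi with rfl | rfl | rfl | rfl
          exacts [hU _ m₁.1 (by simp), hU _ m₁.1 (by simp), hU _ m₁.1 (by simp),
            hU _ m₂.1 (by simp)]
      rw [Finset.eq_of_subset_of_card_le (hsub T' hT') (by rw [C.card_eq _ m'.1]; exact hc4),
        Finset.eq_of_subset_of_card_le (hsub T hT) (by rw [C.card_eq _ m.1]; exact hc4)]
    rw [hTirr, hone, Finset.sum_singleton] at hle
    have := w_le_two' m.2.1 (mono_ex h.symm hT)
    simp at hle
    linarith
  · rw [Finset.not_nonempty_iff_eq_empty.1 hex, Finset.sum_empty, zero_add] at hle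
    have : ((C.irrs v u).card : ℚ) ≤ 2 := by exact_mod_cast card_irrs_le_two huv.symm
    linarith

lemma ch_add_ch_le_eight (hU : ∀ T ∈ C.H, T ⊆ U) (hcard : U.card ≤ 7) (h : C.core u v)
    (hu : ∀ t, C.core u t → t = v) (hv : ∀ t, C.core v t → t = u) :
    C.ch l u + C.ch l v ≤ 8 := by
  rcases ch_end_le_four_or (l := l) h hu with h1 | ⟨T₁, h₁, T₂, h₂, hne, w₁, w₂, y, hyu, hy₁, hy₂⟩
  · rcases ch_end_le_four_or (l := l) h.symm hv with
      h2 | ⟨T₁, h₁, T₂, h₂, hne, w₁, w₂, y, hyu, hy₁, hy₂⟩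
    · linarith
    · have := ch_end_le_two (l := l) hU hcard h.symm hu h₁ h₂ hne w₁ w₂ hyu hy₁ hy₂
      have := ch_end_le_six (l := l) h.symm hv
      linarith
  · have := ch_end_le_two (l := l) hU hcard h hv h₁ h₂ hne w₁ w₂ hyu hy₁ hy₂
    have := ch_end_le_six (l := l) h hu
    linarith

end

end SignedTriples

/-! ### The bound on the total weight -/

lemma alphaBound_add_four (n : ℕ) : alphaBound n + 16 ≤ alphaBound (n + 4) := by
  have hc : cConst (n + 4) = cConst n := by unfold cConst; simp
  have h1 : 4 * ((n + 4 : ℕ) : ℚ) - 4 * cConst (n + 4) ≤ alphaBound (n + 4) := le_max_right _ _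
  have h2 := six_mul_sub_le_alphaBound (n + 4)
  rw [hc] at h1
  push_cast at h1 h2
  rw [← le_sub_iff_add_le]
  exact max_le (by linarith) (by linarith)

namespace SignedTriples

noncomputable section

open Classical

variable {V : Type*} {C : SignedTriples V} {T T' T₁ T₂ : Finset V} {a b c d t u v x y z : V}
  {l : Prop} {s : Bool} {U : Finset V}

lemma card_nonleaf_add_six_le (hU : ∀ T ∈ C.H, T ⊆ U) (h : C.core u v) :
    (U.filter fun x => x ≠ u ∧ x ≠ v ∧ {u, v, x} ∉ C.H).card + 6 ≤ U.card := by
  have h1 : 4 ≤ (U.filter fun x => x ≠ u ∧ x ≠ v ∧ {u, v, x} ∈ C.H).card := by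
    refine h.2.trans (card_le_of_third_mem (C := C) h.1 (fun T hT => by simpa using hT) _
      fun x hxu hxv hx => ?_)
    rw [Finset.mem_filter] at hx ⊢
    exact ⟨hU _ hx.1 (by simp), hxu, hxv, hx.1⟩
  have h2 : ({u, v} : Finset V).card = 2 := Finset.card_pair h.1
  have hd1 : Disjoint ({u, v} : Finset V) (U.filter fun x => x ≠ u ∧ x ≠ v ∧ {u, v, x} ∈ C.H) := by
    rw [Finset.disjoint_left]; intro x; simp; grind
  have hd2 : Disjoint (({u, v} : Finset V) ∪ U.filter fun x => x ≠ u ∧ x ≠ v ∧ {u, v, x} ∈ C.H)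
      (U.filter fun x => x ≠ u ∧ x ≠ v ∧ {u, v, x} ∉ C.H) := by
    rw [Finset.disjoint_left]; intro x; simp; grind
  have h3 := Finset.card_le_card (s := ({u, v} ∪ U.filter fun x => x ≠ u ∧ x ≠ v ∧ {u, v, x} ∈ C.H) ∪
      (U.filter fun x => x ≠ u ∧ x ≠ v ∧ {u, v, x} ∉ C.H)) (t := U) (by
    refine Finset.union_subset (Finset.union_subset ?_ (Finset.filter_subset _ _))
      (Finset.filter_subset _ _)
    intro x hx
    simp only [Finset.mem_insert, Finset.mem_singleton] at hx
    rcases hx with rfl | rfl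
    exacts [h.isCore.mem hU, h.symm.isCore.mem hU])
  rw [Finset.card_union_of_disjoint hd2, Finset.card_union_of_disjoint hd1] at h3
  omega

/-- An end `u` of the core through which two triples avoid its core neighbour and meet only in `u`.
-/
lemma ch_end_leaf_le (h : C.core u v) (hu : ∀ t, C.core u t → t = v)
    (hcl : ∀ u v, C.core u v → ¬ C.clean u v) (h₁ : T₁ ∈ C.ex u v) (h₂ : T₂ ∈ C.ex u v)
    (hd : ∀ y, y ∈ T₁ → y ∈ T₂ → y = u) : C.ch False u ≤ 2 := by
  obtain ⟨hsub, -, hirr⟩ := ex_eq_pair h h₁ h₂ hd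
  have h1 := sum_share_end_le (l := False) h hu
  have h2 : ∑ T ∈ C.ex u v, C.share False u T ≤ (C.ex u v).card := by
    refine (Finset.sum_le_card_nsmul _ _ 1 fun T hT => ?_).trans (by simp)
    obtain ⟨y, z, huy, huz, hyz, rfl⟩ := exists_eq (mem_ex.1 hT).1 (mem_ex.1 hT).2.1
    exact share_ex_le_one h hu hT huy huz hyz (hcl y z)
  have h3 : ((C.ex u v).card : ℚ) ≤ 2 := by
    exact_mod_cast (Finset.card_le_card hsub).trans Finset.card_le_two
  rw [ch_eq_ex_add u v]
  rw [hirr, Finset.card_empty, Nat.cast_zero] at h1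
  linarith

/-- If the core graph is a matching with two edges `u`, `v` and `u'`, `v'`, then an element that
forms triples with both of them gets at most `2`. As each pair lies in at least four triples, at
most `|U| - 6` elements fail to form a triple with it, apart from the pair itself. -/
lemma sum_ch_le_of_two_edges {u' v' : V} (hU : ∀ T ∈ C.H, T ⊆ U)
    (hcl : ∀ u v, C.core u v → ¬ C.clean u v) (hd : ∀ u v t, C.core u v → C.core u t → v = t)
    (hle : ∀ x ∈ U, C.ch False x ≤ 3) (h : C.core u v) (h' : C.core u' v') (h1 : u' ≠ u)
    (h2 : u' ≠ v) : ∑ x ∈ U, C.ch False x ≤ 4 * U.card - 8 := by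
  have h3 : v' ≠ u := by rintro rfl; exact h2 (hd _ _ _ h'.symm h)
  have h4 : v' ≠ v := by rintro rfl; exact h1 (hd _ _ _ h'.symm h.symm)
  have huv := h.1
  have huv' := h'.1
  set R := U \ {u, v, u', v'} with hR
  set B := U.filter fun x => x ≠ u ∧ x ≠ v ∧ {u, v, x} ∉ C.H with hB
  set B' := U.filter fun x => x ≠ u' ∧ x ≠ v' ∧ {u', v', x} ∉ C.H with hB'
  have c1 : B.card + 6 ≤ U.card := card_nonleaf_add_six_le hU h
  have c2 : B'.card + 6 ≤ U.card := card_nonleaf_add_six_le hU h'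
  have c3 : R.card + 4 = U.card := by
    have hsub : ({u, v, u', v'} : Finset V) ⊆ U := by
      intro x hx
      simp only [Finset.mem_insert, Finset.mem_singleton] at hx
      rcases hx with rfl | rfl | rfl | rfl
      exacts [h.isCore.mem hU, h.symm.isCore.mem hU, h'.isCore.mem hU, h'.symm.isCore.mem hU]
    have e : ({u, v, u', v'} : Finset V).card = 4 := by
      rw [Finset.card_insert_of_notMem (by simp; grind), Finset.card_insert_of_notMem (by
        simp; grind), Finset.card_insert_of_notMem (by simp; grind), Finset.card_singleton]
    rw [← e]
    exact Finset.card_sdiff_add_card_eq_card hsub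
  have c4 : R.card ≤ (R \ (B ∪ B')).card + (B.card + B'.card) :=
    (Finset.card_le_card_sdiff_add_card (s := R) (t := B ∪ B')).trans
      (Nat.add_le_add_left (Finset.card_union_le _ _) _)
  have hgood : ∀ x ∈ R \ (B ∪ B'), C.ch False x ≤ 2 := by
    intro x hx
    simp only [hR, hB, hB', Finset.mem_sdiff, Finset.mem_union, Finset.mem_filter,
      Finset.mem_insert, Finset.mem_singleton] at hx
    have e1 : ({u, v, x} : Finset V) = {x, u, v} := by ext; simp; tauto
    have e2 : ({u', v', x} : Finset V) = {x, u', v'} := by ext; simp; tauto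
    have x1 : {x, u, v} ∈ C.H := by rw [← e1]; tauto
    have x2 : {x, u', v'} ∈ C.H := by rw [← e2]; tauto
    by_cases hn : C.isCore x
    · obtain ⟨p, hp⟩ := hn
      have key : ∀ u v, C.core u v → x ≠ u → x ≠ v → p ≠ u := by
        rintro u v h hxu hxv rfl
        exact hxv (hd _ _ _ hp.symm h)
      have p1 := key u v h (by tauto) (by tauto)
      have p2 := key v u h.symm (by tauto) (by tauto)
      have p3 := key u' v' h' (by tauto) (by tauto)
      have p4 := key v' u' h'.symm (by tauto) (by tauto)
      have p5 := hp.1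
      refine ch_end_leaf_le hp (fun t ht => hd _ _ _ ht hp) hcl
        (mem_ex.2 ⟨x1, by simp, by simp; grind⟩) (mem_ex.2 ⟨x2, by simp, by simp; grind⟩) ?_
      intro y; simp; grind
    · exact ch_common_leaf_le hn h (fun t ht => hd _ _ _ ht h) (fun t ht => hd _ _ _ ht h.symm) h'
        (fun t ht => hd _ _ _ ht h') (fun t ht => hd _ _ _ ht h'.symm) (hcl _ _ h) (hcl _ _ h')
        ⟨h1, h2, h3, h4⟩ x1 x2
  have hfin : ∑ x ∈ U, C.ch False x ≤ 3 * U.card - (R \ (B ∪ B')).card := by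
    refine sum_le_sub_slack (S := R \ (B ∪ B')) (fun x hx => ?_) hle ?_
    · exact (Finset.mem_sdiff.1 (Finset.mem_sdiff.1 hx).1).1
    · have := Finset.sum_le_card_nsmul _ _ _ hgood
      rw [nsmul_eq_mul] at this
      linarith
  have c6 : 8 ≤ (R \ (B ∪ B')).card + U.card := by omega
  have : (8 : ℚ) ≤ (R \ (B ∪ B')).card + U.card := by exact_mod_cast c6
  linarith

/-- If the core graph has exactly one edge and there are at most seven elements, then `3` for each
element is too much. Giving the ends the whole weight of the triples without core pairs brings the
other elements down to `5 / 2`, while the two ends still get at most `8` together. -/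
lemma sum_ch_le_of_one_edge (hU : ∀ T ∈ C.H, T ⊆ U) (hcard : U.card ≤ 7) (h : C.core u v)
    (hc : ¬ C.clean u v) (hall : ∀ t, C.isCore t → t = u ∨ t = v)
    (h4 : ∀ x, ∀ T ∈ C.H, x ∈ T → C.far T → C.w T = 4 → ∀ T' ∈ C.H, x ∈ T' → T' ≠ T → ¬ C.far T') :
    ∑ x ∈ U, C.ch True x ≤ 4 * U.card - 8 := by
  have huv := h.1
  have hu : ∀ t, C.core u t → t = v := fun t ht => by
    have := hall t ht.symm.isCore; have := ht.1; grind
  have hv : ∀ t, C.core v t → t = u := fun t ht => by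
    have := hall t ht.symm.isCore; have := ht.1; grind
  have h8 := ch_add_ch_le_eight (l := True) hU hcard h hu hv
  have h6 := card_nonleaf_add_six_le hU h
  set B := U.filter fun x => x ≠ u ∧ x ≠ v ∧ {u, v, x} ∉ C.H with hB
  have hsub : ({u, v} : Finset V) ⊆ U := by
    intro x hx
    simp only [Finset.mem_insert, Finset.mem_singleton] at hx
    rcases hx with rfl | rfl
    exacts [h.isCore.mem hU, h.symm.isCore.mem hU]
  have hR : ∑ x ∈ U \ {u, v}, C.ch True x ≤ (U \ {u, v}).card * (5 / 2) := by
    rw [← nsmul_eq_mul]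
    refine Finset.sum_le_card_nsmul _ _ _ fun x hx => ?_
    simp only [Finset.mem_sdiff, Finset.mem_insert, Finset.mem_singleton] at hx
    have hn : ¬ C.isCore x := fun h => hx.2 (hall x h)
    by_cases hT : {x, u, v} ∈ C.H
    · exact (ch_leaf_le hn h hc hall hT).trans (by norm_num)
    · refine ch_nonleaf_le hn (fun T hT' hxT hp => hT ?_) (h4 x)
      obtain ⟨y, z, hxy, hxz, hyz, rfl, hyz'⟩ := hp.exists_eq hT' hxT hn
      have e : ({x, z, y} : Finset V) = {x, y, z} := congrArg (insert x) (Finset.pair_comm _ _)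
      rcases hall _ hyz'.isCore with rfl | rfl <;> rcases hall _ hyz'.symm.isCore with rfl | rfl
      · exact absurd rfl hyz
      · exact hT'
      · rw [e]; exact hT'
      · exact absurd rfl hyz
  have hL : ∑ x ∈ (U \ {u, v}) \ B, C.ch True x ≤ ((U \ {u, v}) \ B).card * 2 := by
    rw [← nsmul_eq_mul]
    refine Finset.sum_le_card_nsmul _ _ _ fun x hx => ?_
    simp only [hB, Finset.mem_sdiff, Finset.mem_insert, Finset.mem_singleton,
      Finset.mem_filter] at hx
    have e : ({u, v, x} : Finset V) = {x, u, v} := by ext; simp; tauto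
    rw [e] at hx
    exact ch_leaf_le (fun h => hx.1.2 (hall x h)) h hc hall (by tauto)
  have hBle : ∑ x ∈ B, C.ch True x ≤ B.card * (5 / 2) := by
    rw [← nsmul_eq_mul]
    refine Finset.sum_le_card_nsmul _ _ _ fun x hx => ?_
    simp only [hB, Finset.mem_filter] at hx
    have hn : ¬ C.isCore x := fun h => by have := hall x h; tauto
    have e0 : ({u, v, x} : Finset V) = {x, u, v} := by ext; simp; tauto
    rw [e0] at hx
    refine ch_nonleaf_le hn (fun T hT' hxT hp => hx.2.2.2 ?_) (h4 x)
    obtain ⟨y, z, hxy, hxz, hyz, rfl, hyz'⟩ := hp.exists_eq hT' hxT hn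
    have e : ({x, z, y} : Finset V) = {x, y, z} := congrArg (insert x) (Finset.pair_comm _ _)
    rcases hall _ hyz'.isCore with rfl | rfl <;> rcases hall _ hyz'.symm.isCore with rfl | rfl
    · exact absurd rfl hyz
    · exact hT'
    · rw [e]; exact hT'
    · exact absurd rfl hyz
  have hBsub : B ⊆ U \ {u, v} := by
    intro x hx
    simp only [hB, Finset.mem_filter] at hx
    simp only [Finset.mem_sdiff, Finset.mem_insert, Finset.mem_singleton]
    tauto
  have c1 : ((U \ {u, v}).card : ℚ) = U.card - 2 := by
    rw [Finset.card_sdiff_of_subset hsub, Nat.cast_sub (Finset.card_le_card hsub),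
      Finset.card_pair huv]
    norm_num
  have c2 : (((U \ {u, v}) \ B).card : ℚ) = U.card - 2 - B.card := by
    rw [Finset.card_sdiff_of_subset hBsub, Nat.cast_sub (Finset.card_le_card hBsub), c1]
  have c3 : (B.card : ℚ) + 6 ≤ U.card := by exact_mod_cast h6
  have c4 : (6 : ℚ) ≤ U.card := by linarith [(by positivity : (0 : ℚ) ≤ B.card)]
  rw [← Finset.sum_sdiff hsub, ← Finset.sum_sdiff hBsub, Finset.sum_pair huv]
  rw [c2] at hL
  linarith

/-- Each triple of weight `4` off the core meets only triples with core vertices, so that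
`exists_removal` does not apply. -/
def irreducible (C : SignedTriples V) : Prop :=
  ∀ T ∈ C.H, C.far T → C.w T = 4 → ∀ x ∈ T, ∀ T' ∈ C.H, x ∈ T' → T' ≠ T → ¬ C.far T'

/-- Without core pairs, each element gets at most `5 / 2`. -/
lemma sum_w_le_of_no_core (hU : ∀ T ∈ C.H, T ⊆ U) (hirr : C.irreducible)
    (hn : ∀ x, ¬ C.isCore x) : ((∑ T ∈ C.H, C.w T : ℕ) : ℚ) ≤ alphaBound U.card := by
  have h4 := four_mul_sub_le_alphaBound U.card
  have h4' : 4 * (U.card : ℚ) - 4 * cConst U.card ≤ alphaBound U.card := le_max_right _ _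
  have hf : ∀ T, C.far T := fun T y _ => hn y
  rcases le_or_gt U.card 3 with h3 | h3
  · have hH : C.H ⊆ {U} := by
      intro T hT
      rw [Finset.mem_singleton]
      exact Finset.eq_of_subset_of_card_le (hU T hT) (by rw [C.card_eq T hT]; exact h3)
    rcases Finset.subset_singleton_iff.1 hH with h0 | h0
    · rw [h0, Finset.sum_empty, Nat.cast_zero]
      refine le_trans ?_ h4'
      interval_cases hu : U.card <;> norm_num [cConst]
    · have hc : U.card = 3 := C.card_eq U (by rw [h0]; simp)
      rw [h0, Finset.sum_singleton]
      refine w_le_four'.trans (le_trans ?_ h4')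
      rw [hc]; norm_num [cConst]
  · have hle : ((∑ T ∈ C.H, C.w T : ℕ) : ℚ) ≤ U.card * (5 / 2) := by
      rw [← sum_ch (l := False) hU, ← nsmul_eq_mul]
      refine Finset.sum_le_card_nsmul _ _ _ fun x _ => ?_
      have key := sum_cls_le_five_quarters (C := C) (x := x) (l := False) hn
        fun T hT hx hw T' hT' hx' => by
          by_contra hne
          exact hirr T hT (hf T) hw x hx T' hT' hx' hne (hf T')
      rw [ch_eq_sum_cls]
      linarith [key true, key false]
    refine hle.trans ?_
    rcases le_or_gt U.card 5 with h5 | h5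
    · refine le_trans ?_ h4'
      interval_cases hu : U.card <;> norm_num [cConst]
    · refine le_trans ?_ h4
      have : (6 : ℚ) ≤ U.card := by exact_mod_cast h5
      linarith

/-- The bound on the total weight of an irreducible system. -/
lemma sum_w_le_of_irreducible (hU : ∀ T ∈ C.H, T ⊆ U) (hirr : C.irreducible) :
    ((∑ T ∈ C.H, C.w T : ℕ) : ℚ) ≤ alphaBound U.card := by
  have h4 := four_mul_sub_le_alphaBound U.card
  by_cases htri : ∀ x, ¬ C.inTri x
  swap
  · push Not at htri
    obtain ⟨x, p, q, hp, hq, hpq⟩ := htri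
    rw [← sum_ch (l := False) hU]
    exact sum_ch_le_of_triangle hU hp hq hpq
  by_cases hcl : ∀ u v, C.core u v → ¬ C.clean u v
  swap
  · push Not at hcl
    obtain ⟨u, v, huv, hcl⟩ := hcl
    rw [← sum_ch (l := False) hU]
    refine (sum_le_sub_slack (S := {u, v}) (m := 8) ?_ (fun x _ => ch_le_four htri x) ?_).trans h4
    · intro x hx
      simp only [Finset.mem_insert, Finset.mem_singleton] at hx
      rcases hx with rfl | rfl
      exacts [huv.isCore.mem hU, huv.symm.isCore.mem hU]
    · rw [Finset.sum_pair huv.1, Finset.card_pair huv.1]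
      have := ch_clean_le (l := False) huv hcl
      have := ch_clean_le (l := False) huv.symm hcl.symm
      norm_num
      linarith
  by_cases hd : ∀ u v t, C.core u v → C.core u t → v = t
  swap
  · push Not at hd
    obtain ⟨b, a, c, hba, hbc, hac⟩ := hd
    have h := sum_ch_le_of_deg_two hU htri hcl hba hbc hac
    rw [sum_ch hU] at h
    -- the total weight is an integer
    have h' : ((2 * ∑ T ∈ C.H, C.w T + 15 : ℕ) : ℚ) ≤ ((8 * U.card : ℕ) : ℚ) := by
      push_cast at h ⊢; linarith
    have h'' : ∑ T ∈ C.H, C.w T + 8 ≤ 4 * U.card := by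
      have := Nat.cast_le.1 h'; omega
    have : ((∑ T ∈ C.H, C.w T + 8 : ℕ) : ℚ) ≤ ((4 * U.card : ℕ) : ℚ) := by exact_mod_cast h''
    push_cast at this ⊢
    linarith
  by_cases hn : ∀ x, ¬ C.isCore x
  · exact sum_w_le_of_no_core hU hirr hn
  push Not at hn
  obtain ⟨u, v, h⟩ := hn
  have h3 : ∀ x ∈ U, C.ch False x ≤ 3 := by
    intro x _
    by_cases hx : C.isCore x
    · obtain ⟨y, hy⟩ := hx
      exact ch_end_le hy fun t ht => hd _ _ _ ht hy
    · have key := sum_cls_le_three_halves (l := False) hx hcl hd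
        fun T hT hxT hf hw T' hT' hxT' hne => hirr T hT hf hw x hxT T' hT' hxT' hne
      rw [ch_eq_sum_cls]
      linarith [key true, key false]
  by_cases h' : ∃ u', C.isCore u' ∧ u' ≠ u ∧ u' ≠ v
  · obtain ⟨u', ⟨v', h'⟩, h1, h2⟩ := h'
    rw [← sum_ch (l := False) hU]
    exact (sum_ch_le_of_two_edges hU hcl hd h3 h h' h1 h2).trans h4
  push Not at h'
  rcases le_or_gt U.card 7 with h7 | h7
  · rw [← sum_ch (l := True) hU]
    refine (sum_ch_le_of_one_edge hU h7 h (hcl _ _ h) (fun t ht => ?_) ?_).trans h4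
    · by_cases htu : t = u
      · exact Or.inl htu
      · exact Or.inr (h' t ht htu)
    · exact fun x T hT hxT hf hw T' hT' hxT' hne => hirr T hT hf hw x hxT T' hT' hxT' hne
  · rw [← sum_ch (l := False) hU]
    have : ∑ x ∈ U, C.ch False x ≤ U.card * 3 := by
      rw [← nsmul_eq_mul]
      exact Finset.sum_le_card_nsmul _ _ _ h3
    have h8 : (8 : ℚ) ≤ U.card := by exact_mod_cast h7
    linarith

end

end SignedTriples

/-! ### Removing four elements -/

namespace SignedTriples

noncomputable section

open Classical

variable {V : Type*} {C : SignedTriples V} {T T' T₁ T₂ : Finset V} {a b c d t u v x y z : V}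
  {l : Prop} {s : Bool} {U : Finset V}

variable (C) in
/-- The triples meeting `T`, other than `T`. -/
def nbrs (T : Finset V) : Finset (Finset V) := C.H.filter fun T' => T' ≠ T ∧ ∃ x ∈ T, x ∈ T'

lemma mem_nbrs : T' ∈ C.nbrs T ↔ T' ∈ C.H ∧ T' ≠ T ∧ ∃ x ∈ T, x ∈ T' := by simp [nbrs]

/-- A triple meeting a triple of weight `4` shares two elements with it. -/
lemma exists_eq_of_nbrs (hT : T ∈ C.H) (hw : C.w T = 4) (hT' : T' ∈ C.nbrs T) :
    ∃ p q y, p ∈ T ∧ q ∈ T ∧ p ≠ q ∧ y ∉ T ∧ T' = {p, q, y} := by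
  obtain ⟨hH, hne, p, hpT, hp⟩ := mem_nbrs.1 hT'
  obtain ⟨q, hqp, hqT, hq⟩ : ∃ q, q ≠ p ∧ q ∈ T ∧ q ∈ T' := by
    by_contra hcon
    push Not at hcon
    refine not_mono_of_w_eq_four hw hpT (mono_of_conflict hT hH hpT hp fun y hy hy' => ?_)
    by_contra hyp
    exact hcon y hyp hy hy'
  obtain ⟨y, hyp, hyq, rfl⟩ := exists_eq_pair hH hp hq hqp.symm
  refine ⟨p, q, y, hpT, hqT, hqp.symm, fun hy => hne ?_, rfl⟩
  exact (eq_triple hT hpT hqT hy hqp.symm hyp.symm hyq.symm).symm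

/-- The triples meeting a triple `T` of weight `4` without core pairs: if one of them uses both
signs at its two elements of `T`, then there are very few. -/
lemma nbrs_of_not_mono (hT : {a, b, c} ∈ C.H) (hab : a ≠ b) (hac : a ≠ c) (hbc : b ≠ c)
    (hw : C.w {a, b, c} = 4) (hnc : ¬ C.core a b) (hx : x ∉ ({a, b, c} : Finset V))
    (hT' : {a, b, x} ∈ C.H) (ha : ¬ C.mono a {a, b, x}) (hb : ¬ C.mono b {a, b, x}) :
    (C.nbrs {a, b, c}).card ≤ 3 ∨ ∃ y, y ∉ ({a, b, c, x} : Finset V) ∧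
      C.nbrs {a, b, c} = {{a, b, x}, {a, b, y}, {a, c, x}, {b, c, x}} := by
  have hxa : a ≠ x := by rintro rfl; simp at hx
  have hxb : b ≠ x := by rintro rfl; simp at hx
  have hxc : c ≠ x := by rintro rfl; simp at hx
  have hT'n : {a, b, x} ∈ C.nbrs {a, b, c} := by
    refine mem_nbrs.2 ⟨hT', fun e => ?_, a, by simp, by simp⟩
    have : x ∈ ({a, b, c} : Finset V) := by rw [← e]; simp
    exact hx this
  have key : ∀ T'' ∈ C.nbrs {a, b, c}, (a ∈ T'' ∧ b ∈ T'') ∨ T'' = {a, c, x} ∨ T'' = {b, c, x} := by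
    intro T'' hT''
    obtain ⟨p, q, y, hp, hq, hpq, hy, rfl⟩ := exists_eq_of_nbrs hT hw hT''
    have hH := (mem_nbrs.1 hT'').1
    by_cases hin : a ∈ ({p, q, y} : Finset V) ∧ b ∈ ({p, q, y} : Finset V)
    · exact Or.inl hin
    right
    by_cases haT : a ∈ ({p, q, y} : Finset V)
    · left
      have hxT : x ∈ ({p, q, y} : Finset V) := by
        by_contra hxT
        exact ha (mono_of_conflict hT' hH (by simp) haT (by grind))
      exact eq_triple hH haT (by grind) hxT hac hxa hxc
    · right
      have hbT : b ∈ ({p, q, y} : Finset V) := by grind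
      have hxT : x ∈ ({p, q, y} : Finset V) := by
        by_contra hxT
        exact hb (mono_of_conflict hT' hH (by simp) hbT (by grind))
      exact eq_triple hH hbT (by grind) hxT hbc hxb hxc
  by_cases h2 : ∃ T₂ ∈ C.nbrs {a, b, c}, a ∈ T₂ ∧ b ∈ T₂ ∧ T₂ ≠ {a, b, x}
  · obtain ⟨T₂, hT₂, ha₂, hb₂, hne₂⟩ := h2
    obtain ⟨hH₂, hne, -⟩ := mem_nbrs.1 hT₂
    obtain ⟨y, hya, hyb, rfl⟩ := exists_eq_pair hH₂ ha₂ hb₂ hab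
    have hyx : y ≠ x := by rintro rfl; exact hne₂ rfl
    have hyc : y ≠ c := by rintro rfl; exact hne rfl
    have hsub : C.nbrs {a, b, c} ⊆ {{a, b, x}, {a, b, y}, {a, c, x}, {b, c, x}} := by
      intro T'' hT''
      simp only [Finset.mem_insert, Finset.mem_singleton]
      rcases key T'' hT'' with ⟨h1, h2⟩ | h | h
      · by_contra hcon
        push Not at hcon
        -- a fourth triple on `a`, `b` would make it a core pair
        refine hnc ⟨hab, le_trans ?_ (card_le_codeg (A := {{a, b, c}, {a, b, x}, {a, b, y}, T''})
          fun S hS => ?_)⟩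
        · rw [Finset.card_insert_of_notMem, Finset.card_insert_of_notMem,
            Finset.card_insert_of_notMem, Finset.card_singleton]
          · simp only [Finset.mem_singleton]; exact hcon.2.1.symm
          · simp only [Finset.mem_insert, Finset.mem_singleton, not_or]
            exact ⟨hne₂.symm, hcon.1.symm⟩
          · simp only [Finset.mem_insert, Finset.mem_singleton, not_or]
            exact ⟨(mem_nbrs.1 hT'n).2.1.symm, hne.symm, (mem_nbrs.1 hT'').2.1.symm⟩
        · simp only [Finset.mem_insert, Finset.mem_singleton] at hS
          rcases hS with rfl | rfl | rfl | rfl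
          exacts [⟨hT, by simp, by simp⟩, ⟨hT', by simp, by simp⟩, ⟨hH₂, by simp, by simp⟩,
            ⟨(mem_nbrs.1 hT'').1, h1, h2⟩]
      · exact Or.inr (Or.inr (Or.inl h))
      · exact Or.inr (Or.inr (Or.inr h))
    by_cases h4 : 4 ≤ (C.nbrs {a, b, c}).card
    · right
      exact ⟨y, by simp [hya, hyb, hyc, hyx],
        Finset.eq_of_subset_of_card_le hsub (Finset.card_le_four.trans h4)⟩
    · left; omega
  · push Not at h2
    left
    refine (Finset.card_le_card (t := {{a, b, x}, {a, c, x}, {b, c, x}}) fun T'' hT'' => ?_).trans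
      Finset.card_le_three
    simp only [Finset.mem_insert, Finset.mem_singleton]
    rcases key T'' hT'' with ⟨h1, h2'⟩ | h | h
    · exact Or.inl (h2 T'' hT'' h1 h2')
    · exact Or.inr (Or.inl h)
    · exact Or.inr (Or.inr h)

lemma sum_le_four (g : Finset V → ℕ) (i j k m : Finset V) :
    ∑ x ∈ ({i, j, k, m} : Finset (Finset V)), g x ≤ g i + g j + g k + g m := by
  have h : ∀ (i : Finset V) (S : Finset (Finset V)), ∑ x ∈ insert i S, g x ≤ g i + ∑ x ∈ S, g x := by
    intro i S
    by_cases hi : i ∈ S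
    · rw [Finset.insert_eq_of_mem hi]; omega
    · rw [Finset.sum_insert hi]
  have h1 := h i {j, k, m}
  have h2 := h j {k, m}
  have h3 := h k {m}
  rw [Finset.sum_singleton] at h3
  omega

/-- The weight of the triples meeting a triple of weight `4` without core pairs. -/
lemma sum_w_nbrs_le (hT : T ∈ C.H) (hw : C.w T = 4) (hnc : ∀ p ∈ T, ∀ q ∈ T, ¬ C.core p q) :
    ∑ T' ∈ C.nbrs T, C.w T' ≤ 12 ∧
    ((∀ T' ∈ C.nbrs T, ∀ x ∈ T', x ∉ T → C.mono x T') → ∑ T' ∈ C.nbrs T, C.w T' ≤ 6) := by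
  have hcard : (C.nbrs T).card ≤ 3 → ∑ T' ∈ C.nbrs T, C.w T' ≤ 12 := fun h => by
    refine (Finset.sum_le_card_nsmul _ _ 4 fun T' _ => w_le_four).trans ?_
    rw [smul_eq_mul]; omega
  have hcard2 : (∀ T' ∈ C.nbrs T, ∀ x ∈ T', x ∉ T → C.mono x T') → (C.nbrs T).card ≤ 3 →
      ∑ T' ∈ C.nbrs T, C.w T' ≤ 6 := fun hm h => by
    refine (Finset.sum_le_card_nsmul _ _ 2 fun T' hT' => ?_).trans (by rw [smul_eq_mul]; omega)
    obtain ⟨p, q, y, hp, hq, hpq, hy, rfl⟩ := exists_eq_of_nbrs hT hw hT'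
    exact w_le_two (by simp) (hm _ hT' y (by simp) hy)
  by_cases hex : ∃ T' ∈ C.nbrs T, ∃ p q y, p ∈ T ∧ q ∈ T ∧ p ≠ q ∧ y ∉ T ∧ T' = {p, q, y} ∧
      ¬ C.mono p T' ∧ ¬ C.mono q T'
  · obtain ⟨T', hT', a, b, x, ha, hb, hab, hx, rfl, hma, hmb⟩ := hex
    obtain ⟨c, hca, hcb, rfl⟩ := exists_eq_pair hT ha hb hab
    have hH' := (mem_nbrs.1 hT').1
    have hxa : x ≠ a := by rintro rfl; simp at hx
    have hxb : x ≠ b := by rintro rfl; simp at hx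
    have hxc : x ≠ c := by rintro rfl; simp at hx
    rcases nbrs_of_not_mono hT hab hca.symm hcb.symm hw (hnc a ha b hb) hx hH' hma hmb with
      h | ⟨y, hy, he⟩
    · exact ⟨hcard h, fun hm => hcard2 hm h⟩
    · have k2 : {a, b, y} ∈ C.nbrs {a, b, c} := by rw [he]; simp
      have k3 : {a, c, x} ∈ C.nbrs {a, b, c} := by rw [he]; simp
      have k4 : {b, c, x} ∈ C.nbrs {a, b, c} := by rw [he]; simp
      have j2 := (mem_nbrs.1 k2).1
      have j3 := (mem_nbrs.1 k3).1
      have j4 := (mem_nbrs.1 k4).1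
      simp only [Finset.mem_insert, Finset.mem_singleton, not_or] at hy
      have m1 := mono_of_conflict (x := a) j2 j3 (by simp) (by simp) (by grind)
      have m2 := mono_of_conflict (x := a) j3 j2 (by simp) (by simp) (by grind)
      have m3 := mono_of_conflict (x := b) j2 j4 (by simp) (by simp) (by grind)
      have m4 := mono_of_conflict (x := b) j4 j2 (by simp) (by simp) (by grind)
      have w1 : C.w {a, b, x} ≤ 4 := w_le_four
      have w2 : C.w {a, b, y} = 1 := w_eq_one (by simp) (by simp) hab m1 m3
      have w3 : C.w {a, c, x} ≤ 2 := w_le_two (by simp) m2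
      have w4 : C.w {b, c, x} ≤ 2 := w_le_two (by simp) m4
      have hs := sum_le_four C.w {a, b, x} {a, b, y} {a, c, x} {b, c, x}
      rw [← he] at hs
      refine ⟨by omega, fun hm => ?_⟩
      have w1' : C.w {a, b, x} ≤ 2 := w_le_two (by simp) (hm _ hT' x (by simp) hx)
      have w3' : C.w {a, c, x} = 1 :=
        w_eq_one (by simp) (by simp) hxa.symm m2 (hm _ k3 x (by simp) hx)
      have w4' : C.w {b, c, x} = 1 :=
        w_eq_one (by simp) (by simp) hxb.symm m4 (hm _ k4 x (by simp) hx)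
      omega
  · push Not at hex
    obtain ⟨a, b, c, hab, hac, hbc, rfl⟩ := Finset.card_eq_three.1 (C.card_eq T hT)
    have h6 : (C.nbrs {a, b, c}).card ≤ 6 := by
      have hpair : ∀ p ∈ ({a, b, c} : Finset V), ∀ q ∈ ({a, b, c} : Finset V), p ≠ q →
          ((C.nbrs {a, b, c}).filter fun T' => p ∈ T' ∧ q ∈ T').card ≤ 2 := by
        intro p hp q hq hpq
        have h1 := codeg_le_three hpq (hnc p hp q hq)
        have h2 := card_le_codeg (C := C) (u := p) (v := q)
          (A := insert {a, b, c} ((C.nbrs {a, b, c}).filter fun T' => p ∈ T' ∧ q ∈ T'))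
          fun T' hT' => by
            rw [Finset.mem_insert, Finset.mem_filter] at hT'
            rcases hT' with rfl | hT'
            · exact ⟨hT, hp, hq⟩
            · exact ⟨(mem_nbrs.1 hT'.1).1, hT'.2⟩
        rw [Finset.card_insert_of_notMem fun h => (mem_nbrs.1 (Finset.mem_filter.1 h).1).2.1 rfl]
          at h2
        omega
      have p1 := hpair a (by simp) b (by simp) hab
      have p2 := hpair a (by simp) c (by simp) hac
      have p3 := hpair b (by simp) c (by simp) hbc
      have hsub : C.nbrs {a, b, c} ⊆ ((C.nbrs {a, b, c}).filter fun T' => a ∈ T' ∧ b ∈ T') ∪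
          ((C.nbrs {a, b, c}).filter fun T' => a ∈ T' ∧ c ∈ T') ∪
          ((C.nbrs {a, b, c}).filter fun T' => b ∈ T' ∧ c ∈ T') := by
        intro T' hT'
        obtain ⟨p, q, y, hp, hq, hpq, hy, rfl⟩ := exists_eq_of_nbrs hT hw hT'
        simp only [Finset.mem_union, Finset.mem_filter, hT', true_and]
        grind
      have := Finset.card_le_card hsub
      have := Finset.card_union_le
        (((C.nbrs {a, b, c}).filter fun T' => a ∈ T' ∧ b ∈ T') ∪
          ((C.nbrs {a, b, c}).filter fun T' => a ∈ T' ∧ c ∈ T'))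
        ((C.nbrs {a, b, c}).filter fun T' => b ∈ T' ∧ c ∈ T')
      have := Finset.card_union_le ((C.nbrs {a, b, c}).filter fun T' => a ∈ T' ∧ b ∈ T')
        ((C.nbrs {a, b, c}).filter fun T' => a ∈ T' ∧ c ∈ T')
      omega
    constructor
    · refine (Finset.sum_le_card_nsmul _ _ 2 fun T' hT' => ?_).trans (by rw [smul_eq_mul]; omega)
      obtain ⟨p, q, y, hp, hq, hpq, hy, rfl⟩ := exists_eq_of_nbrs hT hw hT'
      by_cases hm : C.mono p {p, q, y}
      · exact w_le_two (by simp) hm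
      · exact w_le_two (by simp : q ∈ _) (hex _ hT' p q y hp hq hpq hy rfl hm)
    · intro hm
      refine (Finset.sum_le_card_nsmul _ _ 1 fun T' hT' => ?_).trans (by rw [smul_eq_mul]; omega)
      obtain ⟨p, q, y, hp, hq, hpq, hy, rfl⟩ := exists_eq_of_nbrs hT hw hT'
      have hmy := hm _ hT' y (by simp) hy
      by_cases hmp : C.mono p {p, q, y}
      · exact (w_eq_one (by simp) (by simp) (by grind) hmp hmy).le
      · exact (w_eq_one (by simp : q ∈ _) (by simp) (by grind)
          (hex _ hT' p q y hp hq hpq hy rfl hmp) hmy).le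

variable (C) in
/-- The triples through `x` disjoint from `T`. -/
def outer (T : Finset V) (x : V) : Finset (Finset V) := C.H.filter fun T' => x ∈ T' ∧ Disjoint T T'

/-- A triple off `T` through the third element of a neighbour of `T` conflicts with it. -/
lemma conflict_outer (hT : T ∈ C.H) (hw : C.w T = 4) (hT' : T' ∈ C.nbrs T) (hx : x ∈ T')
    (hxT : x ∉ T) (hT₁ : T₁ ∈ C.outer T x) :
    C.mono x T' ∧ C.mono x T₁ ∧ ∀ s, C.side x s T' → ¬ C.side x s T₁ := by
  obtain ⟨p, q, y, hp, hq, hpq, hy, rfl⟩ := exists_eq_of_nbrs hT hw hT'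
  have hH := (mem_nbrs.1 hT').1
  rw [outer, Finset.mem_filter] at hT₁
  obtain ⟨h1, h2, h3⟩ := hT₁
  have h4 : ∀ i ∈ ({p, q, y} : Finset V), i ∈ T₁ → i = x := by
    intro i hi hi1
    rw [Finset.disjoint_left] at h3
    have := h3 hp
    have := h3 hq
    grind
  exact ⟨mono_of_conflict hH h1 hx h2 h4, mono_of_conflict h1 hH h2 hx fun i h h' => h4 i h' h,
    conflict hH h1 hx h2 h4⟩

lemma sum_w_outer_le (hT : T ∈ C.H) (hw : C.w T = 4) (hT' : T' ∈ C.nbrs T) (hx : x ∈ T')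
    (hxT : x ∉ T) (hn : ¬ C.isCore x) : ∑ T₁ ∈ C.outer T x, C.w T₁ ≤ 6 := by
  obtain ⟨s, hs⟩ := C.exists_side T' (mem_nbrs.1 hT').1 x hx
  have hsub : C.outer T x ⊆ C.cls x (!s) := by
    intro T₁ hT₁
    have h := (conflict_outer hT hw hT' hx hxT hT₁).2.2 s hs
    rw [outer, Finset.mem_filter] at hT₁
    exact mem_cls.2 ⟨hT₁.1, hT₁.2.1, side_not hT₁.1 hT₁.2.1 h⟩
  have hc := (Finset.card_le_card hsub).trans (card_cls_le hn _)
  refine (Finset.sum_le_card_nsmul _ _ 2 fun T₁ hT₁ => ?_).trans (by rw [smul_eq_mul]; omega)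
  have h := (conflict_outer hT hw hT' hx hxT hT₁).2.1
  rw [outer, Finset.mem_filter] at hT₁
  exact w_le_two hT₁.2.1 h

/-- If a triple of weight `4` off the core meets another triple off the core, then some four
elements meet triples of total weight at most `16`. -/
lemma exists_removal (hT : T ∈ C.H) (hf : C.far T) (hw : C.w T = 4) (hT' : T' ∈ C.nbrs T)
    (hf' : C.far T') : ∃ x, x ∉ T ∧ (∃ T₁ ∈ C.H, x ∈ T₁) ∧
      ∑ T₁ ∈ C.H.filter (fun T₁ => ¬ Disjoint (insert x T) T₁), C.w T₁ ≤ 16 := by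
  have hnc : ∀ p ∈ T, ∀ q ∈ T, ¬ C.core p q := fun p hp q _ h => hf p hp h.isCore
  obtain ⟨n12, n6⟩ := sum_w_nbrs_le hT hw hnc
  have hsplit : ∀ x, ∑ T₁ ∈ C.H.filter (fun T₁ => ¬ Disjoint (insert x T) T₁), C.w T₁ ≤
      4 + ∑ T₁ ∈ C.nbrs T, C.w T₁ + ∑ T₁ ∈ C.outer T x, C.w T₁ := by
    intro x
    have hsub : C.H.filter (fun T₁ => ¬ Disjoint (insert x T) T₁) ⊆
        {T} ∪ (C.nbrs T ∪ C.outer T x) := by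
      intro T₁ hT₁
      rw [Finset.mem_filter, Finset.disjoint_insert_left] at hT₁
      simp only [Finset.mem_union, Finset.mem_singleton, mem_nbrs, outer, Finset.mem_filter]
      by_cases hd : Disjoint T T₁
      · right; right; tauto
      · by_cases he : T₁ = T
        · exact Or.inl he
        · exact Or.inr (Or.inl ⟨hT₁.1, he, Finset.not_disjoint_iff.1 hd⟩)
    have h1 := Finset.sum_le_sum_of_subset (f := C.w) hsub
    have h2 := Finset.sum_union_inter (f := C.w) (s₁ := {T}) (s₂ := C.nbrs T ∪ C.outer T x)
    have h3 := Finset.sum_union_inter (f := C.w) (s₁ := C.nbrs T) (s₂ := C.outer T x)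
    rw [Finset.sum_singleton] at h2
    omega
  by_cases h0 : ∃ x T₁, T₁ ∈ C.nbrs T ∧ x ∈ T₁ ∧ x ∉ T ∧ C.outer T x = ∅
  · obtain ⟨x, T₁, h1, h2, h3, h4⟩ := h0
    refine ⟨x, h3, ⟨T₁, (mem_nbrs.1 h1).1, h2⟩, (hsplit x).trans ?_⟩
    rw [h4, Finset.sum_empty]
    omega
  · push Not at h0
    obtain ⟨p, q, x, hp, hq, hpq, hx, rfl⟩ := exists_eq_of_nbrs hT hw hT'
    refine ⟨x, hx, ⟨_, (mem_nbrs.1 hT').1, by simp⟩, (hsplit x).trans ?_⟩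
    have h6 := n6 fun T₁ hT₁ y hy hyT => by
      obtain ⟨T₂, hT₂⟩ := h0 y T₁ hT₁ hy hyT
      exact (conflict_outer hT hw hT₁ hy hyT hT₂).1
    have := sum_w_outer_le hT hw hT' (by simp) hx (hf' x (by simp))
    omega

/-- The triples disjoint from a set. -/
def remove (C : SignedTriples V) (W : Finset V) : SignedTriples V where
  H := C.H.filter (Disjoint W)
  side := C.side
  card_eq T hT := C.card_eq T (Finset.mem_filter.1 hT).1
  exists_side T hT := C.exists_side T (Finset.mem_filter.1 hT).1
  meet T hT T' hT' := C.meet T (Finset.mem_filter.1 hT).1 T' (Finset.mem_filter.1 hT').1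

/-- The bound on the total weight of a signed triple system. -/
theorem sum_w_le (C : SignedTriples V) (U : Finset V) (hU : ∀ T ∈ C.H, T ⊆ U) :
    ((∑ T ∈ C.H, C.w T : ℕ) : ℚ) ≤ alphaBound U.card := by
  induction hk : U.card using Nat.strong_induction_on generalizing C U with
  | _ k ih =>
    subst hk
    by_cases hirr : C.irreducible
    · exact sum_w_le_of_irreducible hU hirr
    unfold irreducible at hirr
    push Not at hirr
    obtain ⟨T, hT, hf, hw, y, hy, T', hT', hy', hne, hf'⟩ := hirr
    obtain ⟨x, hx, ⟨T₁, hT₁, hx₁⟩, hle⟩ := exists_removal hT hf hw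
      (mem_nbrs.2 ⟨hT', hne, y, hy, hy'⟩) hf'
    have hW : insert x T ⊆ U := Finset.insert_subset (hU _ hT₁ hx₁) (hU _ hT)
    have hc : (U \ insert x T).card + 4 = U.card := by
      rw [← Finset.card_sdiff_add_card_eq_card hW, Finset.card_insert_of_notMem hx, C.card_eq T hT]
    have hrec := ih _ (by omega) (C.remove (insert x T)) (U \ insert x T) (fun S hS => by
      obtain ⟨h1, h2⟩ := Finset.mem_filter.1 hS
      exact Finset.subset_sdiff.2 ⟨hU S h1, h2.symm⟩) rfl
    have hsum : ∑ T ∈ C.H, C.w T = ∑ T ∈ (C.remove (insert x T)).H, (C.remove (insert x T)).w T +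
        ∑ T₁ ∈ C.H.filter (fun T₁ => ¬ Disjoint (insert x T) T₁), C.w T₁ :=
      (Finset.sum_filter_add_sum_filter_not _ _ _).symm
    have h4 := alphaBound_add_four (U \ insert x T).card
    rw [hc] at h4
    have : ((∑ T₁ ∈ C.H.filter (fun T₁ => ¬ Disjoint (insert x T) T₁), C.w T₁ : ℕ) : ℚ) ≤ 16 := by
      exact_mod_cast hle
    rw [hsum, Nat.cast_add]
    exact (add_le_add hrec this).trans h4

end

end SignedTriples

/-! ### Independent sets of `G_n` as signed triple systems -/

open Classical in
/-- The support of a vector. -/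
noncomputable def supp {n : ℕ} (v : EuclideanSpace ℝ (Fin n)) : Finset (Fin n) :=
  Finset.univ.filter fun i => v i ≠ 0

section

open Classical

variable {n : ℕ} {u v : EuclideanSpace ℝ (Fin n)} {i j k : Fin n} {T : Finset (Fin n)}

lemma mem_supp : i ∈ supp v ↔ v i ≠ 0 := by simp [supp]

lemma inner_eq_sum (u v : EuclideanSpace ℝ (Fin n)) : inner ℝ u v = ∑ i, u i * v i := by
  simp [PiLp.inner_apply, mul_comm]

lemma eq_one_or_of_mem_supp (hv : v ∈ vertexSet n) (hi : i ∈ supp v) : v i = 1 ∨ v i = -1 := by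
  have := hv.1 i
  have := mem_supp.1 hi
  tauto

lemma inner_self_of_mem (hv : v ∈ vertexSet n) : inner ℝ v v = (3 : ℝ) := by
  rw [real_inner_self_eq_norm_sq, hv.2, Real.sq_sqrt (by norm_num)]

lemma card_supp (hv : v ∈ vertexSet n) : (supp v).card = 3 := by
  have h1 := inner_self_of_mem hv
  have h2 : ∑ i, v i * v i = ∑ i, if v i ≠ 0 then (1 : ℝ) else 0 := by
    refine Finset.sum_congr rfl fun i _ => ?_
    rcases hv.1 i with h | h | h <;> norm_num [h]
  rw [inner_eq_sum, h2, Finset.sum_boole] at h1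
  exact Nat.cast_injective (R := ℝ) (by rw [supp, h1]; norm_num)

lemma inner_eq_of_supp_inter (h : ∀ j, j ∈ supp u → j ∈ supp v → j = i) :
    inner ℝ u v = u i * v i := by
  rw [inner_eq_sum]
  refine Finset.sum_eq_single i (fun j _ hj => ?_) (by simp)
  by_contra hne
  rw [mul_eq_zero, not_or] at hne
  exact hj (h j (mem_supp.2 hne.1) (mem_supp.2 hne.2))

/-- The sign coded by a Boolean. -/
def signOf (s : Bool) : ℝ := if s then 1 else -1

lemma not_adj_of_mem {F : Finset (vertexSet n)} (hF : (graphG n).IsIndepSet F) {u v : vertexSet n}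
    (hu : u ∈ F) (hv : v ∈ F) : inner ℝ u.1 v.1 ≠ (1 : ℝ) := by
  intro h
  by_cases huv : u = v
  · subst huv
    rw [inner_self_of_mem u.2] at h
    norm_num at h
  · exact hF hu hv huv h

/-- The supports of the vectors of an independent set, with the signs that occur. -/
noncomputable def SignedTriples.ofIndep (F : Finset (vertexSet n))
    (hF : (graphG n).IsIndepSet F) : SignedTriples (Fin n) where
  H := F.image fun v : vertexSet n => supp v.1
  side x s T := ∃ v ∈ F, supp v.1 = T ∧
    v.1 x = signOf s
  card_eq T hT := by
    obtain ⟨v, -, rfl⟩ := Finset.mem_image.1 hT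
    exact card_supp v.2
  exists_side T hT x hx := by
    obtain ⟨v, hv, rfl⟩ := Finset.mem_image.1 hT
    rcases eq_one_or_of_mem_supp v.2 hx with h | h
    · exact ⟨true, v, hv, rfl, by simp [signOf, h]⟩
    · exact ⟨false, v, hv, rfl, by simp [signOf, h]⟩
  meet := by
    rintro T - T' - x s hx hx' ⟨u, hu, rfl, hus⟩ ⟨v, hv, rfl, hvs⟩
    by_contra hcon
    push Not at hcon
    refine not_adj_of_mem hF hu hv ?_
    rw [inner_eq_of_supp_inter (i := x) fun j hj hj' => by
      by_contra hne
      exact hcon j hne hj hj', hus, hvs]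
    cases s <;> simp [signOf]

/-- Two vectors of an independent set with the same support do not differ in just one
coordinate. -/
lemma eq_of_agree {F : Finset (vertexSet n)} (hF : (graphG n).IsIndepSet F) {u v : vertexSet n}
    (hu : u ∈ F) (hv : v ∈ F) (huT : supp u.1 = {i, j, k})
    (hvT : supp v.1 = {i, j, k}) (hij : i ≠ j) (hik : i ≠ k)
    (hjk : j ≠ k) (hi : u.1 i = v.1 i)
    (hj : u.1 j = v.1 j) : u = v := by
  have hzero : ∀ w : vertexSet n, supp w.1 = {i, j, k} →
      ∀ t, t ∉ ({i, j, k} : Finset (Fin n)) → w.1 t = 0 := by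
    intro w hw t ht
    by_contra h
    exact ht (hw ▸ mem_supp.2 h)
  have hne := not_adj_of_mem hF hu hv
  have hsum : inner ℝ u.1 v.1 = ∑ t ∈ ({i, j, k} : Finset (Fin n)),
      u.1 t * v.1 t := by
    rw [inner_eq_sum]
    refine (Finset.sum_subset (Finset.subset_univ _) fun t _ ht => ?_).symm
    rw [hzero u huT t ht, zero_mul]
  rw [hsum, Finset.sum_insert (by simp [hij, hik]), Finset.sum_insert (by simp [hjk]),
    Finset.sum_singleton, hi, hj] at hne
  have ui := eq_one_or_of_mem_supp v.2 (i := i) (by rw [hvT]; simp)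
  have uj := eq_one_or_of_mem_supp v.2 (i := j) (by rw [hvT]; simp)
  have uk := eq_one_or_of_mem_supp u.2 (i := k) (by rw [huT]; simp)
  have vk := eq_one_or_of_mem_supp v.2 (i := k) (by rw [hvT]; simp)
  have hk : u.1 k = v.1 k := by
    rcases ui with ui | ui <;> rcases uj with uj | uj <;> rcases uk with uk | uk <;>
      rcases vk with vk | vk <;> rw [uk, vk] <;> rw [ui, uj, uk, vk] at hne <;> norm_num at hne
  apply Subtype.ext
  ext t
  by_cases ht : t ∈ ({i, j, k} : Finset (Fin n))
  · simp only [Finset.mem_insert, Finset.mem_singleton] at ht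
    rcases ht with rfl | rfl | rfl <;> assumption
  · rw [hzero u huT t ht, hzero v hvT t ht]

/-- At an element where only one sign occurs, the vectors with the given support agree. -/
lemma agree_of_mono {F : Finset (vertexSet n)} (hF : (graphG n).IsIndepSet F) {u v : vertexSet n}
    (hu : u ∈ F) (hv : v ∈ F) (huT : supp u.1 = T)
    (hvT : supp v.1 = T) (hi : i ∈ T)
    (hm : (SignedTriples.ofIndep F hF).mono i T) :
    u.1 i = v.1 i := by
  obtain ⟨s, hs⟩ := hm
  have key : ∀ w ∈ F, supp w.1 = T →
      w.1 i = signOf (!s) := by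
    intro w hw hwT
    have h1 : w.1 i ≠ signOf s := fun h => hs ⟨w, hw, hwT, h⟩
    rcases eq_one_or_of_mem_supp w.2 (i := i) (by rw [hwT]; exact hi) with h | h <;>
      cases s <;> simp_all [signOf]
  rw [key u hu huT, key v hv hvT]

/-- The weight of a triple bounds the number of vectors on it. -/
lemma card_fiber_le_w {F : Finset (vertexSet n)} (hF : (graphG n).IsIndepSet F)
    (hT : T.card = 3) :
    (F.filter fun v : vertexSet n => supp v.1 = T).card ≤
      (SignedTriples.ofIndep F hF).w T := by
  set A := F.filter fun v : vertexSet n => supp v.1 = T with hA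
  set C := SignedTriples.ofIndep F hF with hC
  have hA' : ∀ v ∈ A, v ∈ F ∧ supp v.1 = T := fun v hv => by
    rwa [hA, Finset.mem_filter] at hv
  -- code the signs at two elements that determine the vector
  have code : ∀ v ∈ A, ∀ i ∈ T, v.1 i =
      signOf (decide (v.1 i = 1)) := by
    intro v hv i hi
    rcases eq_one_or_of_mem_supp v.2 (i := i) (by rw [(hA' v hv).2]; exact hi) with h | h
    · simp [signOf, h]
    · rw [h]; norm_num [signOf]
  have dec : ∀ u ∈ A, ∀ v ∈ A, ∀ i ∈ T, decide (u.1 i = 1) =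
      decide (v.1 i = 1) →
      u.1 i = v.1 i := by
    intro u hu v hv i hi h
    rw [code u hu i hi, code v hv i hi, h]
  have agree : ∀ i ∈ T, ∀ j ∈ T, i ≠ j → ∀ u ∈ A, ∀ v ∈ A,
      u.1 i = v.1 i →
      u.1 j = v.1 j → u = v := by
    intro i hi j hj hij u hu v hv h1 h2
    obtain ⟨k, hk⟩ : ∃ k, k ∈ (T.erase i).erase j := by
      apply Finset.card_pos.1
      rw [Finset.card_erase_of_mem (Finset.mem_erase.2 ⟨hij.symm, hj⟩),
        Finset.card_erase_of_mem hi, hT]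
      norm_num
    simp only [Finset.mem_erase] at hk
    have e : T = {i, j, k} := by
      symm
      refine Finset.eq_of_subset_of_card_le ?_ ?_
      · intro t ht
        simp only [Finset.mem_insert, Finset.mem_singleton] at ht
        rcases ht with rfl | rfl | rfl
        exacts [hi, hj, hk.2.2]
      · rw [hT, Finset.card_eq_three.2 ⟨i, j, k, hij, hk.2.1.symm, hk.1.symm, rfl⟩]
    have hu' := hA' u hu
    have hv' := hA' v hv
    exact eq_of_agree hF hu'.1 hv'.1 (hu'.2.trans e) (hv'.2.trans e) hij hk.2.1.symm hk.1.symm h1 h2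
  have mono_agree : ∀ i ∈ T, C.mono i T → ∀ u ∈ A, ∀ v ∈ A,
      u.1 i = v.1 i := by
    intro i hi hm u hu v hv
    have hu' := hA' u hu
    have hv' := hA' v hv
    exact agree_of_mono hF hu'.1 hv'.1 hu'.2 hv'.2 hi hm
  unfold SignedTriples.w
  split_ifs with h0 h1
  · obtain ⟨i, hi, j, hj, hij⟩ := Finset.one_lt_card.1 (by rw [hT]; norm_num : 1 < T.card)
    have := Finset.card_le_card_of_injOn (s := A) (t := (Finset.univ : Finset (Bool × Bool)))
      (fun v => (decide (v.1 i = 1),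
        decide (v.1 j = 1))) (fun _ _ => Finset.mem_univ _)
      (fun u hu v hv h => by
        obtain ⟨h1, h2⟩ := Prod.ext_iff.1 h
        exact agree i hi j hj hij u hu v hv (dec u hu v hv i hi h1) (dec u hu v hv j hj h2))
    simpa using this
  · obtain ⟨i, hi⟩ := Finset.card_pos.1 (by rw [h1]; norm_num : 0 < (T.filter (C.mono · T)).card)
    rw [Finset.mem_filter] at hi
    obtain ⟨j, hj⟩ := Finset.card_pos.1 (by rw [Finset.card_erase_of_mem hi.1, hT]; norm_num :
      0 < (T.erase i).card)
    rw [Finset.mem_erase] at hj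
    have := Finset.card_le_card_of_injOn (s := A) (t := (Finset.univ : Finset Bool))
      (fun v => decide (v.1 j = 1)) (fun _ _ => Finset.mem_univ _)
      (fun u hu v hv h => agree i hi.1 j hj.2 hj.1.symm u hu v hv (mono_agree i hi.1 hi.2 u hu v hv)
        (dec u hu v hv j hj.2 h))
    simpa using this
  · obtain ⟨i, hi, j, hj, hij⟩ := Finset.one_lt_card.1
      (by omega : 1 < (T.filter (C.mono · T)).card)
    rw [Finset.mem_filter] at hi hj
    rw [Finset.card_le_one]
    intro u hu v hv
    exact agree i hi.1 j hj.1 hij u hu v hv (mono_agree i hi.1 hi.2 u hu v hv)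
      (mono_agree j hj.1 hj.2 u hu v hv)

/-- The upper bound for independent sets of `G_n`. -/
lemma card_le_alphaBound {F : Finset (vertexSet n)} (hF : (graphG n).IsIndepSet F) :
    (F.card : ℚ) ≤ alphaBound n := by
  have h := SignedTriples.sum_w_le (SignedTriples.ofIndep F hF) Finset.univ
    fun T _ => Finset.subset_univ T
  rw [Finset.card_univ, Fintype.card_fin] at h
  refine le_trans ?_ h
  have h1 := Finset.card_eq_sum_card_image (fun v : vertexSet n => supp v.1) F
  have h2 : F.card ≤ ∑ T ∈ (SignedTriples.ofIndep F hF).H, (SignedTriples.ofIndep F hF).w T := by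
    rw [h1]
    exact Finset.sum_le_sum fun T hT => card_fiber_le_w hF
      ((SignedTriples.ofIndep F hF).card_eq T hT)
  exact_mod_cast h2

end

/-! ### Large independent sets -/

/-- The vectors `f i` lie in `V_n`, and they are distinct and pairwise non-adjacent in `G_n`; stated
with integer coordinates, so that small cases are decidable. -/
def IsIndepFamily {ι : Type*} {n : ℕ} (f : ι → Fin n → ℤ) : Prop :=
  (∀ i j, f i j = -1 ∨ f i j = 0 ∨ f i j = 1) ∧ (∀ i, f i ⬝ᵥ f i = 3) ∧
    ∀ i j, i ≠ j → f i ⬝ᵥ f j ≠ 1 ∧ f i ⬝ᵥ f j ≠ 3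

/-- The point of Euclidean space with the given integer coordinates. -/
noncomputable def intPoint {n : ℕ} (f : Fin n → ℤ) : EuclideanSpace ℝ (Fin n) :=
  WithLp.toLp 2 fun j => (f j : ℝ)

lemma inner_intPoint {n : ℕ} (f g : Fin n → ℤ) :
    inner ℝ (intPoint f) (intPoint g) = ((f ⬝ᵥ g : ℤ) : ℝ) := by
  rw [inner_eq_sum, dotProduct]
  push_cast
  rfl

lemma intPoint_injective {n : ℕ} : Function.Injective (intPoint (n := n)) := by
  intro f g h
  funext j
  have : (intPoint f) j = (intPoint g) j := by rw [h]
  exact Int.cast_injective (α := ℝ) this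

lemma intPoint_mem_vertexSet {n : ℕ} {f : Fin n → ℤ} (h1 : ∀ j, f j = -1 ∨ f j = 0 ∨ f j = 1)
    (h2 : f ⬝ᵥ f = 3) : intPoint f ∈ vertexSet n := by
  refine ⟨fun j => ?_, ?_⟩
  · change ((f j : ℤ) : ℝ) = -1 ∨ ((f j : ℤ) : ℝ) = 0 ∨ ((f j : ℤ) : ℝ) = 1
    rcases h1 j with h | h | h <;> simp [h]
  · rw [@norm_eq_sqrt_real_inner, inner_intPoint, h2]
    norm_num

lemma exists_eq_intPoint {n : ℕ} {v : EuclideanSpace ℝ (Fin n)} (hv : v ∈ vertexSet n) :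
    ∃ f : Fin n → ℤ, v = intPoint f ∧ ∀ j, f j ∈ ({-1, 0, 1} : Finset ℤ) := by
  have h : ∀ j, ∃ z : ℤ, z ∈ ({-1, 0, 1} : Finset ℤ) ∧ (z : ℝ) = v j := by
    intro j
    rcases hv.1 j with h | h | h
    · exact ⟨-1, by simp, by simp [h]⟩
    · exact ⟨0, by simp, by simp [h]⟩
    · exact ⟨1, by simp, by simp [h]⟩
  choose f hf hv' using h
  refine ⟨f, ?_, hf⟩
  ext j
  exact (hv' j).symm

lemma finite_vertexSet (n : ℕ) : (vertexSet n).Finite := by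
  refine ((Finset.finite_toSet (Fintype.piFinset fun _ : Fin n => ({-1, 0, 1} : Finset ℤ))).image
    intPoint).subset ?_
  intro v hv
  obtain ⟨f, rfl, hf⟩ := exists_eq_intPoint hv
  exact ⟨f, by simpa [Fintype.mem_piFinset] using hf, rfl⟩

instance (n : ℕ) : Finite (vertexSet n) := finite_vertexSet n

lemma IsIndepFamily.card_le_indepNum {ι : Type*} [Fintype ι] {n : ℕ} {f : ι → Fin n → ℤ}
    (hf : IsIndepFamily f) :
    Fintype.card ι ≤ (graphG n).indepNum := by
  classical
  let F : ι → vertexSet n := fun i => ⟨intPoint (f i), intPoint_mem_vertexSet (hf.1 i) (hf.2.1 i)⟩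
  have hF : Function.Injective F := by
    intro i j hij
    by_contra hne
    have h := intPoint_injective (congrArg Subtype.val hij)
    exact (hf.2.2 i j hne).2 (h ▸ hf.2.1 i)
  have hI : (graphG n).IsIndepSet (Finset.univ.image F : Finset (vertexSet n)) := by
    intro u hu v hv huv
    simp only [Finset.coe_image, Finset.coe_univ, Set.image_univ, Set.mem_range] at hu hv
    obtain ⟨i, rfl⟩ := hu
    obtain ⟨j, rfl⟩ := hv
    change ¬ inner ℝ (intPoint (f i)) (intPoint (f j)) = 1
    rw [inner_intPoint]
    intro h
    exact (hf.2.2 i j fun h => huv (h ▸ rfl)).1 (by exact_mod_cast h)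
  have := hI.card_le_indepNum
  rwa [Finset.card_image_of_injective _ hF, Finset.card_univ] at this

lemma append_dotProduct_append {m n : ℕ} (a c : Fin n → ℤ) (b d : Fin m → ℤ) :
    Fin.append a b ⬝ᵥ Fin.append c d = a ⬝ᵥ c + b ⬝ᵥ d := by
  simp [dotProduct, Fin.sum_univ_add]

lemma append_mem {m n : ℕ} {a : Fin n → ℤ} {b : Fin m → ℤ}
    (ha : ∀ j, a j = -1 ∨ a j = 0 ∨ a j = 1) (hb : ∀ j, b j = -1 ∨ b j = 0 ∨ b j = 1)
    (j : Fin (n + m)) : Fin.append a b j = -1 ∨ Fin.append a b j = 0 ∨ Fin.append a b j = 1 := by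
  refine Fin.addCases (fun i => ?_) (fun i => ?_) j
  · simpa using ha i
  · simpa using hb i

/-- The union of two families with disjoint supports. -/
lemma IsIndepFamily.append {ι κ : Type*} {m n : ℕ} {f : ι → Fin n → ℤ} {g : κ → Fin m → ℤ}
    (hf : IsIndepFamily f) (hg : IsIndepFamily g) :
    IsIndepFamily (Sum.elim (fun i => Fin.append (f i) 0) fun k => Fin.append 0 (g k) :
      ι ⊕ κ → Fin (n + m) → ℤ) := by
  refine ⟨?_, ?_, ?_⟩
  · rintro (i | k)
    · exact append_mem (hf.1 i) fun _ => Or.inr (Or.inl rfl)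
    · exact append_mem (fun _ => Or.inr (Or.inl rfl)) (hg.1 k)
  · rintro (i | k)
    · simp [append_dotProduct_append, hf.2.1]
    · simp [append_dotProduct_append, hg.2.1]
  · rintro (i | k) (j | l) h
    · simpa [append_dotProduct_append] using hf.2.2 i j fun e => h (e ▸ rfl)
    · simp [append_dotProduct_append]
    · simp [append_dotProduct_append]
    · simpa [append_dotProduct_append] using hg.2.2 k l fun e => h (e ▸ rfl)

/-- Some independent set of `G_n`, given with integer coordinates, has `k` vectors. -/
def HasIndepFamily (n k : ℕ) : Prop := ∃ f : Fin k → Fin n → ℤ, IsIndepFamily f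

lemma IsIndepFamily.hasIndepFamily {ι : Type*} [Fintype ι] {n k : ℕ} {f : ι → Fin n → ℤ}
    (hf : IsIndepFamily f) (hk : Fintype.card ι = k) : HasIndepFamily n k := by
  let e := (Fintype.equivFinOfCardEq hk).symm
  exact ⟨f ∘ e, fun i => hf.1 (e i), fun i => hf.2.1 (e i), fun i j h =>
    hf.2.2 (e i) (e j) fun h' => h (e.injective h')⟩

lemma HasIndepFamily.le_indepNum {n k : ℕ} (h : HasIndepFamily n k) :
    k ≤ (graphG n).indepNum := by
  obtain ⟨f, hf⟩ := h
  simpa using hf.card_le_indepNum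

lemma HasIndepFamily.add {m n k l : ℕ} (h : HasIndepFamily n k) (h' : HasIndepFamily m l) :
    HasIndepFamily (n + m) (k + l) := by
  obtain ⟨f, hf⟩ := h
  obtain ⟨g, hg⟩ := h'
  exact (hf.append hg).hasIndepFamily (by simp)

lemma hasIndepFamily_zero (n : ℕ) : HasIndepFamily n 0 :=
  ⟨fun i => i.elim0, fun i => i.elim0, fun i => i.elim0, fun i => i.elim0⟩

lemma hasIndepFamily_three : HasIndepFamily 3 4 :=
  ⟨![![1, 1, 1], ![1, -1, -1], ![-1, 1, -1], ![-1, -1, 1]], by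
    unfold IsIndepFamily; decide⟩

/-- On four coordinates, all vectors with an even number of negative entries. -/
lemma hasIndepFamily_four : HasIndepFamily 4 16 :=
  ⟨![![1, 1, 1, 0], ![1, -1, -1, 0], ![-1, 1, -1, 0], ![-1, -1, 1, 0],
    ![1, 1, 0, 1], ![1, -1, 0, -1], ![-1, 1, 0, -1], ![-1, -1, 0, 1],
    ![1, 0, 1, 1], ![1, 0, -1, -1], ![-1, 0, 1, -1], ![-1, 0, -1, 1],
    ![0, 1, 1, 1], ![0, 1, -1, -1], ![0, -1, 1, -1], ![0, -1, -1, 1]], by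
    unfold IsIndepFamily; decide⟩

lemma hasIndepFamily_four_mul (q : ℕ) : HasIndepFamily (4 * q) (16 * q) := by
  induction q with
  | zero => exact hasIndepFamily_zero 0
  | succ q ih => exact ih.add hasIndepFamily_four

/-- Blocks of four coordinates give `4 (n - c(n))` vectors. -/
lemma four_mul_le_indepNum (n : ℕ) : 4 * n ≤ (graphG n).indepNum + 4 * cConst n := by
  have key : ∀ r k, n % 4 = r → HasIndepFamily r k → 16 * (n / 4) + k ≤ (graphG n).indepNum := by
    intro r k hr h
    have := ((hasIndepFamily_four_mul (n / 4)).add h).le_indepNum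
    rwa [← hr, Nat.div_add_mod] at this
  have hr : n % 4 = 0 ∨ n % 4 = 1 ∨ n % 4 = 2 ∨ n % 4 = 3 := by omega
  unfold cConst
  rcases hr with h | h | h | h
  · have := key _ _ h (hasIndepFamily_zero _)
    simp only [h, if_true]
    omega
  · have := key _ _ h (hasIndepFamily_zero _)
    norm_num [h]
    omega
  · have := key _ _ h (hasIndepFamily_zero _)
    norm_num [h]
    omega
  · have := key _ _ h hasIndepFamily_three
    norm_num [h]
    omega

/-- Three differences `e_a - e_b` running around each of two triangles. -/
def triangleDiff : Fin 6 → Fin 6 → ℤ :=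
  ![![1, -1, 0, 0, 0, 0], ![0, 1, -1, 0, 0, 0], ![-1, 0, 1, 0, 0, 0],
    ![0, 0, 0, 1, -1, 0], ![0, 0, 0, 0, 1, -1], ![0, 0, 0, -1, 0, 1]]

/-- The sign, depending on the triangle, of the coordinate outside the two triangles. -/
def triangleSign : Fin 6 → ℤ := ![1, 1, 1, -1, -1, -1]

/-- The vectors supported by one of the two triangles with an even number of negative entries. -/
def triangleFull : Fin 8 → Fin 6 → ℤ :=
  ![![1, 1, 1, 0, 0, 0], ![1, -1, -1, 0, 0, 0], ![-1, 1, -1, 0, 0, 0], ![-1, -1, 1, 0, 0, 0],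
    ![0, 0, 0, 1, 1, 1], ![0, 0, 0, 1, -1, -1], ![0, 0, 0, -1, 1, -1], ![0, 0, 0, -1, -1, 1]]

/-- Two triangles, each joined to all other coordinates, give `6 (n - 6) + 8` vectors. -/
lemma isIndepFamily_triangles (m : ℕ) :
    IsIndepFamily (Sum.elim
      (fun p => Fin.append (triangleDiff p.1) (Pi.single p.2 (triangleSign p.1)))
      (fun j => Fin.append (triangleFull j) 0) : (Fin 6 × Fin m) ⊕ Fin 8 → Fin (6 + m) → ℤ) := by
  have hs : ∀ k, triangleSign k = -1 ∨ triangleSign k = 0 ∨ triangleSign k = 1 := by decide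
  have hss : ∀ k, triangleSign k * triangleSign k = 1 := by decide
  have hdd : ∀ k, triangleDiff k ⬝ᵥ triangleDiff k = 2 := by decide
  have hne : ∀ k l, triangleDiff k ⬝ᵥ triangleDiff l ≠ 1 ∧ triangleDiff k ⬝ᵥ triangleDiff l ≠ 3 := by
    decide
  have hne' : ∀ k l, k ≠ l →
      triangleDiff k ⬝ᵥ triangleDiff l + triangleSign k * triangleSign l ≠ 1 ∧
        triangleDiff k ⬝ᵥ triangleDiff l + triangleSign k * triangleSign l ≠ 3 := by
    decide
  have hdf : ∀ k j, triangleDiff k ⬝ᵥ triangleFull j ≠ 1 ∧ triangleDiff k ⬝ᵥ triangleFull j ≠ 3 := by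
    decide
  have hff : ∀ i j, i ≠ j →
      triangleFull i ⬝ᵥ triangleFull j ≠ 1 ∧ triangleFull i ⬝ᵥ triangleFull j ≠ 3 := by
    decide
  refine ⟨?_, ?_, ?_⟩
  · rintro (⟨k, x⟩ | j)
    · refine append_mem ?_ fun y => ?_
      · exact (by decide : ∀ k j, triangleDiff k j = -1 ∨ triangleDiff k j = 0 ∨
          triangleDiff k j = 1) k
      · by_cases h : y = x
        · subst h
          simpa using hs k
        · simp [h]
    · refine append_mem ?_ fun y => Or.inr (Or.inl rfl)
      revert j; decide
  · rintro (⟨k, x⟩ | j)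
    · simp [append_dotProduct_append, hdd, hss]
    · simp only [Sum.elim_inr, append_dotProduct_append, dotProduct_zero, add_zero]
      revert j; decide
  · rintro (⟨k, x⟩ | i) (⟨l, y⟩ | j) h
    · simp only [Sum.elim_inl, append_dotProduct_append, dotProduct_single]
      by_cases hxy : x = y
      · subst hxy
        rw [Pi.single_eq_same]
        exact hne' k l fun e => h (by rw [e])
      · rw [Pi.single_eq_of_ne (Ne.symm hxy), zero_mul, add_zero]
        exact hne k l
    · simpa [append_dotProduct_append] using hdf k j
    · simpa [append_dotProduct_append, dotProduct_comm] using hdf l i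
    · simpa [append_dotProduct_append] using hff i j fun e => h (e ▸ rfl)

lemma six_mul_le_indepNum {n : ℕ} (hn : 6 ≤ n) : 6 * n ≤ (graphG n).indepNum + 28 := by
  obtain ⟨m, rfl⟩ := Nat.exists_eq_add_of_le hn
  have := (isIndepFamily_triangles m).card_le_indepNum
  simp only [Fintype.card_sum, Fintype.card_prod, Fintype.card_fin] at this
  omega

/-- The independence number of `G_n`. -/
lemma indepNum_graphG (n : ℕ) : ((graphG n).indepNum : ℚ) = alphaBound n := by
  apply le_antisymm
  · obtain ⟨F, hF⟩ := (graphG n).exists_isNIndepSet_indepNum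
    rw [← hF.card_eq]
    exact card_le_alphaBound hF.isIndepSet
  · have h4 : (4 * n : ℚ) ≤ (graphG n).indepNum + 4 * cConst n := by
      exact_mod_cast four_mul_le_indepNum n
    refine max_le ?_ (by linarith)
    by_cases hn : 6 ≤ n
    · have h6 : (6 * n : ℚ) ≤ (graphG n).indepNum + 28 := by
        exact_mod_cast six_mul_le_indepNum hn
      linarith
    · have h1 : (n : ℚ) ≤ 5 := by exact_mod_cast (by omega : n ≤ 5)
      have h2 : (cConst n : ℚ) ≤ 2 := by exact_mod_cast cConst_le_two n
      linarith

/-! ### The number of vertices -/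

/-- The vector with value `-1` on `N`, value `1` on `P \ N`, and `0` elsewhere. -/
def signVector {n : ℕ} (P N : Finset (Fin n)) (j : Fin n) : ℤ :=
  if j ∈ P then if j ∈ N then -1 else 1 else 0

lemma ncard_vertexSet (n : ℕ) : (vertexSet n).ncard = 8 * n.choose 3 := by
  classical
  let S : Finset (Σ _ : Finset (Fin n), Finset (Fin n)) :=
    (Finset.powersetCard 3 Finset.univ).sigma fun P => P.powerset
  have hS : ∀ p, p ∈ S ↔ p.1.card = 3 ∧ p.2 ⊆ p.1 := by
    intro p
    simp [S, Finset.mem_powersetCard]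
  have hcard : S.card = 8 * n.choose 3 := by
    rw [Finset.card_sigma, Finset.sum_congr rfl (g := fun _ => 8) fun P hP => by
      rw [Finset.card_powerset, (Finset.mem_powersetCard.1 hP).2]; norm_num]
    simp [Finset.card_powersetCard, mul_comm]
  have hinj : Set.InjOn (fun p : Σ _ : Finset (Fin n), Finset (Fin n) =>
      intPoint (signVector p.1 p.2)) S := by
    rintro ⟨P, N⟩ hp ⟨P', N'⟩ hp' h
    have hN := ((hS _).1 hp).2
    have hN' := ((hS _).1 hp').2
    have h' := fun j => congrFun (intPoint_injective h) j
    have hP : P = P' := by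
      ext j
      have := h' j
      simp only [signVector] at this
      split_ifs at this <;> simp_all
    subst hP
    have hNN : N = N' := by
      ext j
      have := h' j
      have h1 := @hN j
      have h2 := @hN' j
      simp only [signVector] at this
      split_ifs at this <;> simp_all
    rw [hNN]
  have himage : vertexSet n = (fun p : Σ _ : Finset (Fin n), Finset (Fin n) =>
      intPoint (signVector p.1 p.2)) '' S := by
    ext v
    constructor
    · intro hv
      refine ⟨⟨supp v, Finset.univ.filter fun j => v j = -1⟩, ?_, ?_⟩
      · refine (hS _).2 ⟨card_supp hv, fun j hj => ?_⟩
        rw [Finset.mem_filter] at hj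
        exact mem_supp.2 (by rw [hj.2]; norm_num)
      · ext j
        change ((signVector _ _ j : ℤ) : ℝ) = v j
        rcases hv.1 j with h | h | h <;> norm_num [signVector, mem_supp, h]
    · rintro ⟨⟨P, N⟩, hp, rfl⟩
      have hp := (hS _).1 hp
      refine intPoint_mem_vertexSet (fun j => ?_) ?_
      · simp only [signVector]
        split_ifs <;> simp
      · have : ∀ j, signVector P N j * signVector P N j = if j ∈ P then 1 else 0 := by
          intro j
          simp only [signVector]
          split_ifs <;> simp
        simp only [dotProduct, this, Finset.sum_boole, Finset.filter_mem_eq_inter,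
          Finset.univ_inter, hp.1]
        rfl
  rw [himage, hinj.ncard_image, Set.ncard_coe_finset, hcard]

/-! ### Chromatic numbers -/

lemma chiQ_le_chiR (n : ℕ) : chiQ n ≤ chiR n :=
  SimpleGraph.chromaticNumber_mono_of_hom (SimpleGraph.Embedding.induce _).toHom

/-- Adjacent vectors of `G_n` are at distance `2`, so halving maps `G_n` to the unit distance graph
on the rational points. -/
lemma chromaticNumber_graphG_le_chiQ (n : ℕ) : (graphG n).chromaticNumber ≤ chiQ n := by
  refine SimpleGraph.chromaticNumber_mono_of_hom
    (⟨fun v => ⟨(1 / 2 : ℝ) • v.1, fun j => ?_⟩, ?_⟩ :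
      graphG n →g (unitDistanceGraph n).induce (rationalPoints n))
  · rcases v.2.1 j with h | h | h
    · exact ⟨-1 / 2, by simp [h]; norm_num⟩
    · exact ⟨0, by simp [h]⟩
    · exact ⟨1 / 2, by simp [h]⟩
  · intro u v h
    change inner ℝ u.1 v.1 = (1 : ℝ) at h
    change dist ((1 / 2 : ℝ) • u.1) ((1 / 2 : ℝ) • v.1) = 1
    have h1 : ‖u.1 - v.1‖ ^ 2 = 2 ^ 2 := by
      rw [norm_sub_sq_real, h, u.2.2, v.2.2, Real.sq_sqrt (by norm_num)]
      norm_num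
    have h2 : ‖u.1 - v.1‖ = 2 := by
      rwa [sq_eq_sq₀ (norm_nonneg _) (by norm_num)] at h1
    rw [dist_eq_norm, ← smul_sub, norm_smul, h2]
    norm_num

/-- Each colour class of a graph is an independent set. -/
lemma SimpleGraph.Coloring.card_le_mul_indepNum {V : Type*} [Fintype V] {G : SimpleGraph V} {k : ℕ}
    (c : G.Coloring (Fin k)) : Fintype.card V ≤ k * G.indepNum := by
  classical
  have h := Finset.card_le_mul_card_image_of_maps_to (s := (Finset.univ : Finset V))
    (t := (Finset.univ : Finset (Fin k))) (f := c) (fun _ _ => Finset.mem_univ _) G.indepNum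
    fun i _ => by
      refine SimpleGraph.IsIndepSet.card_le_indepNum fun u hu v hv _ => ?_
      simp only [Finset.coe_filter, Finset.mem_univ, true_and, Set.mem_ofPred_eq] at hu hv
      exact fun h => c.valid h (hu.trans hv.symm)
  simpa [mul_comm] using h

lemma exists_chromaticNumber_graphG (n : ℕ) : ∃ k : ℕ, (graphG n).chromaticNumber = (k : ℕ∞) ∧
    (vertexSet n).ncard ≤ k * (graphG n).indepNum := by
  classical
  have := Fintype.ofFinite (vertexSet n)
  have hc : (graphG n).Colorable (Fintype.card (vertexSet n)) := (graphG n).colorable_of_fintype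
  obtain ⟨k, hk⟩ := ENat.ne_top_iff_exists.1
    (SimpleGraph.chromaticNumber_ne_top_iff_exists.2 ⟨_, hc⟩)
  have hk' : (graphG n).Colorable k := SimpleGraph.chromaticNumber_le_iff_colorable.1 hk.ge
  refine ⟨k, hk.symm, ?_⟩
  have := hk'.some.card_le_mul_indepNum
  rwa [← Nat.card_eq_fintype_card] at this

/-- A numerical form of the bound: it suffices to compare `(k - 1) α(G_n)` with `|V_n|`. -/
lemma le_chiQ {n k : ℕ} {a : ℚ} (ha : alphaBound n = a) (h : (k - 1 : ℚ) * a < 8 * n.choose 3) :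
    (k : ℕ∞) ≤ chiQ n := by
  refine le_trans ?_ (chromaticNumber_graphG_le_chiQ n)
  obtain ⟨l, hl, hle⟩ := exists_chromaticNumber_graphG n
  rw [hl]
  rw [ncard_vertexSet] at hle
  have hle' : (8 * n.choose 3 : ℚ) ≤ l * (graphG n).indepNum := by exact_mod_cast hle
  rw [indepNum_graphG, ha] at hle'
  have ha0 : 0 ≤ a := by
    rw [← ha, ← indepNum_graphG]
    exact Nat.cast_nonneg _
  have hlt : (k - 1 : ℚ) < l := lt_of_mul_lt_mul_right (h.trans_le hle') ha0
  have : (k : ℚ) < (l + 1 : ℕ) := by push_cast; linarith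
  exact_mod_cast Nat.lt_succ_iff.1 (by exact_mod_cast this)

theorem theorem2 :
    (∀ n : ℕ, 3 ≤ n →
      chiQ n ≤ chiR n ∧
      (graphG n).chromaticNumber ≤ chiQ n ∧
      (∃ k : ℕ, (graphG n).chromaticNumber = (k : ℕ∞) ∧
        ((vertexSet n).ncard : ℝ) / ((graphG n).indepNum : ℝ) ≤ (k : ℝ)) ∧
      ((vertexSet n).ncard : ℝ) / ((graphG n).indepNum : ℝ)
        = 8 * (n.choose 3 : ℝ) / max (6 * (n : ℝ) - 28) (4 * (n : ℝ) - 4 * (cConst n : ℝ))) ∧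
    (21 ≤ chiQ 9 ∧ chiQ 9 ≤ chiR 9) ∧
    (30 ≤ chiQ 10 ∧ chiQ 10 ≤ chiR 10) ∧
    (35 ≤ chiQ 11 ∧ chiQ 11 ≤ chiR 11) ∧
    (37 ≤ chiQ 12 ∧ chiQ 12 ≤ chiR 12) := by
  refine ⟨fun n hn => ⟨chiQ_le_chiR n, chromaticNumber_graphG_le_chiQ n, ?_, ?_⟩,
    ⟨?_, chiQ_le_chiR 9⟩, ⟨?_, chiQ_le_chiR 10⟩, ⟨?_, chiQ_le_chiR 11⟩, ⟨?_, chiQ_le_chiR 12⟩⟩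
  · obtain ⟨k, hk, hle⟩ := exists_chromaticNumber_graphG n
    refine ⟨k, hk, div_le_of_le_mul₀ (Nat.cast_nonneg _) (Nat.cast_nonneg _) ?_⟩
    exact_mod_cast hle
  · have h : ((graphG n).indepNum : ℝ) = ((alphaBound n : ℚ) : ℝ) := by
      rw [← indepNum_graphG, Rat.cast_natCast]
    rw [ncard_vertexSet, h, alphaBound]
    push_cast
    rfl
  · exact le_chiQ (n := 9) (k := 21) (a := 32) (by norm_num [alphaBound, cConst])
      (by norm_num [Nat.choose])
  · exact le_chiQ (n := 10) (k := 30) (a := 32) (by norm_num [alphaBound, cConst])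
      (by norm_num [Nat.choose])
  · exact le_chiQ (n := 11) (k := 35) (a := 38) (by norm_num [alphaBound, cConst])
      (by norm_num [Nat.choose])
  · exact le_chiQ (n := 12) (k := 37) (a := 48) (by norm_num [alphaBound, cConst])
      (by norm_num [Nat.choose])
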